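/- Machine model. Algorithms are programs (finite instruction lists) of a randomized random access machine with an integer memory (instructions charged by the bit lengths of the integers and computed addresses involved), a real memory (exact $+,-,\times$ and comparison at unit cost, no rounding to integers), and access to independent fair coins. For $d\ge 1$, $\Delta\ge 2$ let $[\Delta]^d=\{1,\dots,\Delta\}^d$ with the Euclidean distance. A dynamic weighted set $X\subseteq[\Delta]^d$, $w:X\to\mathbb R_{\ge 0}$, is initially empty and undergoes insertions of a point with a weight (replacing the weight if the point is present) and deletions of a point (no effect if absent). For $B\subseteq X$ and $c\in\mathbb R^d$ put $w(B)=\sum_{y\in B}w(y)$, $\mathrm{cost}(B,c)=\sum_{y\in B}w(y)\,\mathrm{dist}(y,c)^2$ and $\mathrm{OPT}_1(B)=\inf_{c\in\mathbb R^d}\mathrm{cost}(B,c)$. Theorem. There is an absolute constant $K$ such that for every $\kappa\in\mathbb N$ there is $C\in\mathbb N$ (depending only on $\kappa$) such that for every $0<\epsilon<1$ there is one program which, started with any parameters $d\ge1$, $\Delta\ge2$, maintains a dynamic weighted set $X\subseteq[\Delta]^d$ under insertions, deletions and queries $(x,r)$ with $x\in[\Delta]^d$ and real $r\ge 0$, with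 the following guarantees against every adaptive adversary, i.e. one that chooses each request (update or query) depending on all previous answers. Correctness: the program always halts, and to every query $(x,r)$ it returns a real number $b_x\ge 0$, a center $c^\star\in[\Delta]^d$ and estimates $\widehat{\mathrm{cost}}_{c^\star},\widehat{\mathrm{cost}}_x$ for which there is a set $B_x\subseteq X$ with 1. $\{y\in X:\mathrm{dist}(x,y)\le r\}\subseteq B_x\subseteq\{y\in X:\mathrm{dist}(x,y)\le K\epsilon^{-3/2}r\}$ and $b_x=w(B_x)$; 2. $\mathrm{cost}(B_x,c)\le\widehat{\mathrm{cost}}_c\le K\,\mathrm{cost}(B_x,c)$ for both $c=c^\star$ and $c=x$; 3. $\mathrm{cost}(B_x,c^\star)\le K\,\mathrm{OPT}_1(B_x)$. Running time: let $T=C\cdot 2^{\epsilon d}\,(d\,\epsilon^{-1}\log_2\Delta)^C$, that is, $T=\tilde O(2^{\epsilon d})$. With probability at least $1-\Delta^{-\kappa d}$, throughout the whole (infinite) interaction, every query takes time at most $T$, and after any number of requests, $u$ of which were updates, the total time of the initialization and these updates is at most $T\cdot(1+u)$. -/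

import Mathlib

open scoped NNReal ENNReal

namespace OneMeans

/-! ### The machine: a randomized random access machine

It has an integer memory and a real memory, both indexed by `ℕ`.  Integer instructions (also those
that compute addresses) are charged logarithmic cost, that is, the bit lengths of the integers
involved.  The real memory supports exact addition, subtraction, multiplication and comparison at
unit cost; there is no rounding, no real constant, and no conversion from reals to integers.
Randomness is a tape of fair coins, read one bit at a time. -/

/-- Arithmetic on natural numbers (`sub` is truncated, `div` is the floor of the quotient). -/
inductive NatOp | add | sub | mul | div

def NatOp.eval : NatOp → ℕ → ℕ → ℕ
  | .add, a, b => a + b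
  | .sub, a, b => a - b
  | .mul, a, b => a * b
  | .div, a, b => a / b

/-- Arithmetic on reals. -/
inductive RealOp | add | sub | mul

noncomputable def RealOp.eval : RealOp → ℝ → ℝ → ℝ
  | .add, a, b => a + b
  | .sub, a, b => a - b
  | .mul, a, b => a * b

/-- Instructions; `M` is the integer memory and `R` the real memory. -/
inductive Instr
  /-- `M[i] := n` -/
  | const (i n : ℕ)
  /-- `M[i] := M[M[j]]` -/
  | load (i j : ℕ)
  /-- `M[M[i]] := M[j]` -/
  | store (i j : ℕ)
  /-- `M[i] := op M[j] M[k]` -/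
  | nat (op : NatOp) (i j k : ℕ)
  /-- `M[i] :=` the next fair coin -/
  | coin (i : ℕ)
  /-- jump to line `l` if `M[i] < M[j]` -/
  | jlt (i j l : ℕ)
  /-- `R[i] := M[j]` -/
  | rcast (i j : ℕ)
  /-- `R[i] := R[M[j]]` -/
  | rload (i j : ℕ)
  /-- `R[M[i]] := R[j]` -/
  | rstore (i j : ℕ)
  /-- `R[i] := op R[j] R[k]` -/
  | real (op : RealOp) (i j k : ℕ)
  /-- jump to line `l` if `R[i] < R[j]` -/
  | rjlt (i j l : ℕ)

/-- A program is a finite list of instructions; it halts by leaving the list. -/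
abbrev Program := List Instr

/-- A machine state: program counter, the two memories, number of coins already read. -/
structure State where
  pc : ℕ
  M : ℕ → ℕ
  R : ℕ → ℝ
  coins : ℕ

/-- The infinite tape of coins. -/
abbrev Coins := ℕ → Bool

/-- Effect of one instruction. -/
noncomputable def Instr.exec (ω : Coins) (s : State) : Instr → State
  | .const i n => { s with pc := s.pc + 1, M := Function.update s.M i n }
  | .load i j => { s with pc := s.pc + 1, M := Function.update s.M i (s.M (s.M j)) }
  | .store i j => { s with pc := s.pc + 1, M := Function.update s.M (s.M i) (s.M j) }
  | .nat op i j k =>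
      { s with pc := s.pc + 1, M := Function.update s.M i (op.eval (s.M j) (s.M k)) }
  | .coin i =>
      { s with pc := s.pc + 1, M := Function.update s.M i (ω s.coins).toNat, coins := s.coins + 1 }
  | .jlt i j l => { s with pc := if s.M i < s.M j then l else s.pc + 1 }
  | .rcast i j => { s with pc := s.pc + 1, R := Function.update s.R i (s.M j : ℝ) }
  | .rload i j => { s with pc := s.pc + 1, R := Function.update s.R i (s.R (s.M j)) }
  | .rstore i j => { s with pc := s.pc + 1, R := Function.update s.R (s.M i) (s.R j) }
  | .real op i j k =>
      { s with pc := s.pc + 1, R := Function.update s.R i (op.eval (s.R j) (s.R k)) }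
  | .rjlt i j l =>
      open scoped Classical in { s with pc := if s.R i < s.R j then l else s.pc + 1 }

/-- Cost of one instruction (`Nat.size` is the bit length). -/
def Instr.cost (s : State) : Instr → ℕ
  | .const _ n => 1 + n.size
  | .load _ j => 1 + (s.M j).size + (s.M (s.M j)).size
  | .store i j => 1 + (s.M i).size + (s.M j).size
  | .nat _ _ j k => 1 + (s.M j).size + (s.M k).size
  | .coin _ => 1
  | .jlt i j _ => 1 + (s.M i).size + (s.M j).size
  | .rcast _ j => 1 + (s.M j).size
  | .rload _ j => 1 + (s.M j).size
  | .rstore i _ => 1 + (s.M i).size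
  | .real _ _ _ _ => 1
  | .rjlt _ _ _ => 1

/-- One step of a program; nothing happens once the program counter is outside the program. -/
noncomputable def step (P : Program) (ω : Coins) (s : State) : State :=
  match P[s.pc]? with
  | none => s
  | some I => I.exec ω s

/-- Cost of the step made in state `s`. -/
def stepCost (P : Program) (s : State) : ℕ :=
  match P[s.pc]? with
  | none => 0
  | some I => I.cost s

/-- The program, started in `s`, halts. -/
def Halts (P : Program) (ω : Coins) (s : State) : Prop :=
  ∃ n, P.length ≤ ((step P ω)^[n] s).pc

/-- Number of steps until the program halts (meaningful if `Halts P ω s`). -/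
noncomputable def haltTime (P : Program) (ω : Coins) (s : State) : ℕ :=
  sInf {n | P.length ≤ ((step P ω)^[n] s).pc}

/-- The halting state of the run started in `s`. -/
noncomputable def run (P : Program) (ω : Coins) (s : State) : State :=
  (step P ω)^[haltTime P ω s] s

/-- The running time of the run started in `s`. -/
noncomputable def runCost (P : Program) (ω : Coins) (s : State) : ℕ :=
  ∑ n ∈ Finset.range (haltTime P ω s), stepCost P ((step P ω)^[n] s)

/-- The law of the coin tape: independent fair coins. -/
noncomputable def coinMeasure : MeasureTheory.Measure Coins :=
  MeasureTheory.Measure.infinitePi fun _ => (PMF.uniformOfFintype Bool).toMeasure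

/-! ### Weighted point sets in the grid `[Δ]^d` -/

/-- The grid `[Δ]^d = {1, …, Δ}^d`. -/
abbrev Grid (d Δ : ℕ) := Fin d → Finset.Icc 1 Δ

/-- A grid point as a point of Euclidean space. -/
noncomputable def Grid.pt {d Δ : ℕ} (x : Grid d Δ) : EuclideanSpace ℝ (Fin d) :=
  WithLp.toLp 2 fun i => ((x i : ℕ) : ℝ)

/-- A weighted point set: a set of grid points and their weights
(the values of `w` outside `pts` are irrelevant). -/
structure WSet (d Δ : ℕ) where
  pts : Finset (Grid d Δ)
  w : Grid d Δ → ℝ≥0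

/-- `cost(B, c) = ∑_{y ∈ B} w(y) · dist(y, c)²`. -/
noncomputable def cost {d Δ : ℕ} (w : Grid d Δ → ℝ≥0) (B : Finset (Grid d Δ))
    (c : EuclideanSpace ℝ (Fin d)) : ℝ :=
  ∑ y ∈ B, (w y : ℝ) * dist y.pt c ^ 2

/-- The optimal 1-means cost, over all centers in Euclidean space. -/
noncomputable def opt₁ {d Δ : ℕ} (w : Grid d Δ → ℝ≥0) (B : Finset (Grid d Δ)) : ℝ :=
  ⨅ c : EuclideanSpace ℝ (Fin d), cost w B c

/-! ### Requests and answers -/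

/-- The requests: insert a point with its weight, delete a point, query a point and a radius. -/
inductive Request (d Δ : ℕ)
  | insert (x : Grid d Δ) (weight : ℝ≥0)
  | delete (x : Grid d Δ)
  | query (x : Grid d Δ) (r : ℝ≥0)

namespace Request
variable {d Δ : ℕ}

def isQuery : Request d Δ → Bool
  | insert _ _ => false
  | delete _ => false
  | query _ _ => true

/-- Code of the request: `1` for insertions, `2` for deletions, `3` for queries. -/
def code : Request d Δ → ℕ
  | insert _ _ => 1
  | delete _ => 2
  | query _ _ => 3

def point : Request d Δ → Grid d Δ
  | insert x _ => x
  | delete x => x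
  | query x _ => x

/-- The real number that comes with the request. -/
noncomputable def number : Request d Δ → ℝ
  | insert _ v => v
  | delete _ => 0
  | query _ r => r

/-- Effect of a request on the point set.  Inserting a point that is present replaces its weight;
deleting a point that is absent does nothing. -/
def apply (X : WSet d Δ) : Request d Δ → WSet d Δ
  | insert x v => ⟨Insert.insert x X.pts, Function.update X.w x v⟩
  | delete x => ⟨X.pts.erase x, X.w⟩
  | query _ _ => X

end Request

/-- The answer to a query: the weight, the center `c⋆`, and the cost estimates for `c⋆` and for the
query point. -/
structure Answer (d : ℕ) where
  weight : ℝ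
  center : Fin d → ℕ
  costCenter : ℝ
  costPoint : ℝ

/-- `a` is a correct answer to the query `(x, r)` on the weighted set `X`. -/
def Answer.Correct {d Δ : ℕ} (K ε : ℝ) (X : WSet d Δ) (x : Grid d Δ) (r : ℝ≥0)
    (a : Answer d) : Prop :=
  ∃ c : Grid d Δ, (∀ i, a.center i = c i) ∧
  ∃ B : Finset (Grid d Δ), B ⊆ X.pts ∧
    (∀ y ∈ X.pts, dist x.pt y.pt ≤ r → y ∈ B) ∧
    (∀ y ∈ B, dist x.pt y.pt ≤ K * ε ^ (-(3 / 2) : ℝ) * r) ∧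
    a.weight = ∑ y ∈ B, (X.w y : ℝ) ∧
    (cost X.w B c.pt ≤ a.costCenter ∧ a.costCenter ≤ K * cost X.w B c.pt) ∧
    (cost X.w B x.pt ≤ a.costPoint ∧ a.costPoint ≤ K * cost X.w B x.pt) ∧
    cost X.w B c.pt ≤ K * opt₁ X.w B

/-! ### Interaction of a program with an adaptive adversary

Cell `0` of the integer memory receives the code of the request (`0` for the initialization), and the
cells `1, 3, 5, …` receive the coordinates of its point (for the initialization, cell `1` holds `d`
and cell `3` holds `Δ`).  Cell `0` of the real memory receives the weight or the radius.
A center is returned in the cells `1, 3, 5, …`, the three real values in the real cells `0, 1, 2`.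
The memory persists between requests. -/

/-- The initial state: all cells are `0`, except those which hold the parameters. -/
noncomputable def initState (d Δ : ℕ) : State where
  pc := 0
  M := fun a => if a = 1 then d else if a = 3 then Δ else 0
  R := fun _ => 0
  coins := 0

/-- Hand a request to the machine and restart the program at its first line. -/
noncomputable def present {d Δ : ℕ} (q : Request d Δ) (s : State) : State where
  pc := 0
  M := fun a =>
    if a = 0 then q.code
    else if h : a % 2 = 1 ∧ a / 2 < d then (q.point ⟨a / 2, h.2⟩ : ℕ)
    else s.M a
  R := Function.update s.R 0 q.number
  coins := s.coins

/-- Read the answer off a halting state. -/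
def readAnswer (d : ℕ) (s : State) : Answer d where
  weight := s.R 0
  center := fun i => s.M (2 * i + 1)
  costCenter := s.R 1
  costPoint := s.R 2

/-- An adaptive adversary chooses the next request from all the outputs seen so far
(one entry per earlier request, `none` for updates). -/
abbrev Adversary (d Δ : ℕ) := List (Option (Answer d)) → Request d Δ

/-- A moment of the interaction: machine state, current point set, outputs so far. -/
structure Config (d Δ : ℕ) where
  state : State
  X : WSet d Δ
  hist : List (Option (Answer d))

section
variable {d Δ : ℕ} (P : Program) (ω : Coins) (A : Adversary d Δ)

/-- The configuration after the initialization and the first `t` requests; `X` is initially empty. -/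
noncomputable def play : ℕ → Config d Δ
  | 0 => ⟨run P ω (initState d Δ), ⟨∅, fun _ => 0⟩, []⟩
  | t + 1 =>
      let g := play t
      let q := A g.hist
      let s := run P ω (present q g.state)
      ⟨s, q.apply g.X, g.hist ++ [if q.isQuery then some (readAnswer d s) else none]⟩

/-- The request number `t` (counted from `0`). -/
noncomputable def request (t : ℕ) : Request d Δ := A (play P ω A t).hist

/-- The state in which the program starts to serve request number `t`. -/
noncomputable def startState (t : ℕ) : State :=
  present (request P ω A t) (play P ω A t).state

/-- The time spent on request number `t`. -/
noncomputable def time (t : ℕ) : ℕ := runCost P ω (startState P ω A t)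

/-- The program always halts and answers all queries correctly. -/
def AlwaysCorrect (K ε : ℝ) : Prop :=
  Halts P ω (initState d Δ) ∧
  ∀ t, Halts P ω (startState P ω A t) ∧
    ∀ x r, request P ω A t = .query x r →
      Answer.Correct K ε (play P ω A t).X x r (readAnswer d (play P ω A (t + 1)).state)

/-- Each query takes time at most `T`; the initialization and the updates take
amortized time at most `T`. -/
def WithinTime (T : ℝ) : Prop :=
  (∀ t, (request P ω A t).isQuery = true → (time P ω A t : ℝ) ≤ T) ∧
  ∀ t, let U := (Finset.range t).filter fun i => (request P ω A i).isQuery = false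
    (runCost P ω (initState d Δ) : ℝ) + ∑ i ∈ U, (time P ω A i : ℝ) ≤ T * (1 + U.card)

end

end OneMeans

/-! The data structure is deterministic. Correctness and the time bound hold for every tape and
every sequence of requests, so an adaptive adversary gains nothing and the failure event is empty.

Fix an integer E of order 1/ε. For each scale i let R = `radius E i`, a quantity that doubles with
i, and measure lengths in units of R/t, where t is least with d ≤ t²E. Cut each axis into cells of
length E units, shifted by one of E offsets j, the same in all coordinates. The resulting cubes have
diameter about √d·E·R/t ≤ E^(3/2)·R. Hence the cubes that come within t units, that is R, of x cover
the ball of radius R and stay inside a ball of radius O(ε^(-3/2))·R (`sum_gap_lt`, `sum_sq_le`). A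
query takes the first scale with R above r, so that R ≤ 2r.

The number of these cubes depends on how close x lies to cell boundaries. Give a partial cube the
weight exp(remaining budget of squared distance). Passing to the next coordinate multiplies the
total weight by at most ∑ exp(-gap²), which a penalty for closeness to the cell ends controls
(`sum_exp_gapAt_le`). Averaging over the E shifts gives a shift of small total penalty
(`exists_shift`), and for it at most exp(2 + 18d/E) = O(2^(εd)) cubes are met in every coordinate
(`length_frontier_le_exp`). The shift is thus chosen at query time, by the query point itself.

For each cube and coordinate a table stores ∑w, ∑wy and ∑wy². Summed over the cubes found, these
moments give the weight and all costs exactly (`moment_eq`, `cost_near`). The center is the mean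
rounded in each coordinate, which costs a factor 4 because the points are integral (`cost_le_opt₁`).
An update touches one cube per scale and shift. The old weight of the point is read at scale 0,
where a cube holds at most one grid point (`TabInv.weight`).

The algorithm is written in a small structured language whose compiler is proved correct together
with its cost (`Exec.run`), so that it remains to count ticks and to bound the stored integers. -/

set_option linter.unusedSimpArgs false

namespace OneMeans

/-! ### Runs of the machine -/

/-- `Steps P ω s s' c`: the program gets from `s` to `s'`, staying inside, at cost `c`. -/
inductive Steps (P : Program) (ω : Coins) : State → State → ℕ → Prop
  | refl (s) : Steps P ω s s 0
  | head {s s' : State} {I : Instr} {c : ℕ} (h : P[s.pc]? = some I)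
      (hs : Steps P ω (I.exec ω s) s' c) : Steps P ω s s' (I.cost s + c)

theorem Steps.trans {P : Program} {ω : Coins} {s₁ s₂ s₃ : State} {c₁ c₂ : ℕ}
    (h : Steps P ω s₁ s₂ c₁) (h' : Steps P ω s₂ s₃ c₂) : Steps P ω s₁ s₃ (c₁ + c₂) := by
  induction h with
  | refl s => simpa using h'
  | head hI _ ih => rw [add_assoc]; exact .head hI (ih h')

/-- Every step of the chain is made at a line of the program, so no earlier state is outside it and
`haltTime` is exactly the length of the chain. -/
theorem Steps.finish {P : Program} {ω : Coins} {s s' : State} {c : ℕ}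
    (h : Steps P ω s s' c) (hpc : P.length ≤ s'.pc) :
    Halts P ω s ∧ run P ω s = s' ∧ runCost P ω s = c := by
  induction h with
  | refl s =>
    have h0 : haltTime P ω s = 0 := Nat.sInf_eq_zero.2 (Or.inl hpc)
    exact ⟨⟨0, hpc⟩, by simp [run, h0], by simp [runCost, h0]⟩
  | @head s s' I c hI hs ih =>
    obtain ⟨⟨n, hn⟩, hr, hc⟩ := ih hpc
    have hstep : step P ω s = I.exec ω s := by simp [step, hI]
    have hlt : s.pc < P.length := by
      by_contra hcon
      rw [List.getElem?_eq_none (by omega)] at hI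
      cases hI
    have hmem : n + 1 ∈ {n | P.length ≤ ((step P ω)^[n] s).pc} := by
      simpa [Function.iterate_succ_apply, hstep] using hn
    have hne : {n | P.length ≤ ((step P ω)^[n] s).pc}.Nonempty := ⟨_, hmem⟩
    have hT : haltTime P ω s = haltTime P ω (I.exec ω s) + 1 := by
      unfold haltTime
      apply le_antisymm
      · apply Nat.sInf_le
        have := Nat.sInf_mem (s := {n | P.length ≤ ((step P ω)^[n] (I.exec ω s)).pc}) ⟨n, hn⟩
        simpa [Function.iterate_succ_apply, hstep] using this
      · have h1 := Nat.sInf_mem hne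
        set m := sInf {n | P.length ≤ ((step P ω)^[n] s).pc} with hm
        cases hm' : m with
        | zero =>
          rw [hm'] at h1
          simp at h1
          omega
        | succ j =>
          rw [hm'] at h1
          have : sInf {n | P.length ≤ ((step P ω)^[n] (I.exec ω s)).pc} ≤ j := by
            apply Nat.sInf_le
            simpa [Function.iterate_succ_apply, hstep] using h1
          omega
    refine ⟨⟨n + 1, hmem⟩, ?_, ?_⟩
    · rw [← hr]
      simp [run, hT, Function.iterate_succ_apply, hstep]
    · rw [← hc]
      simp only [runCost, hT]
      rw [Finset.sum_range_succ']
      simp only [Function.iterate_succ_apply, hstep, Function.iterate_zero, id]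
      simp [stepCost, hI, add_comm]

/-- From `s` the program reaches, at cost at most `c`, a state that satisfies `Q`. -/
def Reach (P : Program) (ω : Coins) (s : State) (c : ℕ) (Q : State → Prop) : Prop :=
  ∃ s' c', Steps P ω s s' c' ∧ c' ≤ c ∧ Q s'

section Reach
variable {P : Program} {ω : Coins} {s : State} {Q Q' : State → Prop} {c c₁ c₂ : ℕ}

theorem Reach.refl (h : Q s) : Reach P ω s c Q := ⟨s, 0, .refl s, Nat.zero_le _, h⟩

/-- Cost is treated as a budget: the unspent part is handed on, and each cost obligation becomes a
linear inequality. -/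
theorem Reach.bind (h : Reach P ω s c₁ Q) (hc : c₁ ≤ c)
    (h' : ∀ s', Q s' → Reach P ω s' (c - c₁) Q') : Reach P ω s c Q' := by
  obtain ⟨s', c', hs, hc', hQ⟩ := h
  obtain ⟨s'', c'', hs', hc'', hQ'⟩ := h' s' hQ
  exact ⟨s'', c' + c'', hs.trans hs', by omega, hQ'⟩

theorem Reach.step {I : Instr} (hI : P[s.pc]? = some I) (hc : I.cost s ≤ c)
    (h : Reach P ω (I.exec ω s) (c - I.cost s) Q) : Reach P ω s c Q := by
  obtain ⟨s', c', hs, hc', hQ⟩ := h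
  exact ⟨s', _, .head hI hs, by omega, hQ⟩

theorem Reach.mono (h : Reach P ω s c₁ Q) (hc : c₁ ≤ c) (hQ : ∀ s', Q s' → Q' s') :
    Reach P ω s c Q' := by
  obtain ⟨s', c', hs, hc', h⟩ := h
  exact ⟨s', c', hs, hc'.trans hc, hQ _ h⟩

end Reach

/-- The instructions `l` stand in the program `P` from line `pc` on. -/
def CodeAt (P : Program) : ℕ → List Instr → Prop
  | _, [] => True
  | pc, I :: l => P[pc]? = some I ∧ CodeAt P (pc + 1) l

theorem codeAt_append {P : Program} {pc : ℕ} {l l' : List Instr} :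
    CodeAt P pc (l ++ l') ↔ CodeAt P pc l ∧ CodeAt P (pc + l.length) l' := by
  induction l generalizing pc with
  | nil => simp [CodeAt]
  | cons I l ih => simp [CodeAt, ih, and_assoc, Nat.add_assoc, Nat.add_comm 1]

theorem codeAt_self (pre l : List Instr) : CodeAt (pre ++ l) pre.length l := by
  induction l generalizing pre with
  | nil => trivial
  | cons I l ih => exact ⟨by simp, by simpa using ih (pre ++ [I])⟩

/-! ### A structured language -/

/-- Memory of structured programs: integer variables, the input array, an integer array,
real variables, a real array. -/
structure Mem where
  n : ℕ → ℕ
  inp : ℕ → ℕ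
  arr : ℕ → ℕ
  r : ℕ → ℝ
  tab : ℕ → ℝ

/-- Integer expressions. -/
inductive NExp
  | lit (n : ℕ)
  | var (v : ℕ)
  | inp (e : NExp)
  | arr (e : NExp)
  | op (o : NatOp) (a b : NExp)

/-- Real expressions. -/
inductive RExp
  | var (v : ℕ)
  | tab (e : NExp)
  | cast (e : NExp)
  | op (o : RealOp) (a b : RExp)

/-- Conditions. -/
inductive Cond
  | nlt (a b : NExp)
  | rlt (a b : RExp)

/-- Commands. -/
inductive Cmd
  | set (v : ℕ) (e : NExp)
  | setInp (i e : NExp)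
  | setArr (i e : NExp)
  | rset (v : ℕ) (e : RExp)
  | setTab (i : NExp) (e : RExp)
  | skip
  | seq (c c' : Cmd)
  | ite (q : Cond) (c c' : Cmd)
  | loop (q : Cond) (c : Cmd)

def NExp.eval (s : Mem) : NExp → ℕ
  | lit n => n
  | var v => s.n v
  | inp e => s.inp (e.eval s)
  | arr e => s.arr (e.eval s)
  | op o a b => o.eval (a.eval s) (b.eval s)

noncomputable def RExp.eval (s : Mem) : RExp → ℝ
  | var v => s.r v
  | tab e => s.tab (e.eval s)
  | cast e => (e.eval s : ℝ)
  | op o a b => o.eval (a.eval s) (b.eval s)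

def Cond.holds (s : Mem) : Cond → Prop
  | nlt a b => a.eval s < b.eval s
  | rlt a b => a.eval s < b.eval s

/-- All integers in memory have at most `b` bits. -/
structure Mem.Small (b : ℕ) (s : Mem) : Prop where
  n : ∀ v, s.n v < 2 ^ b
  inp : ∀ i, s.inp i < 2 ^ b
  arr : ∀ i, s.arr i < 2 ^ b

def Mem.setN (s : Mem) (v x : ℕ) : Mem := { s with n := Function.update s.n v x }
def Mem.setInp (s : Mem) (i x : ℕ) : Mem := { s with inp := Function.update s.inp i x }
def Mem.setArr (s : Mem) (i x : ℕ) : Mem := { s with arr := Function.update s.arr i x }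
noncomputable def Mem.setR (s : Mem) (v : ℕ) (x : ℝ) : Mem :=
  { s with r := Function.update s.r v x }
noncomputable def Mem.setTab (s : Mem) (i : ℕ) (x : ℝ) : Mem :=
  { s with tab := Function.update s.tab i x }

/-- `Exec b c s s' k`: `c` leads from `s` to `s'` in `k` ticks, storing only integers with at most
`b` bits. -/
inductive Exec (b : ℕ) : Cmd → Mem → Mem → ℕ → Prop
  | set {s v e} (h : NExp.eval s e < 2 ^ b) : Exec b (.set v e) s (s.setN v (e.eval s)) 1
  | setInp {s i e} (h : NExp.eval s e < 2 ^ b) :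
      Exec b (.setInp i e) s (s.setInp (i.eval s) (e.eval s)) 1
  | setArr {s i e} (h : NExp.eval s e < 2 ^ b) :
      Exec b (.setArr i e) s (s.setArr (i.eval s) (e.eval s)) 1
  | rset {s v e} : Exec b (.rset v e) s (s.setR v (e.eval s)) 1
  | setTab {s i e} : Exec b (.setTab i e) s (s.setTab (i.eval s) (e.eval s)) 1
  | skip {s} : Exec b .skip s s 0
  | seq {c c' s s' s'' k k'} (h : Exec b c s s' k) (h' : Exec b c' s' s'' k') :
      Exec b (.seq c c') s s'' (k + k')
  | iteTrue {q c c' s s' k} (hq : q.holds s) (h : Exec b c s s' k) :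
      Exec b (.ite q c c') s s' (k + 1)
  | iteFalse {q c c' s s' k} (hq : ¬ q.holds s) (h : Exec b c' s s' k) :
      Exec b (.ite q c c') s s' (k + 1)
  | loopTrue {q c s s' s'' k k'} (hq : q.holds s) (h : Exec b c s s' k)
      (h' : Exec b (.loop q c) s' s'' k') : Exec b (.loop q c) s s'' (k + k' + 1)
  | loopFalse {q c s} (hq : ¬ q.holds s) : Exec b (.loop q c) s s 1

theorem Exec.small {b : ℕ} {c : Cmd} {s s' : Mem} {k : ℕ} (h : Exec b c s s' k)
    (hs : s.Small b) : s'.Small b := by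
  induction h with
  | set h =>
    refine ⟨fun v => ?_, hs.inp, hs.arr⟩
    simp only [Mem.setN, Function.update_apply]; split_ifs <;> simp [h, hs.n]
  | setInp h =>
    refine ⟨hs.n, fun v => ?_, hs.arr⟩
    simp only [Mem.setInp, Function.update_apply]; split_ifs <;> simp [h, hs.inp]
  | setArr h =>
    refine ⟨hs.n, hs.inp, fun v => ?_⟩
    simp only [Mem.setArr, Function.update_apply]; split_ifs <;> simp [h, hs.arr]
  | rset => exact ⟨hs.n, hs.inp, hs.arr⟩
  | setTab => exact ⟨hs.n, hs.inp, hs.arr⟩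
  | skip => exact hs
  | seq _ _ ih ih' => exact ih' (ih hs)
  | iteTrue _ _ ih => exact ih hs
  | iteFalse _ _ ih => exact ih hs
  | loopTrue _ _ _ ih ih' => exact ih' (ih hs)
  | loopFalse => exact hs

/-! ### Compilation -/

/-- Code that leaves the value of an integer expression in cell `4 * k`. -/
def NExp.comp (k : ℕ) : NExp → List Instr
  | lit n => [.const (4 * k) n]
  | var v => [.const (4 * (k + 1)) 0, .nat .add (4 * k) (4 * v) (4 * (k + 1))]
  | inp e => e.comp k ++
      [.nat .add (4 * k) (4 * k) (4 * k), .const (4 * (k + 1)) 1,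
        .nat .add (4 * k) (4 * k) (4 * (k + 1)), .load (4 * k) (4 * k)]
  | arr e => e.comp k ++
      [.nat .add (4 * k) (4 * k) (4 * k), .nat .add (4 * k) (4 * k) (4 * k),
        .const (4 * (k + 1)) 2, .nat .add (4 * k) (4 * k) (4 * (k + 1)), .load (4 * k) (4 * k)]
  | op o a b => a.comp k ++ (b.comp (k + 1) ++ [.nat o (4 * k) (4 * k) (4 * (k + 1))])

/-- Code that leaves the value of a real expression in real cell `2 * k`. -/
def RExp.comp (k : ℕ) : RExp → List Instr
  | var v => [.const 120 0, .rcast (2 * (k + 1)) 120, .real .add (2 * k) (2 * v) (2 * (k + 1))]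
  | tab e => e.comp 30 ++ [.nat .add 120 120 120, .const 124 1, .nat .add 120 120 124,
      .rload (2 * k) 120]
  | cast e => e.comp 30 ++ [.rcast (2 * k) 120]
  | op o a b => a.comp k ++ (b.comp (k + 1) ++ [.real o (2 * k) (2 * k) (2 * (k + 1))])

/-- Code that jumps to line `l` if the condition holds. -/
def Cond.comp (l : ℕ) : Cond → List Instr
  | nlt a b => a.comp 30 ++ (b.comp 31 ++ [.jlt 120 124 l])
  | rlt a b => a.comp 20 ++ (b.comp 21 ++ [.rjlt 40 42 l])

/-- Unconditional jump. -/
def jump (l : ℕ) : List Instr := [.const 120 0, .const 124 1, .jlt 120 124 l]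

/-- Jump targets are computed from code lengths; there is no circularity because lengths do not
depend on targets. -/
theorem Cond.length_comp (q : Cond) (l l' : ℕ) : (q.comp l).length = (q.comp l').length := by
  cases q <;> simp [Cond.comp]

/-- Code for a command, to be placed from line `pc` on. -/
def Cmd.comp (pc : ℕ) : Cmd → List Instr
  | set v e => e.comp 30 ++ [.const 124 0, .nat .add (4 * v) 120 124]
  | setInp i e => i.comp 30 ++ (e.comp 31 ++
      [.nat .add 120 120 120, .const 128 1, .nat .add 120 120 128, .store 120 124])
  | setArr i e => i.comp 30 ++ (e.comp 31 ++
      [.nat .add 120 120 120, .nat .add 120 120 120, .const 128 2, .nat .add 120 120 128,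
        .store 120 124])
  | rset v e => e.comp 20 ++ [.const 120 0, .rcast 42 120, .real .add (2 * v) 40 42]
  | setTab i e => e.comp 20 ++ (i.comp 30 ++
      [.nat .add 120 120 120, .const 124 1, .nat .add 120 120 124, .rstore 120 40])
  | skip => []
  | seq c c' => c.comp pc ++ c'.comp (pc + (c.comp pc).length)
  | ite q c c' =>
      let pc₁ := pc + (q.comp 0).length
      let l₁ := pc₁ + (c'.comp pc₁).length + 3
      q.comp l₁ ++ (c'.comp pc₁ ++ (jump (l₁ + (c.comp l₁).length) ++ c.comp l₁))
  | loop q c =>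
      let l₁ := pc + (q.comp 0).length + 3
      q.comp l₁ ++ (jump (l₁ + (c.comp l₁).length + 3) ++ (c.comp l₁ ++ jump pc))

/-- The machine state `σ` represents the memory `s`. -/
structure Rep (s : Mem) (σ : State) : Prop where
  n : ∀ v < 30, σ.M (4 * v) = s.n v
  inp : ∀ i, σ.M (2 * i + 1) = s.inp i
  arr : ∀ i, σ.M (4 * i + 2) = s.arr i
  r : ∀ v < 20, σ.R (2 * v) = s.r v
  tab : ∀ i, σ.R (2 * i + 1) = s.tab i

/-- The bound, in units of `b` bits, on the size of the value. -/
def NExp.width : NExp → ℕ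
  | op _ a b => a.width + b.width
  | _ => 1

/-- The bound, in units of `b` bits, on the cost of evaluation. -/
def NExp.work : NExp → ℕ
  | lit _ => 2
  | var _ => 3
  | inp e => e.work + 6 * e.width + 12
  | arr e => e.work + 8 * e.width + 22
  | op _ a b => a.work + b.work + a.width + b.width + 1

def RExp.work : RExp → ℕ
  | var _ => 3
  | tab e => e.work + 6 * e.width + 12
  | cast e => e.work + e.width + 1
  | op _ a b => a.work + b.work + 1

def Cond.work : Cond → ℕ
  | nlt a b => a.work + b.work + a.width + b.width + 1
  | rlt a b => a.work + b.work + 1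

def Cmd.work : Cmd → ℕ
  | set _ e => e.work + e.width + 3
  | setInp i e => i.work + e.work + 6 * i.width + e.width + 12
  | setArr i e => i.work + e.work + 8 * i.width + e.width + 22
  | rset _ e => e.work + 4
  | setTab i e => i.work + e.work + 6 * i.width + 12
  | skip => 0
  | seq c c' => max c.work c'.work
  | ite q c c' => max (q.work + 7) (max c.work c'.work)
  | loop q c => max (q.work + 14) c.work

/-- Variables below the temporary cells, literals with at most `b` bits. -/
def NExp.Ok (b : ℕ) : NExp → Prop
  | lit n => n < 2 ^ b
  | var v => v < 30
  | inp e => e.Ok b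
  | arr e => e.Ok b
  | op _ x y => x.Ok b ∧ y.Ok b

def RExp.Ok (b : ℕ) : RExp → Prop
  | var v => v < 20
  | tab e => e.Ok b
  | cast e => e.Ok b
  | op _ x y => x.Ok b ∧ y.Ok b

def Cond.Ok (b : ℕ) : Cond → Prop
  | nlt x y => x.Ok b ∧ y.Ok b
  | rlt x y => x.Ok b ∧ y.Ok b

def Cmd.Ok (b : ℕ) : Cmd → Prop
  | set v e => v < 30 ∧ e.Ok b
  | setInp i e => i.Ok b ∧ e.Ok b
  | setArr i e => i.Ok b ∧ e.Ok b
  | rset v e => v < 20 ∧ e.Ok b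
  | setTab i e => i.Ok b ∧ e.Ok b
  | skip => True
  | seq c c' => c.Ok b ∧ c'.Ok b
  | ite q c c' => q.Ok b ∧ c.Ok b ∧ c'.Ok b
  | loop q c => q.Ok b ∧ c.Ok b

theorem size_add_le (x y : ℕ) : (x + y).size ≤ max x.size y.size + 1 := by
  rw [Nat.size_le, pow_succ]
  have h1 : x < 2 ^ max x.size y.size :=
    (Nat.lt_size_self x).trans_le (Nat.pow_le_pow_right (by norm_num) (le_max_left _ _))
  have h2 : y < 2 ^ max x.size y.size :=
    (Nat.lt_size_self y).trans_le (Nat.pow_le_pow_right (by norm_num) (le_max_right _ _))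
  omega

theorem size_mul_le (x y : ℕ) : (x * y).size ≤ x.size + y.size := by
  rw [Nat.size_le, pow_add]
  exact Nat.mul_lt_mul'' (Nat.lt_size_self x) (Nat.lt_size_self y)

theorem NExp.one_le_width (e : NExp) : 1 ≤ e.width := by
  induction e with
  | op _ a b iha ihb => simp only [width]; omega
  | _ => simp [width]

/-- Multiplication adds bit lengths. The carry bit of an addition is covered by the other operand,
whose width is at least 1. The other operations do not grow. Only stored values must fit in `b`
bits; intermediate values such as addresses may be wider. -/
theorem NExp.size_eval_le {b : ℕ} (hb : 1 ≤ b) {s : Mem} (hs : s.Small b) {e : NExp}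
    (he : e.Ok b) : (e.eval s).size ≤ e.width * b := by
  induction e with
  | lit n => simpa [width, eval, Nat.size_le, Ok] using he
  | var v => simpa [width, eval, Nat.size_le] using hs.n v
  | inp e => simpa [width, eval, Nat.size_le] using hs.inp _
  | arr e => simpa [width, eval, Nat.size_le] using hs.arr _
  | op o x y ihx ihy =>
    have h1 := ihx he.1
    have h2 := ihy he.2
    have h3 := Nat.mul_le_mul x.one_le_width hb
    have h4 := Nat.mul_le_mul y.one_le_width hb
    simp only [width, eval, add_mul]
    cases o with
    | add => exact (size_add_le _ _).trans (by omega)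
    | mul => exact (size_mul_le _ _).trans (by omega)
    | sub => exact (Nat.size_le_size (Nat.sub_le _ _)).trans (by omega)
    | div => exact (Nat.size_le_size (Nat.div_le_self _ _)).trans (by omega)

/-- Only temporary integer cells `4 * k'`, `k' ≥ k`, differ. -/
structure SameBelow (k : ℕ) (σ σ' : State) : Prop where
  M : ∀ a, (∀ k' ≥ k, a ≠ 4 * k') → σ'.M a = σ.M a
  R : σ'.R = σ.R

theorem SameBelow.rep {k : ℕ} {σ σ' : State} {s : Mem} (h : SameBelow k σ σ') (hk : 30 ≤ k)
    (hr : Rep s σ) : Rep s σ' where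
  n v hv := by rw [h.M _ (by omega), hr.n v hv]
  inp i := by rw [h.M _ (by omega), hr.inp i]
  arr i := by rw [h.M _ (by omega), hr.arr i]
  r v hv := by rw [h.R, hr.r v hv]
  tab i := by rw [h.R, hr.tab i]

end OneMeans

/-! ### Simulation of expressions and conditions by compiled code -/

namespace OneMeans

section Simulation
variable {P : Program} {ω : Coins} {b : ℕ} {s : Mem}

theorem size_double_le (x : ℕ) : (x + x).size ≤ x.size + 1 := by
  simpa using size_add_le x x

/-- Here `k` acts as a stack pointer: the first operand rests in cell `4 * k` while the second is
evaluated with temporaries from `4 * (k + 1)` on. -/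
theorem NExp.reach (hb : 1 ≤ b) (hs : s.Small b) {e : NExp} (he : e.Ok b) {σ : State} {k : ℕ}
    (hk : 30 ≤ k) (hr : Rep s σ) (hc : CodeAt P σ.pc (e.comp k)) :
    Reach P ω σ (e.work * b) (fun σ' => σ'.pc = σ.pc + (e.comp k).length ∧
      σ'.M (4 * k) = e.eval s ∧ SameBelow k σ σ') := by
  have z0 : Nat.size 0 = 0 := rfl
  have z1 : Nat.size 1 = 1 := rfl
  have z2 : Nat.size 2 = 2 := rfl
  induction e generalizing σ k with
  | lit n =>
    have hn : n.size ≤ b := Nat.size_le.2 he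
    refine Reach.step hc.1 (by simp only [Instr.cost, work]; omega) (Reach.refl ?_)
    refine ⟨by simp [Instr.exec, comp], by simp [Instr.exec, eval], fun a ha => ?_, rfl⟩
    simp [Instr.exec, Function.update_apply, ha k le_rfl]
  | var v =>
    have hv : v < 30 := he
    have hn : (s.n v).size ≤ b := Nat.size_le.2 (hs.n v)
    have hM : σ.M (4 * v) = s.n v := hr.n v hv
    have h4 : 4 * v ≠ 4 * (k + 1) := by omega
    have hcost : work (var v) * b = 3 * b := rfl
    refine Reach.step hc.1 (by simp only [Instr.cost]; omega) ?_
    refine Reach.step (I := .nat .add (4 * k) (4 * v) (4 * (k + 1))) hc.2.1 ?_ (Reach.refl ?_)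
    · simp [Instr.cost, Instr.exec, hM, h4, z0]; omega
    refine ⟨by simp [Instr.exec, comp], by simp [Instr.exec, eval, NatOp.eval, h4, hM],
      fun a ha => ?_, rfl⟩
    simp [Instr.exec, Function.update_apply, ha k le_rfl, ha (k + 1) (by omega)]
  | inp e ih =>
    rw [comp, codeAt_append] at hc
    have hsz := e.size_eval_le hb hs he
    have hsz' : (eval s (inp e)).size ≤ b := by
      simpa [width] using (inp e).size_eval_le hb hs he
    have hcost : work (inp e) * b = e.work * b + 6 * (e.width * b) + 12 * b := by
      simp only [work]; ring
    refine (ih he hk hr hc.1).bind (by omega) ?_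
    rintro σ₁ ⟨hpc, hM, hsame⟩
    obtain ⟨h1, h2, h3, h4, -⟩ := hpc ▸ hc.2
    have d1 := size_double_le (e.eval s)
    have d2 := size_add_le (e.eval s + e.eval s) 1
    have e1 : (4 : ℕ) * k ≠ 4 * (k + 1) := by omega
    have hv : σ₁.M (e.eval s + e.eval s + 1) = eval s (inp e) := by
      rw [← two_mul, (hsame.rep hk hr).inp]; rfl
    have e2 : e.eval s + e.eval s + 1 ≠ 4 * k := by omega
    have e3 : e.eval s + e.eval s + 1 ≠ 4 * (k + 1) := by omega
    refine Reach.step h1 (by simp [Instr.cost, hM]; omega) ?_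
    refine Reach.step (I := .const (4 * (k + 1)) 1) h2 (by simp [Instr.cost, hM, z1]; omega) ?_
    refine Reach.step (I := .nat .add (4 * k) (4 * k) (4 * (k + 1))) h3
      (by simp [Instr.cost, Instr.exec, NatOp.eval, hM, z1]; omega) ?_
    refine Reach.step (I := .load (4 * k) (4 * k)) h4
      (by simp [Instr.cost, Instr.exec, NatOp.eval, hM, z1, hv, e2, e3]; omega) (Reach.refl ?_)
    refine ⟨by simp [Instr.exec, comp, hpc]; omega, by simp [Instr.exec, NatOp.eval, hM, hv, e2, e3],
      fun a ha => ?_, by simp [Instr.exec, hsame.R]⟩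
    simp [Instr.exec, Function.update_apply, ha k le_rfl, ha (k + 1) (by omega), hsame.M a ha]
  | arr e ih =>
    rw [comp, codeAt_append] at hc
    have hsz := e.size_eval_le hb hs he
    have hsz' : (eval s (arr e)).size ≤ b := by
      simpa [width] using (arr e).size_eval_le hb hs he
    have hcost : work (arr e) * b = e.work * b + 8 * (e.width * b) + 22 * b := by
      simp only [work]; ring
    refine (ih he hk hr hc.1).bind (by omega) ?_
    rintro σ₁ ⟨hpc, hM, hsame⟩
    obtain ⟨h1, h2, h3, h4, h5, -⟩ := hpc ▸ hc.2
    set x := e.eval s with hx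
    have d1 := size_double_le x
    have d2 := size_double_le (x + x)
    have d3 := size_add_le (x + x + (x + x)) 2
    have hv : σ₁.M (x + x + (x + x) + 2) = eval s (arr e) := by
      rw [show x + x + (x + x) = 4 * x by ring, (hsame.rep hk hr).arr]; rfl
    have e2 : x + x + (x + x) + 2 ≠ 4 * k := by omega
    have e3 : x + x + (x + x) + 2 ≠ 4 * (k + 1) := by omega
    refine Reach.step h1 (by simp [Instr.cost, hM]; omega) ?_
    refine Reach.step (I := .nat .add (4 * k) (4 * k) (4 * k)) h2
      (by simp [Instr.cost, Instr.exec, NatOp.eval, hM]; omega) ?_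
    refine Reach.step (I := .const (4 * (k + 1)) 2) h3
      (by simp [Instr.cost, Instr.exec, NatOp.eval, hM, z2]; omega) ?_
    refine Reach.step (I := .nat .add (4 * k) (4 * k) (4 * (k + 1))) h4
      (by simp [Instr.cost, Instr.exec, NatOp.eval, hM, z2]; omega) ?_
    refine Reach.step (I := .load (4 * k) (4 * k)) h5
      (by simp [Instr.cost, Instr.exec, NatOp.eval, hM, z2, hv, e2, e3]; omega) (Reach.refl ?_)
    refine ⟨by simp [Instr.exec, comp, hpc]; omega, by simp [Instr.exec, NatOp.eval, hM, hv, e2, e3],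
      fun a ha => ?_, by simp [Instr.exec, hsame.R]⟩
    simp [Instr.exec, Function.update_apply, ha k le_rfl, ha (k + 1) (by omega), hsame.M a ha]
  | op o x y ihx ihy =>
    rw [comp, codeAt_append, codeAt_append] at hc
    have hx := x.size_eval_le hb hs he.1
    have hy := y.size_eval_le hb hs he.2
    have hcost : work (op o x y) * b =
        x.work * b + y.work * b + x.width * b + y.width * b + b := by
      simp only [work]; ring
    refine (ihx he.1 hk hr hc.1).bind (by omega) ?_
    rintro σ₁ ⟨hpc, hM, hsame⟩
    refine (ihy he.2 (by omega) (hsame.rep hk hr) (hpc ▸ hc.2.1)).bind (by omega) ?_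
    rintro σ₂ ⟨hpc', hM', hsame'⟩
    have hM₂ : σ₂.M (4 * k) = x.eval s := by rw [hsame'.M _ (by omega), hM]
    have hc3 := hc.2.2.1
    rw [← hpc, ← hpc'] at hc3
    refine Reach.step hc3 (by simp [Instr.cost, hM', hM₂]; omega) (Reach.refl ?_)
    refine ⟨by simp [Instr.exec, comp, hpc, hpc']; omega, by simp [Instr.exec, hM', hM₂, eval],
      fun a ha => ?_, by simp [Instr.exec, hsame.R, hsame'.R]⟩
    simp [Instr.exec, Function.update_apply, ha k le_rfl, hsame.M a ha,
      hsame'.M a (fun k' hk' => ha k' (by omega))]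

/-- Only temporary cells differ; among the temporary real cells, those from number `k` on. -/
structure RSameBelow (k : ℕ) (σ σ' : State) : Prop where
  M : ∀ a, (∀ k' ≥ 30, a ≠ 4 * k') → σ'.M a = σ.M a
  R : ∀ a, (∀ k' ≥ k, a ≠ 2 * k') → σ'.R a = σ.R a

theorem RSameBelow.rep {k : ℕ} {σ σ' : State} (h : RSameBelow k σ σ') (hk : 20 ≤ k)
    (hr : Rep s σ) : Rep s σ' where
  n v hv := by rw [h.M _ (by omega), hr.n v hv]
  inp i := by rw [h.M _ (by omega), hr.inp i]
  arr i := by rw [h.M _ (by omega), hr.arr i]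
  r v hv := by rw [h.R _ (by omega), hr.r v hv]
  tab i := by rw [h.R _ (by omega), hr.tab i]

/-- The stack is now in the real cells. Integer temporaries restart at number 30 each time, since no
integer value has to survive the evaluation of another subexpression. -/
theorem RExp.reach (hb : 1 ≤ b) (hs : s.Small b) {e : RExp} (he : e.Ok b) {σ : State} {k : ℕ}
    (hk : 20 ≤ k) (hr : Rep s σ) (hc : CodeAt P σ.pc (e.comp k)) :
    Reach P ω σ (e.work * b) (fun σ' => σ'.pc = σ.pc + (e.comp k).length ∧
      σ'.R (2 * k) = e.eval s ∧ RSameBelow k σ σ') := by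
  have z0 : Nat.size 0 = 0 := rfl
  have z1 : Nat.size 1 = 1 := rfl
  induction e generalizing σ k with
  | var v =>
    have hv : v < 20 := he
    have hR : σ.R (2 * v) = s.r v := hr.r v hv
    have h4 : v ≠ k + 1 := by omega
    have hcost : work (var v) * b = 3 * b := rfl
    obtain ⟨h1, h2, h3, -⟩ := hc
    refine Reach.step h1 (by simp [Instr.cost]; omega) ?_
    refine Reach.step (I := .rcast (2 * (k + 1)) 120) h2
      (by simp [Instr.cost, Instr.exec, z0]; omega) ?_
    refine Reach.step (I := .real .add (2 * k) (2 * v) (2 * (k + 1))) h3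
      (by simp [Instr.cost, Instr.exec, z0]; omega) (Reach.refl ?_)
    refine ⟨by simp [Instr.exec, comp], by simp [Instr.exec, eval, RealOp.eval, h4, hR],
      fun a ha => ?_, fun a ha => ?_⟩
    · have := ha 30 le_rfl
      simp [Instr.exec, Function.update_apply, this]
    · simp [Instr.exec, Function.update_apply, ha k le_rfl, ha (k + 1) (by omega)]
  | tab e =>
    rw [comp, codeAt_append] at hc
    have hsz := e.size_eval_le hb hs he
    have hcost : work (tab e) * b = e.work * b + 6 * (e.width * b) + 12 * b := by
      simp only [work]; ring
    refine (e.reach hb hs he le_rfl hr hc.1).bind (by omega) ?_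
    rintro σ₁ ⟨hpc, hM, hsame⟩
    obtain ⟨h1, h2, h3, h4, -⟩ := hpc ▸ hc.2
    norm_num at hM
    set x := e.eval s with hx
    have d1 := size_double_le x
    have d2 := size_add_le (x + x) 1
    have hv : σ₁.R (x + x + 1) = eval s (tab e) := by
      rw [← two_mul, (hsame.rep le_rfl hr).tab]; rfl
    refine Reach.step h1 (by simp [Instr.cost, hM]; omega) ?_
    refine Reach.step (I := .const 124 1) h2 (by simp [Instr.cost, hM, z1]; omega) ?_
    refine Reach.step (I := .nat .add 120 120 124) h3
      (by simp [Instr.cost, Instr.exec, NatOp.eval, hM, z1]; omega) ?_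
    refine Reach.step (I := .rload (2 * k) 120) h4
      (by simp [Instr.cost, Instr.exec, NatOp.eval, hM, z1]; omega) (Reach.refl ?_)
    refine ⟨by simp [Instr.exec, comp, hpc]; omega, by simp [Instr.exec, NatOp.eval, hM, hv],
      fun a ha => ?_, fun a ha => ?_⟩
    · have h30 := ha 30 le_rfl
      have h31 := ha 31 (by norm_num)
      norm_num at h30 h31
      simp [Instr.exec, Function.update_apply, h30, h31, hsame.M a ha]
    · simp [Instr.exec, Function.update_apply, ha k le_rfl, hsame.R]
  | cast e =>
    rw [comp, codeAt_append] at hc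
    have hsz := e.size_eval_le hb hs he
    have hcost : work (cast e) * b = e.work * b + e.width * b + b := by
      simp only [work]; ring
    refine (e.reach hb hs he le_rfl hr hc.1).bind (by omega) ?_
    rintro σ₁ ⟨hpc, hM, hsame⟩
    obtain ⟨h1, -⟩ := hpc ▸ hc.2
    norm_num at hM
    refine Reach.step h1 (by simp [Instr.cost, hM]; omega) (Reach.refl ?_)
    refine ⟨by simp [Instr.exec, comp, hpc]; omega, by simp [Instr.exec, hM, eval],
      fun a ha => ?_, fun a ha => ?_⟩
    · simp [Instr.exec, hsame.M a ha]
    · simp [Instr.exec, Function.update_apply, ha k le_rfl, hsame.R]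
  | op o x y ihx ihy =>
    rw [comp, codeAt_append, codeAt_append] at hc
    have hcost : work (op o x y) * b = x.work * b + y.work * b + b := by
      simp only [work]; ring
    refine (ihx he.1 hk hr hc.1).bind (by omega) ?_
    rintro σ₁ ⟨hpc, hM, hsame⟩
    refine (ihy he.2 (by omega) (hsame.rep hk hr) (hpc ▸ hc.2.1)).bind (by omega) ?_
    rintro σ₂ ⟨hpc', hM', hsame'⟩
    have hM₂ : σ₂.R (2 * k) = x.eval s := by rw [hsame'.R _ (by omega), hM]
    have hc3 := hc.2.2.1
    rw [← hpc, ← hpc'] at hc3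
    refine Reach.step hc3 (by simp [Instr.cost]; omega) (Reach.refl ?_)
    refine ⟨by simp [Instr.exec, comp, hpc, hpc']; omega, by simp [Instr.exec, hM', hM₂, eval],
      fun a ha => ?_, fun a ha => ?_⟩
    · simp [Instr.exec, hsame.M a ha, hsame'.M a ha]
    · simp [Instr.exec, Function.update_apply, ha k le_rfl, hsame.R a ha,
        hsame'.R a (fun k' hk' => ha k' (by omega))]

open scoped Classical in
theorem Cond.reach (hb : 1 ≤ b) (hs : s.Small b) {q : Cond} (hq : q.Ok b) {σ : State} {l : ℕ}
    (hr : Rep s σ) (hc : CodeAt P σ.pc (q.comp l)) :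
    Reach P ω σ (q.work * b) (fun σ' =>
      σ'.pc = (if q.holds s then l else σ.pc + (q.comp l).length) ∧ Rep s σ') := by
  cases q with
  | nlt x y =>
    rw [comp, codeAt_append, codeAt_append] at hc
    have hx := x.size_eval_le hb hs hq.1
    have hy := y.size_eval_le hb hs hq.2
    have hcost : work (nlt x y) * b =
        x.work * b + y.work * b + x.width * b + y.width * b + b := by
      simp only [work]; ring
    refine (x.reach hb hs hq.1 le_rfl hr hc.1).bind (by omega) ?_
    rintro σ₁ ⟨hpc, hM, hsame⟩
    refine (y.reach hb hs hq.2 (by omega) (hsame.rep le_rfl hr) (hpc ▸ hc.2.1)).bind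
      (by omega) ?_
    rintro σ₂ ⟨hpc', hM', hsame'⟩
    have hM₂ : σ₂.M (4 * 30) = x.eval s := by rw [hsame'.M _ (by omega), hM]
    have hc3 := hc.2.2.1
    rw [← hpc, ← hpc'] at hc3
    norm_num at hM' hM₂
    have hrep := hsame'.rep (by norm_num) (hsame.rep le_rfl hr)
    refine Reach.step hc3 (by simp [Instr.cost, hM', hM₂]; omega) (Reach.refl ⟨?_, ?_⟩)
    · simp [Instr.exec, comp, hpc, hpc', hM', hM₂, holds, Nat.add_assoc]
    · exact ⟨hrep.n, hrep.inp, hrep.arr, hrep.r, hrep.tab⟩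
  | rlt x y =>
    rw [comp, codeAt_append, codeAt_append] at hc
    have hcost : work (rlt x y) * b = x.work * b + y.work * b + b := by
      simp only [work]; ring
    refine (x.reach hb hs hq.1 le_rfl hr hc.1).bind (by omega) ?_
    rintro σ₁ ⟨hpc, hM, hsame⟩
    refine (y.reach hb hs hq.2 (by omega) (hsame.rep le_rfl hr) (hpc ▸ hc.2.1)).bind
      (by omega) ?_
    rintro σ₂ ⟨hpc', hM', hsame'⟩
    have hM₂ : σ₂.R (2 * 20) = x.eval s := by rw [hsame'.R _ (by omega), hM]
    have hc3 := hc.2.2.1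
    rw [← hpc, ← hpc'] at hc3
    norm_num at hM' hM₂
    have hrep := hsame'.rep (by norm_num) (hsame.rep le_rfl hr)
    refine Reach.step hc3 (by simp [Instr.cost]; omega) (Reach.refl ⟨?_, ?_⟩)
    · simp only [Instr.exec, comp, hpc, hpc', hM', hM₂, holds, Nat.add_assoc, List.length_append]
      congr 1
    · exact ⟨hrep.n, hrep.inp, hrep.arr, hrep.r, hrep.tab⟩

theorem jump_reach {σ : State} {l : ℕ} (hr : Rep s σ) (hc : CodeAt P σ.pc (jump l)) :
    Reach P ω σ 7 (fun σ' => σ'.pc = l ∧ Rep s σ') := by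
  have z0 : Nat.size 0 = 0 := rfl
  have z1 : Nat.size 1 = 1 := rfl
  obtain ⟨h1, h2, h3, -⟩ := hc
  refine Reach.step h1 (by simp [Instr.cost]) ?_
  refine Reach.step (I := .const 124 1) h2 (by simp [Instr.cost, z1]) ?_
  refine Reach.step (I := .jlt 120 124 l) h3 (by simp [Instr.cost, Instr.exec, z0, z1])
    (Reach.refl ⟨?_, ?_⟩)
  · simp [Instr.exec]
  · refine ⟨fun v hv => ?_, fun i => ?_, fun i => ?_, hr.r, hr.tab⟩
    · have e1 : 4 * v ≠ 120 := by omega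
      have e2 : 4 * v ≠ 124 := by omega
      simp [Instr.exec, e1, e2, hr.n v hv]
    · have e1 : 2 * i + 1 ≠ 120 := by omega
      have e2 : 2 * i + 1 ≠ 124 := by omega
      simp [Instr.exec, e1, e2, hr.inp i]
    · have e1 : 4 * i + 2 ≠ 120 := by omega
      have e2 : 4 * i + 2 ≠ 124 := by omega
      simp [Instr.exec, e1, e2, hr.arr i]

end Simulation
end OneMeans

/-! ### Simulation of commands by compiled code -/

namespace OneMeans

section Simulation
variable {P : Program} {ω : Coins} {b : ℕ} {s s' : Mem}

theorem jump_length (l : ℕ) : (jump l).length = 3 := rfl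

/-- Induction on the execution. A tick is worth `W * b`, and `Cmd.work` is so large that the tick
charged for a branch or a loop round pays for the condition and the jumps. -/
theorem Exec.reach (hb : 1 ≤ b) {c : Cmd} {k : ℕ} (h : Exec b c s s' k) (hs : s.Small b)
    (hok : c.Ok b) {W : ℕ} (hW : c.work ≤ W) {σ : State} (hr : Rep s σ)
    (hc : CodeAt P σ.pc (c.comp σ.pc)) :
    Reach P ω σ (k * (W * b))
      (fun σ' => σ'.pc = σ.pc + (c.comp σ.pc).length ∧ Rep s' σ') := by
  have z0 : Nat.size 0 = 0 := rfl
  have z1 : Nat.size 1 = 1 := rfl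
  have z2 : Nat.size 2 = 2 := rfl
  induction h generalizing σ with
  | @set s v e hv =>
    rw [Cmd.comp, codeAt_append] at hc
    have hsz := e.size_eval_le hb hs hok.2
    have hcost := Nat.mul_le_mul_right b hW
    simp only [Cmd.work, add_mul] at hcost
    rw [one_mul]
    refine (e.reach hb hs hok.2 le_rfl hr hc.1).bind (by omega) ?_
    rintro σ₁ ⟨hpc, hM, hsame⟩
    obtain ⟨h1, h2, -⟩ := hpc ▸ hc.2
    norm_num at hM
    have hrep := hsame.rep le_rfl hr
    refine Reach.step h1 (by simp [Instr.cost]; omega) ?_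
    refine Reach.step (I := .nat .add (4 * v) 120 124) h2
      (by simp [Instr.cost, Instr.exec, hM, z0]; omega) (Reach.refl ⟨?_, ?_⟩)
    · simp [Instr.exec, Cmd.comp, hpc]; omega
    · refine ⟨fun w hw => ?_, fun i => ?_, fun i => ?_, hrep.r, hrep.tab⟩
      · have e2 : 4 * w ≠ 124 := by omega
        by_cases hwv : w = v
        · subst hwv; simp [Instr.exec, hM, NatOp.eval, Mem.setN]
        · have e3 : 4 * w ≠ 4 * v := by omega
          simp [Instr.exec, e2, hwv, Mem.setN, hrep.n w hw]
      · have e1 : 2 * i + 1 ≠ 4 * v := by omega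
        have e2 : 2 * i + 1 ≠ 124 := by omega
        simp [Instr.exec, e1, e2, Mem.setN, hrep.inp i]
      · have e1 : 4 * i + 2 ≠ 4 * v := by omega
        have e2 : 4 * i + 2 ≠ 124 := by omega
        simp [Instr.exec, e1, e2, Mem.setN, hrep.arr i]
  | @setInp s i e hv =>
    rw [Cmd.comp, codeAt_append, codeAt_append] at hc
    have hsz := e.size_eval_le hb hs hok.2
    have hsi := i.size_eval_le hb hs hok.1
    have hcost := Nat.mul_le_mul_right b hW
    simp only [Cmd.work, add_mul, mul_assoc] at hcost
    rw [one_mul]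
    refine (i.reach hb hs hok.1 le_rfl hr hc.1).bind (by omega) ?_
    rintro σ₁ ⟨hpc, hM, hsame⟩
    refine (e.reach hb hs hok.2 (by norm_num : 30 ≤ 31) (hsame.rep le_rfl hr)
      (hpc ▸ hc.2.1)).bind (by omega) ?_
    rintro σ₂ ⟨hpc', hM', hsame'⟩
    have hM₂ : σ₂.M (4 * 30) = i.eval s := by rw [hsame'.M _ (by omega), hM]
    have hc3 := hc.2.2
    rw [← hpc, ← hpc'] at hc3
    obtain ⟨h1, h2, h3, h4, -⟩ := hc3
    norm_num at hM' hM₂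
    have hrep := hsame'.rep (by norm_num) (hsame.rep le_rfl hr)
    set x := i.eval s with hx
    have d1 := size_double_le x
    have d2 := size_add_le (x + x) 1
    refine Reach.step h1 (by simp [Instr.cost, hM₂]; omega) ?_
    refine Reach.step (I := .const 128 1) h2 (by simp [Instr.cost, hM₂, z1]; omega) ?_
    refine Reach.step (I := .nat .add 120 120 128) h3
      (by simp [Instr.cost, Instr.exec, NatOp.eval, hM₂, z1]; omega) ?_
    refine Reach.step (I := .store 120 124) h4
      (by simp [Instr.cost, Instr.exec, NatOp.eval, hM₂, hM', z1]; omega)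
      (Reach.refl ⟨?_, ?_⟩)
    · simp [Instr.exec, Cmd.comp, hpc, hpc']; omega
    · refine ⟨fun w hw => ?_, fun j => ?_, fun j => ?_, hrep.r, hrep.tab⟩
      · have e1 : 4 * w ≠ x + x + 1 := by omega
        have e2 : 4 * w ≠ 120 := by omega
        have e3 : 4 * w ≠ 128 := by omega
        simp [Instr.exec, NatOp.eval, hM₂, Function.update_of_ne e1, e2, e3, Mem.setInp, hrep.n w hw]
      · have e2 : 2 * j + 1 ≠ 120 := by omega
        have e3 : 2 * j + 1 ≠ 128 := by omega
        by_cases hj : j = x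
        · subst hj
          simp [Instr.exec, NatOp.eval, hM₂, hM', Mem.setInp, ← two_mul, ← hx]
        · have e1 : 2 * j + 1 ≠ x + x + 1 := by omega
          simp [Instr.exec, NatOp.eval, hM₂, Function.update_of_ne e1, e2, e3, Mem.setInp, hrep.inp j, ← hx, hj]
      · have e1 : 4 * j + 2 ≠ x + x + 1 := by omega
        have e2 : 4 * j + 2 ≠ 120 := by omega
        have e3 : 4 * j + 2 ≠ 128 := by omega
        simp [Instr.exec, NatOp.eval, hM₂, Function.update_of_ne e1, e2, e3, Mem.setInp, hrep.arr j]
  | @setArr s i e hv =>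
    rw [Cmd.comp, codeAt_append, codeAt_append] at hc
    have hsz := e.size_eval_le hb hs hok.2
    have hsi := i.size_eval_le hb hs hok.1
    have hcost := Nat.mul_le_mul_right b hW
    simp only [Cmd.work, add_mul, mul_assoc] at hcost
    rw [one_mul]
    refine (i.reach hb hs hok.1 le_rfl hr hc.1).bind (by omega) ?_
    rintro σ₁ ⟨hpc, hM, hsame⟩
    refine (e.reach hb hs hok.2 (by norm_num : 30 ≤ 31) (hsame.rep le_rfl hr)
      (hpc ▸ hc.2.1)).bind (by omega) ?_
    rintro σ₂ ⟨hpc', hM', hsame'⟩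
    have hM₂ : σ₂.M (4 * 30) = i.eval s := by rw [hsame'.M _ (by omega), hM]
    have hc3 := hc.2.2
    rw [← hpc, ← hpc'] at hc3
    obtain ⟨h1, h2, h3, h4, h5, -⟩ := hc3
    norm_num at hM' hM₂
    have hrep := hsame'.rep (by norm_num) (hsame.rep le_rfl hr)
    set x := i.eval s with hx
    have d1 := size_double_le x
    have d2 := size_double_le (x + x)
    have d3 := size_add_le (x + x + (x + x)) 2
    refine Reach.step h1 (by simp [Instr.cost, hM₂]; omega) ?_
    refine Reach.step (I := .nat .add 120 120 120) h2
      (by simp [Instr.cost, Instr.exec, NatOp.eval, hM₂]; omega) ?_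
    refine Reach.step (I := .const 128 2) h3 (by simp [Instr.cost, Instr.exec, NatOp.eval, hM₂, z2]; omega) ?_
    refine Reach.step (I := .nat .add 120 120 128) h4
      (by simp [Instr.cost, Instr.exec, NatOp.eval, hM₂, z2]; omega) ?_
    refine Reach.step (I := .store 120 124) h5
      (by simp [Instr.cost, Instr.exec, NatOp.eval, hM₂, hM', z2]; omega)
      (Reach.refl ⟨?_, ?_⟩)
    · simp [Instr.exec, Cmd.comp, hpc, hpc']; omega
    · refine ⟨fun w hw => ?_, fun j => ?_, fun j => ?_, hrep.r, hrep.tab⟩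
      · have e1 : 4 * w ≠ x + x + (x + x) + 2 := by omega
        have e2 : 4 * w ≠ 120 := by omega
        have e3 : 4 * w ≠ 128 := by omega
        simp [Instr.exec, NatOp.eval, hM₂, Function.update_of_ne e1, e2, e3, Mem.setArr, hrep.n w hw]
      · have e1 : 2 * j + 1 ≠ x + x + (x + x) + 2 := by omega
        have e2 : 2 * j + 1 ≠ 120 := by omega
        have e3 : 2 * j + 1 ≠ 128 := by omega
        simp [Instr.exec, NatOp.eval, hM₂, Function.update_of_ne e1, e2, e3, Mem.setArr, hrep.inp j]
      · have e2 : 4 * j + 2 ≠ 120 := by omega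
        have e3 : 4 * j + 2 ≠ 128 := by omega
        by_cases hj : j = x
        · subst hj
          have e4 : 4 * x = x + x + (x + x) := by ring
          simp [Instr.exec, NatOp.eval, hM₂, hM', Mem.setArr, ← hx, e4]
        · have e1 : 4 * j + 2 ≠ x + x + (x + x) + 2 := by omega
          simp [Instr.exec, NatOp.eval, hM₂, Function.update_of_ne e1, e2, e3, Mem.setArr, hrep.arr j, ← hx, hj]
  | @rset s v e =>
    rw [Cmd.comp, codeAt_append] at hc
    have hcost := Nat.mul_le_mul_right b hW
    simp only [Cmd.work, add_mul] at hcost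
    rw [one_mul]
    refine (e.reach hb hs hok.2 le_rfl hr hc.1).bind (by omega) ?_
    rintro σ₁ ⟨hpc, hR, hsame⟩
    obtain ⟨h1, h2, h3, -⟩ := hpc ▸ hc.2
    norm_num at hR
    have hrep := hsame.rep le_rfl hr
    refine Reach.step h1 (by simp [Instr.cost]; omega) ?_
    refine Reach.step (I := .rcast 42 120) h2
      (by simp [Instr.cost, Instr.exec, z0]; omega) ?_
    refine Reach.step (I := .real .add (2 * v) 40 42) h3
      (by simp [Instr.cost, Instr.exec, z0]; omega) (Reach.refl ⟨?_, ?_⟩)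
    · simp [Instr.exec, Cmd.comp, hpc]; omega
    · refine ⟨fun w hw => ?_, fun i => ?_, fun i => ?_, fun w hw => ?_, fun i => ?_⟩
      · have e2 : 4 * w ≠ 120 := by omega
        simp [Instr.exec, e2, Mem.setR, hrep.n w hw]
      · have e2 : 2 * i + 1 ≠ 120 := by omega
        simp [Instr.exec, e2, Mem.setR, hrep.inp i]
      · have e2 : 4 * i + 2 ≠ 120 := by omega
        simp [Instr.exec, e2, Mem.setR, hrep.arr i]
      · have e2 : 2 * w ≠ 42 := by omega
        by_cases hwv : w = v
        · subst hwv; simp [Instr.exec, hR, RealOp.eval, Mem.setR]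
        · simp [Instr.exec, e2, hwv, Mem.setR, hrep.r w hw]
      · have e1 : 2 * i + 1 ≠ 2 * v := by omega
        have e2 : 2 * i + 1 ≠ 42 := by omega
        simp [Instr.exec, e1, e2, Mem.setR, hrep.tab i]
  | @setTab s i e =>
    rw [Cmd.comp, codeAt_append, codeAt_append] at hc
    have hsi := i.size_eval_le hb hs hok.1
    have hcost := Nat.mul_le_mul_right b hW
    simp only [Cmd.work, add_mul, mul_assoc] at hcost
    rw [one_mul]
    -- The real value is computed before the index, because evaluating an integer expression leaves
    -- all real cells alone.
    refine (e.reach hb hs hok.2 le_rfl hr hc.1).bind (by omega) ?_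
    rintro σ₁ ⟨hpc, hR, hsame⟩
    refine (i.reach hb hs hok.1 le_rfl (hsame.rep le_rfl hr)
      (hpc ▸ hc.2.1)).bind (by omega) ?_
    rintro σ₂ ⟨hpc', hM', hsame'⟩
    have hR₂ : σ₂.R (2 * 20) = e.eval s := by rw [hsame'.R, hR]
    have hc3 := hc.2.2
    rw [← hpc, ← hpc'] at hc3
    obtain ⟨h1, h2, h3, h4, -⟩ := hc3
    norm_num at hM' hR₂
    have hrep := hsame'.rep (by norm_num) (hsame.rep le_rfl hr)
    set x := i.eval s with hx
    have d1 := size_double_le x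
    have d2 := size_add_le (x + x) 1
    refine Reach.step h1 (by simp [Instr.cost, hM']; omega) ?_
    refine Reach.step (I := .const 124 1) h2 (by simp [Instr.cost, hM', z1]; omega) ?_
    refine Reach.step (I := .nat .add 120 120 124) h3
      (by simp [Instr.cost, Instr.exec, NatOp.eval, hM', z1]; omega) ?_
    refine Reach.step (I := .rstore 120 40) h4
      (by simp [Instr.cost, Instr.exec, NatOp.eval, hM', z1]; omega)
      (Reach.refl ⟨?_, ?_⟩)
    · simp [Instr.exec, Cmd.comp, hpc, hpc']; omega
    · refine ⟨fun w hw => ?_, fun j => ?_, fun j => ?_, fun w hw => ?_, fun j => ?_⟩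
      · have e2 : 4 * w ≠ 120 := by omega
        have e3 : 4 * w ≠ 124 := by omega
        simp [Instr.exec, e2, e3, Mem.setTab, hrep.n w hw]
      · have e2 : 2 * j + 1 ≠ 120 := by omega
        have e3 : 2 * j + 1 ≠ 124 := by omega
        simp [Instr.exec, e2, e3, Mem.setTab, hrep.inp j]
      · have e2 : 4 * j + 2 ≠ 120 := by omega
        have e3 : 4 * j + 2 ≠ 124 := by omega
        simp [Instr.exec, e2, e3, Mem.setTab, hrep.arr j]
      · have e1 : 2 * w ≠ x + x + 1 := by omega
        simp [Instr.exec, NatOp.eval, hM', Function.update_of_ne e1, Mem.setTab, hrep.r w hw]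
      · by_cases hj : j = x
        · subst hj
          simp [Instr.exec, NatOp.eval, hM', hR₂, Mem.setTab, ← two_mul, ← hx]
        · have e1 : 2 * j + 1 ≠ x + x + 1 := by omega
          simp [Instr.exec, NatOp.eval, hM', Function.update_of_ne e1, Mem.setTab, hrep.tab j, ← hx, hj]
  | skip => exact Reach.refl ⟨by simp [Cmd.comp], hr⟩
  | @seq c c' s s' s'' k k' h h' ih ih' =>
    rw [Cmd.comp, codeAt_append] at hc
    simp only [Cmd.work, max_le_iff] at hW
    rw [add_mul]
    refine (ih hs hok.1 hW.1 hr hc.1).bind (by omega) ?_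
    rintro σ₁ ⟨hpc, hr₁⟩
    refine (ih' (h.small hs) hok.2 hW.2 hr₁ (hpc ▸ hc.2)).mono (by omega) ?_
    rintro σ₂ ⟨hpc₂, hr₂⟩
    refine ⟨?_, hr₂⟩
    rw [hpc₂, hpc, Cmd.comp, List.length_append, Nat.add_assoc]
  | @iteTrue q c c' s s' k hq h ih =>
    simp only [Cmd.comp, codeAt_append] at hc
    simp only [Cmd.work, max_le_iff] at hW
    have hqW := Nat.mul_le_mul_right b hW.1
    rw [add_mul] at hqW
    rw [add_mul, one_mul]
    obtain ⟨hc1, hc2, hc3, hc4⟩ := hc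
    refine (Cond.reach hb hs hok.1 hr hc1).bind (by omega) ?_
    rintro σ₁ ⟨hpc, hr₁⟩
    rw [if_pos hq] at hpc
    rw [jump_length] at hc4
    rw [Cond.length_comp q _ 0] at hc4
    refine (ih hs hok.2.1 hW.2.1 hr₁ (by rw [hpc]; exact hc4)).mono (by omega) ?_
    rintro σ₂ ⟨hpc₂, hr₂⟩
    refine ⟨?_, hr₂⟩
    rw [hpc₂, hpc]
    simp only [Cmd.comp, List.length_append, jump_length]
    rw [Cond.length_comp q (_ + 3) 0]
    omega
  | @iteFalse q c c' s s' k hq h ih =>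
    simp only [Cmd.comp, codeAt_append] at hc
    simp only [Cmd.work, max_le_iff] at hW
    have hqW := Nat.mul_le_mul_right b hW.1
    rw [add_mul] at hqW
    rw [add_mul, one_mul]
    obtain ⟨hc1, hc2, hc3, hc4⟩ := hc
    refine (Cond.reach hb hs hok.1 hr hc1).bind (by omega) ?_
    rintro σ₁ ⟨hpc, hr₁⟩
    rw [if_neg hq, Cond.length_comp q _ 0] at hpc
    rw [Cond.length_comp q _ 0] at hc2 hc3
    refine (ih hs hok.2.2 hW.2.2 hr₁ (by rw [hpc]; exact hc2)).bind (by omega) ?_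
    rintro σ₂ ⟨hpc₂, hr₂⟩
    rw [hpc] at hpc₂
    refine (jump_reach hr₂ (by rw [hpc₂]; exact hc3)).mono (by omega) ?_
    rintro σ₃ ⟨hpc₃, hr₃⟩
    refine ⟨?_, hr₃⟩
    rw [hpc₃]
    simp only [Cmd.comp, List.length_append, jump_length]
    rw [Cond.length_comp q (_ + 3) 0]
    omega
  | @loopTrue q c s s' s'' k k' hq h h' ih ih' =>
    have hc0 := hc
    simp only [Cmd.comp, codeAt_append] at hc
    have hW0 := hW
    simp only [Cmd.work, max_le_iff] at hW
    have hqW := Nat.mul_le_mul_right b hW.1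
    rw [add_mul] at hqW
    rw [add_mul, add_mul, one_mul]
    obtain ⟨hc1, hc2, hc3, hc4⟩ := hc
    refine (Cond.reach hb hs hok.1 hr hc1).bind (by omega) ?_
    rintro σ₁ ⟨hpc, hr₁⟩
    rw [if_pos hq] at hpc
    rw [jump_length, Cond.length_comp q _ 0] at hc3 hc4
    refine (ih hs hok.2 hW.2 hr₁ (by rw [hpc]; exact hc3)).bind (by omega) ?_
    rintro σ₂ ⟨hpc₂, hr₂⟩
    rw [hpc] at hpc₂
    refine (jump_reach hr₂ (by rw [hpc₂]; exact hc4)).bind (by omega) ?_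
    rintro σ₃ ⟨hpc₃, hr₃⟩
    -- The jump back returns to the first line of the same code, so the remaining rounds are the
    -- second induction hypothesis for the original `hc0`.
    refine (ih' (h.small hs) hok hW0 hr₃ (by rw [hpc₃]; exact hc0)).mono (by omega) ?_
    rintro σ₄ ⟨hpc₄, hr₄⟩
    exact ⟨by rw [hpc₄, hpc₃], hr₄⟩
  | @loopFalse q c s hq =>
    simp only [Cmd.comp, codeAt_append] at hc
    simp only [Cmd.work, max_le_iff] at hW
    have hqW := Nat.mul_le_mul_right b hW.1
    rw [add_mul] at hqW
    rw [one_mul]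
    obtain ⟨hc1, hc2, hc3, hc4⟩ := hc
    refine (Cond.reach hb hs hok.1 hr hc1).bind (by omega) ?_
    rintro σ₁ ⟨hpc, hr₁⟩
    rw [if_neg hq, Cond.length_comp q _ 0] at hpc
    rw [Cond.length_comp q _ 0] at hc2
    refine (jump_reach hr₁ (by rw [hpc]; exact hc2)).mono (by omega) ?_
    rintro σ₂ ⟨hpc₂, hr₂⟩
    refine ⟨?_, hr₂⟩
    rw [hpc₂]
    simp only [Cmd.comp, List.length_append, jump_length]
    rw [Cond.length_comp q (_ + 3) 0]
    omega

/-- The compiled program does what the structured program does. -/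
theorem Exec.run (hb : 1 ≤ b) {c : Cmd} {k : ℕ} (h : Exec b c s s' k) (hs : s.Small b)
    (hok : c.Ok b) {σ : State} (hpc : σ.pc = 0) (hr : Rep s σ) :
    Halts (c.comp 0) ω σ ∧ Rep s' (run (c.comp 0) ω σ) ∧
      runCost (c.comp 0) ω σ ≤ k * (c.work * b) := by
  have hc : CodeAt (c.comp 0) σ.pc (c.comp σ.pc) := by
    rw [hpc]; simpa using codeAt_self [] (c.comp 0)
  obtain ⟨σ', cst, hst, hle, hpc', hr'⟩ := h.reach (ω := ω) hb hs hok le_rfl hr hc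
  obtain ⟨h1, h2, h3⟩ := hst.finish (by rw [hpc', hpc]; simp)
  exact ⟨h1, h2 ▸ hr', h3 ▸ hle⟩

end Simulation
end OneMeans

namespace OneMeans

/-! ### Reasoning about structured programs -/

instance : Add NExp := ⟨.op .add⟩
instance : Sub NExp := ⟨.op .sub⟩
instance : Mul NExp := ⟨.op .mul⟩
instance : Div NExp := ⟨.op .div⟩
instance (n : ℕ) : OfNat NExp n := ⟨.lit n⟩
instance : Add RExp := ⟨.op .add⟩
instance : Sub RExp := ⟨.op .sub⟩
instance : Mul RExp := ⟨.op .mul⟩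

namespace NExp
variable (s : Mem) (a b : NExp)

@[simp] theorem eval_lit (n : ℕ) : (lit n).eval s = n := rfl
@[simp] theorem eval_ofNat (n : ℕ) : (no_index (OfNat.ofNat n) : NExp).eval s = n := rfl
@[simp] theorem eval_var (v : ℕ) : (var v).eval s = s.n v := rfl
@[simp] theorem eval_inp : (inp a).eval s = s.inp (a.eval s) := rfl
@[simp] theorem eval_arr : (arr a).eval s = s.arr (a.eval s) := rfl
@[simp] theorem eval_add : (a + b).eval s = a.eval s + b.eval s := rfl
@[simp] theorem eval_sub : (a - b).eval s = a.eval s - b.eval s := rfl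
@[simp] theorem eval_mul : (a * b).eval s = a.eval s * b.eval s := rfl
@[simp] theorem eval_div : (a / b).eval s = a.eval s / b.eval s := rfl

end NExp

namespace RExp
variable (s : Mem) (a b : RExp) (e : NExp)

@[simp] theorem eval_var (v : ℕ) : (var v).eval s = s.r v := rfl
@[simp] theorem eval_tab : (tab e).eval s = s.tab (e.eval s) := rfl
@[simp] theorem eval_cast : (cast e).eval s = (e.eval s : ℝ) := rfl
@[simp] theorem eval_add : (a + b).eval s = a.eval s + b.eval s := rfl
@[simp] theorem eval_sub : (a - b).eval s = a.eval s - b.eval s := rfl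
@[simp] theorem eval_mul : (a * b).eval s = a.eval s * b.eval s := rfl

end RExp

@[simp] theorem Cond.holds_nlt (s : Mem) (a b : NExp) :
    (nlt a b).holds s ↔ a.eval s < b.eval s := Iff.rfl
@[simp] theorem Cond.holds_rlt (s : Mem) (a b : RExp) :
    (rlt a b).holds s ↔ a.eval s < b.eval s := Iff.rfl

namespace Mem
variable (s : Mem) (v w x : ℕ) (y : ℝ)

@[simp] theorem setN_n : (s.setN v x).n w = if w = v then x else s.n w :=
  Function.update_apply ..
@[simp] theorem setN_inp : (s.setN v x).inp = s.inp := rfl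
@[simp] theorem setN_arr : (s.setN v x).arr = s.arr := rfl
@[simp] theorem setN_r : (s.setN v x).r = s.r := rfl
@[simp] theorem setN_tab : (s.setN v x).tab = s.tab := rfl
@[simp] theorem setInp_inp : (s.setInp v x).inp = Function.update s.inp v x := rfl
@[simp] theorem setInp_n : (s.setInp v x).n = s.n := rfl
@[simp] theorem setInp_arr : (s.setInp v x).arr = s.arr := rfl
@[simp] theorem setInp_r : (s.setInp v x).r = s.r := rfl
@[simp] theorem setInp_tab : (s.setInp v x).tab = s.tab := rfl
@[simp] theorem setArr_arr : (s.setArr v x).arr = Function.update s.arr v x := rfl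
@[simp] theorem setArr_n : (s.setArr v x).n = s.n := rfl
@[simp] theorem setArr_inp : (s.setArr v x).inp = s.inp := rfl
@[simp] theorem setArr_r : (s.setArr v x).r = s.r := rfl
@[simp] theorem setArr_tab : (s.setArr v x).tab = s.tab := rfl
@[simp] theorem setR_r : (s.setR v y).r w = if w = v then y else s.r w :=
  Function.update_apply ..
@[simp] theorem setR_n : (s.setR v y).n = s.n := rfl
@[simp] theorem setR_inp : (s.setR v y).inp = s.inp := rfl
@[simp] theorem setR_arr : (s.setR v y).arr = s.arr := rfl
@[simp] theorem setR_tab : (s.setR v y).tab = s.tab := rfl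
@[simp] theorem setTab_tab : (s.setTab v y).tab = Function.update s.tab v y := rfl
@[simp] theorem setTab_n : (s.setTab v y).n = s.n := rfl
@[simp] theorem setTab_inp : (s.setTab v y).inp = s.inp := rfl
@[simp] theorem setTab_arr : (s.setTab v y).arr = s.arr := rfl
@[simp] theorem setTab_r : (s.setTab v y).r = s.r := rfl

end Mem

theorem NExp.eval_congr {s s' : Mem} (hn : s.n = s'.n) (hi : s.inp = s'.inp)
    (ha : s.arr = s'.arr) (e : NExp) : e.eval s = e.eval s' := by
  induction e with
  | lit => rfl
  | var v => simp [hn]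
  | inp e ih => simp [hi, ih]
  | arr e ih => simp [ha, ih]
  | op o a b iha ihb => simp [NExp.eval, iha, ihb]

@[simp] theorem NExp.eval_setTab (s : Mem) (v : ℕ) (y : ℝ) (e : NExp) :
    e.eval (s.setTab v y) = e.eval s :=
  NExp.eval_congr (s := s.setTab v y) (s' := s) rfl rfl rfl e
@[simp] theorem NExp.eval_setR (s : Mem) (v : ℕ) (y : ℝ) (e : NExp) :
    e.eval (s.setR v y) = e.eval s :=
  NExp.eval_congr (s := s.setR v y) (s' := s) rfl rfl rfl e

/-- The parts of the memory that a command may change. -/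
inductive Part
  | n (v : ℕ)
  | r (v : ℕ)
  | inp
  | arr
  | tab
  deriving DecidableEq

/-- Boolean valued, so that at each use `rfl` proves that a command leaves a variable alone. -/
def Cmd.writes (p : Part) : Cmd → Bool
  | set v _ => p = .n v
  | setInp _ _ => p = .inp
  | setArr _ _ => p = .arr
  | rset v _ => p = .r v
  | setTab _ _ => p = .tab
  | skip => false
  | seq c c' => c.writes p || c'.writes p
  | ite _ c c' => c.writes p || c'.writes p
  | loop _ c => c.writes p

/-- `s'` agrees with `s` on everything that `c` does not write. -/
structure Frame (c : Cmd) (s s' : Mem) : Prop where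
  n : ∀ v, c.writes (.n v) = false → s'.n v = s.n v
  r : ∀ v, c.writes (.r v) = false → s'.r v = s.r v
  inp : c.writes .inp = false → s'.inp = s.inp
  arr : c.writes .arr = false → s'.arr = s.arr
  tab : c.writes .tab = false → s'.tab = s.tab

theorem Frame.refl (c : Cmd) (s : Mem) : Frame c s s :=
  ⟨fun _ _ => rfl, fun _ _ => rfl, fun _ => rfl, fun _ => rfl, fun _ => rfl⟩

theorem Frame.trans {c : Cmd} {s s' s'' : Mem} (h : Frame c s s') (h' : Frame c s' s'') :
    Frame c s s'' :=
  ⟨fun v hv => (h'.n v hv).trans (h.n v hv), fun v hv => (h'.r v hv).trans (h.r v hv),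
    fun hc => (h'.inp hc).trans (h.inp hc), fun hc => (h'.arr hc).trans (h.arr hc),
    fun hc => (h'.tab hc).trans (h.tab hc)⟩

theorem Frame.mono {c c' : Cmd} {s s' : Mem} (h : Frame c s s')
    (hc : ∀ p, c'.writes p = false → c.writes p = false) : Frame c' s s' :=
  ⟨fun v hv => h.n v (hc _ hv), fun v hv => h.r v (hc _ hv), fun hv => h.inp (hc _ hv),
    fun hv => h.arr (hc _ hv), fun hv => h.tab (hc _ hv)⟩

theorem Exec.frame {b : ℕ} {c : Cmd} {s s' : Mem} {k : ℕ} (h : Exec b c s s' k) :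
    Frame c s s' := by
  induction h with
  | set => constructor <;> simp +contextual [Cmd.writes]
  | setInp => constructor <;> simp [Cmd.writes]
  | setArr => constructor <;> simp [Cmd.writes]
  | rset => constructor <;> simp +contextual [Cmd.writes]
  | setTab => constructor <;> simp [Cmd.writes]
  | skip => exact Frame.refl _ _
  | seq _ _ ih ih' =>
    exact (ih.mono (by simp +contextual [Cmd.writes])).trans
      (ih'.mono (by simp +contextual [Cmd.writes]))
  | iteTrue _ _ ih => exact ih.mono (by simp +contextual [Cmd.writes])
  | iteFalse _ _ ih => exact ih.mono (by simp +contextual [Cmd.writes])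
  | loopTrue _ _ _ ih ih' =>
    exact (ih.mono (by simp +contextual [Cmd.writes])).trans ih'
  | loopFalse => exact Frame.refl _ _

/-- `c`, started in `s`, stops within `K` ticks in a memory that satisfies `Q`. -/
def Runs (b : ℕ) (c : Cmd) (s : Mem) (K : ℕ) (Q : Mem → Prop) : Prop :=
  ∃ s' k, Exec b c s s' k ∧ k ≤ K ∧ Q s'

infixr:35 " ;; " => Cmd.seq

namespace Runs
variable {b : ℕ} {c c' : Cmd} {s : Mem} {K K' : ℕ} {Q R : Mem → Prop} {q : Cond}
  {e i : NExp} {e' : RExp} {v : ℕ}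

theorem set (h : e.eval s < 2 ^ b) (hK : 1 ≤ K) (hQ : Q (s.setN v (e.eval s))) :
    Runs b (.set v e) s K Q := ⟨_, _, .set h, hK, hQ⟩

theorem setInp (h : e.eval s < 2 ^ b) (hK : 1 ≤ K) (hQ : Q (s.setInp (i.eval s) (e.eval s))) :
    Runs b (.setInp i e) s K Q := ⟨_, _, .setInp h, hK, hQ⟩

theorem setTab (hK : 1 ≤ K) (hQ : Q (s.setTab (i.eval s) (e'.eval s))) :
    Runs b (.setTab i e') s K Q := ⟨_, _, .setTab, hK, hQ⟩

theorem skip (hQ : Q s) : Runs b .skip s K Q := ⟨_, _, .skip, Nat.zero_le _, hQ⟩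

theorem seq (h : Runs b c s K' R) (hK : K' ≤ K)
    (h' : ∀ s', Frame c s s' → R s' → Runs b c' s' (K - K') Q) : Runs b (c ;; c') s K Q := by
  obtain ⟨s', k, he, hk, hR⟩ := h
  obtain ⟨s'', k', he', hk', hQ⟩ := h' s' he.frame hR
  exact ⟨s'', _, he.seq he', by omega, hQ⟩

theorem seq_set (h : e.eval s < 2 ^ b) (hK : 1 ≤ K)
    (h' : Runs b c' (s.setN v (e.eval s)) (K - 1) Q) : Runs b (.set v e ;; c') s K Q := by
  obtain ⟨s'', k', he', hk', hQ⟩ := h'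
  exact ⟨s'', _, (Exec.set h).seq he', by omega, hQ⟩

theorem seq_setArr (h : e.eval s < 2 ^ b) (hK : 1 ≤ K)
    (h' : Runs b c' (s.setArr (i.eval s) (e.eval s)) (K - 1) Q) :
    Runs b (.setArr i e ;; c') s K Q := by
  obtain ⟨s'', k', he', hk', hQ⟩ := h'
  exact ⟨s'', _, (Exec.setArr h).seq he', by omega, hQ⟩

theorem seq_rset (hK : 1 ≤ K) (h' : Runs b c' (s.setR v (e'.eval s)) (K - 1) Q) :
    Runs b (.rset v e' ;; c') s K Q := by
  obtain ⟨s'', k', he', hk', hQ⟩ := h'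
  exact ⟨s'', _, Exec.rset.seq he', by omega, hQ⟩

theorem seq_setTab (hK : 1 ≤ K)
    (h' : Runs b c' (s.setTab (i.eval s) (e'.eval s)) (K - 1) Q) :
    Runs b (.setTab i e' ;; c') s K Q := by
  obtain ⟨s'', k', he', hk', hQ⟩ := h'
  exact ⟨s'', _, Exec.setTab.seq he', by omega, hQ⟩

theorem ite (hK : 1 ≤ K) (h : q.holds s → Runs b c s (K - 1) Q)
    (h' : ¬ q.holds s → Runs b c' s (K - 1) Q) : Runs b (.ite q c c') s K Q := by
  by_cases hq : q.holds s
  · obtain ⟨s', k, he, hk, hQ⟩ := h hq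
    exact ⟨s', _, .iteTrue hq he, by omega, hQ⟩
  · obtain ⟨s', k, he, hk, hQ⟩ := h' hq
    exact ⟨s', _, .iteFalse hq he, by omega, hQ⟩

theorem mono (h : Runs b c s K R) (hK : K ≤ K') (hQ : ∀ s', Frame c s s' → R s' → Q s') :
    Runs b c s K' Q := by
  obtain ⟨s', k, he, hk, hR⟩ := h
  exact ⟨s', k, he, hk.trans hK, hQ s' he.frame hR⟩

/-- Loops with a variant `m` that drops in each round. -/
theorem loop {J : Mem → Prop} (m : Mem → ℕ) {T : ℕ} (h0 : J s)
    (hstep : ∀ s', Frame c s s' → J s' → q.holds s' →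
      Runs b c s' T (fun s'' => J s'' ∧ m s'' < m s'))
    (hK : m s * (T + 1) + 1 ≤ K) :
    Runs b (.loop q c) s K (fun s' => J s' ∧ ¬ q.holds s') := by
  suffices H : ∀ n, ∀ s', Frame c s s' → J s' → m s' ≤ n →
      Runs b (.loop q c) s' (n * (T + 1) + 1) (fun s' => J s' ∧ ¬ q.holds s') from
    (H _ s (.refl _ _) h0 le_rfl).mono hK fun _ _ h => h
  intro n
  induction n with
  | zero =>
    intro s' hF hJ hm
    have hq : ¬ q.holds s' := by
      intro hq
      obtain ⟨s'', k, he, hk, -, hlt⟩ := hstep s' hF hJ hq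
      omega
    exact ⟨s', 1, .loopFalse hq, by omega, hJ, hq⟩
  | succ n ih =>
    intro s' hF hJ hm
    by_cases hq : q.holds s'
    · obtain ⟨s'', k, he, hk, hJ', hlt⟩ := hstep s' hF hJ hq
      obtain ⟨s₃, k₃, he₃, hk₃, hQ⟩ := ih s'' (hF.trans he.frame) hJ' (by omega)
      refine ⟨s₃, _, .loopTrue hq he he₃, ?_, hQ⟩
      rw [add_mul, one_mul]
      omega
    · exact ⟨s', 1, .loopFalse hq, by omega, hJ, hq⟩

end Runs

/-- `for v = 0, …, e - 1 do c` -/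
def Cmd.forTo (v : ℕ) (e : NExp) (c : Cmd) : Cmd :=
  .set v 0 ;; .loop (.nlt (.var v) e) (c ;; .set v (.var v + 1))

/-- Rule for `for`-loops: `I j` is the invariant before round `j`. -/
theorem Runs.forTo {b : ℕ} {v : ℕ} {e : NExp} {c : Cmd} {s : Mem} (I : ℕ → Mem → Prop)
    (n T : ℕ) {K : ℕ} (hn : n < 2 ^ b) (hv : c.writes (.n v) = false)
    (he : ∀ j s', Frame (.forTo v e c) s s' → s'.n v = j → j ≤ n → I j s' → e.eval s' = n)
    (h0 : I 0 (s.setN v 0))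
    (hstep : ∀ j < n, ∀ s', Frame (.forTo v e c) s s' → s'.n v = j → I j s' →
      Runs b c s' T (fun s'' => I (j + 1) (s''.setN v (j + 1))))
    (hK : n * (T + 2) + 2 ≤ K) :
    Runs b (.forTo v e c) s K (fun s' => s'.n v = n ∧ I n s') := by
  have hF0 : Frame (.forTo v e c) s (s.setN v 0) := by
    constructor <;> simp +contextual [Cmd.writes, Cmd.forTo]
  have hcv : ∀ {s' s''}, Frame (c ;; .set v (.var v + 1)) s' s'' →
      Frame (.forTo v e c) s' s'' := by
    intro s' s'' h
    exact h.mono (by simp +contextual [Cmd.writes, Cmd.forTo])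
  refine Runs.seq_set (by simp) (by omega) ?_
  simp only [NExp.eval_ofNat]
  refine (Runs.loop (J := fun s' => s'.n v ≤ n ∧ I (s'.n v) s') (fun s' => n - s'.n v)
    (T := T + 1) (by simpa using h0) ?_ (K := K - 1)
    (by have : n * (T + 1 + 1) = n * (T + 2) := rfl
        simp; omega)).mono le_rfl ?_
  · rintro s' hF ⟨hle, hI⟩ hq
    have hF' := hF0.trans (hcv hF)
    have hev := he _ s' hF' rfl hle hI
    rw [Cond.holds_nlt, NExp.eval_var, hev] at hq
    refine (hstep _ hq s' hF' rfl hI).seq (by omega) fun s'' hF'' hI' => ?_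
    have hvv := hF''.n v hv
    refine Runs.set ?_ (by omega) ?_
    · simp [hvv]; omega
    · simp only [NExp.eval_add, NExp.eval_var, NExp.eval_ofNat, hvv]
      refine ⟨⟨by simpa using hq, by simpa using hI'⟩, ?_⟩
      simp; omega
  · rintro s' hF ⟨⟨hle, hI⟩, hq⟩
    have hF' := hF0.trans (hcv (hF.mono (by simp [Cmd.writes])))
    have hev := he _ s' hF' rfl hle hI
    rw [Cond.holds_nlt, NExp.eval_var, hev] at hq
    have : s'.n v = n := by omega
    exact ⟨this, this ▸ hI⟩

end OneMeans

namespace OneMeans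

/-! ### Cells of a shifted grid on a line

The line is divided into cells `{z | z / E = c}` of length `E`. -/

/-- Lower bound for the distance of the point `z` from cell number `c` (rounded positions). -/
def gap (E z c : ℕ) : ℕ := ((z / E - c) * E + z % E - E) + ((c - z / E) * E - (z % E + 1))

/-- `gap E z (z / E + u - t)`, also where `z / E + u < t`. -/
def gapAt (E t k u : ℕ) : ℕ := ((t - u) * E + k - E) + ((u - t) * E - (k + 1))

/-- The index `u` is the cell number relative to the cell of `z`, raised by `t` to stay in ℕ; both
truncated differences then agree. -/
theorem gapAt_eq {E t z c u : ℕ} (h : z / E + u = c + t) : gapAt E t (z % E) u = gap E z c := by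
  generalize hy : z / E = y at h
  have h1 : t - u = y - c := by omega
  have h2 : u - t = c - y := by omega
  simp only [gapAt, gap, hy, h1, h2]

/-- This justifies the search window of `2 * t + 1` cells: a cell more than `t` cells away exhausts
the budget `t * t` on its own. -/
theorem le_gap_of_lt {E t z c : ℕ} (hE : 0 < E) (h : c + t < z / E ∨ z / E + t < c) :
    t ≤ gap E z c := by
  have hk := Nat.mod_lt z hE
  unfold gap
  rcases h with h | h
  · have : (t + 1) * E ≤ (z / E - c) * E := Nat.mul_le_mul_right _ (by omega)
    have : t ≤ t * E := Nat.le_mul_of_pos_right _ hE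
    rw [add_mul, one_mul] at *
    omega
  · have : (t + 1) * E ≤ (c - z / E) * E := Nat.mul_le_mul_right _ (by omega)
    have : t ≤ t * E := Nat.le_mul_of_pos_right _ hE
    rw [add_mul, one_mul] at *
    omega

/-- The number with digits `f 0, …, f (l - 1)` in base `V`, after the leading part `g`. -/
def horner (V g : ℕ) (f : ℕ → ℕ) : ℕ → ℕ
  | 0 => g
  | l + 1 => horner V g f l * V + f l

theorem mul_add_inj {V a b x y : ℕ} (hx : x < V) (hy : y < V) :
    a * V + x = b * V + y ↔ a = b ∧ x = y := by
  constructor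
  · intro h
    have h1 : (a * V + x) / V = (b * V + y) / V := by rw [h]
    have h2 : (a * V + x) % V = (b * V + y) % V := by rw [h]
    have hV : 0 < V := by omega
    rw [mul_comm a, mul_comm b, Nat.mul_add_div hV, Nat.mul_add_div hV,
      Nat.div_eq_of_lt hx, Nat.div_eq_of_lt hy] at h1
    rw [mul_comm a, mul_comm b, Nat.mul_add_mod, Nat.mul_add_mod, Nat.mod_eq_of_lt hx,
      Nat.mod_eq_of_lt hy] at h2
    exact ⟨by simpa using h1, h2⟩
  · rintro ⟨rfl, rfl⟩; rfl

/-- Unique decoding lets the cells of all scales and shifts share one table. -/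
theorem horner_inj {V g g' : ℕ} {f f' : ℕ → ℕ} {d : ℕ} (hf : ∀ l < d, f l < V)
    (hf' : ∀ l < d, f' l < V) :
    horner V g f d = horner V g' f' d ↔ g = g' ∧ ∀ l < d, f l = f' l := by
  induction d with
  | zero => simp [horner]
  | succ d ih =>
    rw [horner, horner, mul_add_inj (hf d (by omega)) (hf' d (by omega)),
      ih (fun l hl => hf l (by omega)) (fun l hl => hf' l (by omega)), and_assoc]
    refine and_congr_right fun _ => ⟨fun ⟨h1, h2⟩ l hl => ?_,
      fun h => ⟨fun l hl => h l (by omega), h d (by omega)⟩⟩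
    rcases Nat.lt_succ_iff_lt_or_eq.1 hl with h | rfl
    exacts [h1 l h, h2]

/-- The bound `(g + 1) * V ^ l` for numbers with leading part `g` and `l` digits. -/
theorem horner_lt {V g : ℕ} {f : ℕ → ℕ} {l : ℕ} (hf : ∀ i < l, f i < V) :
    horner V g f l < (g + 1) * V ^ l := by
  induction l with
  | zero => simp [horner]
  | succ l ih =>
    have h1 := ih fun i hi => hf i (by omega)
    have h2 := hf l (by omega)
    calc horner V g f l * V + f l < (horner V g f l + 1) * V := by rw [add_mul]; omega
      _ ≤ (g + 1) * V ^ l * V := Nat.mul_le_mul_right _ h1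
      _ = _ := by rw [pow_succ, mul_assoc]

/-! ### Enumeration of the cells near a point -/

/-- Extension of a partial cell by the cells in the next coordinate, in which the point has the
rounded position `z`.  A partial cell is recorded by its number and the remaining budget. -/
def expand (E t V z : ℕ) (p : ℕ × ℕ) : List (ℕ × ℕ) :=
  (List.range (2 * t + 1)).filterMap fun u =>
    if gapAt E t (z % E) u * gapAt E t (z % E) u < p.2 then
      some (p.1 * V + z / E + u, p.2 - gapAt E t (z % E) u * gapAt E t (z % E) u)
    else none

/-- The partial cells, after `l` coordinates, near the point with rounded positions `z`. -/
def frontier (E t V g : ℕ) (z : ℕ → ℕ) : ℕ → List (ℕ × ℕ)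
  | 0 => [(g, t * t)]
  | l + 1 => (frontier E t V g z l).flatMap (expand E t V (z l))

variable {E t V g : ℕ} {z : ℕ → ℕ}

theorem mem_expand {z : ℕ} {p q : ℕ × ℕ} : q ∈ expand E t V z p ↔ ∃ u < 2 * t + 1,
    gapAt E t (z % E) u * gapAt E t (z % E) u < p.2 ∧ q = (p.1 * V + z / E + u,
      p.2 - gapAt E t (z % E) u * gapAt E t (z % E) u) := by
  simp only [expand, List.mem_filterMap, List.mem_range]
  refine exists_congr fun u => and_congr_right fun _ => ?_
  split_ifs with h <;> simp [h, eq_comm]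

theorem frontier_budget (ht : 1 ≤ t) {l : ℕ} {p : ℕ × ℕ} (hp : p ∈ frontier E t V g z l) :
    0 < p.2 ∧ p.2 ≤ t * t := by
  induction l generalizing p with
  | zero =>
    simp only [frontier, List.mem_singleton] at hp
    subst hp
    exact ⟨Nat.mul_pos ht ht, le_rfl⟩
  | succ l ih =>
    obtain ⟨q, hq, hp⟩ := List.mem_flatMap.1 hp
    obtain ⟨u, hu, hlt, rfl⟩ := mem_expand.1 hp
    have := ih hq
    dsimp only
    omega

/-- The leading part records scale and shift, so an enumeration never meets cells of another grid.
-/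
theorem frontier_lead {l : ℕ} (hV : ∀ i < l, z i / E + 2 * t < V) {p : ℕ × ℕ}
    (hp : p ∈ frontier E t V g z l) : p.1 / V ^ l = g := by
  induction l generalizing p with
  | zero =>
    simp only [frontier, List.mem_singleton] at hp
    simp [hp]
  | succ l ih =>
    obtain ⟨q, hq, hp⟩ := List.mem_flatMap.1 hp
    obtain ⟨u, hu, hlt, rfl⟩ := mem_expand.1 hp
    have h1 := ih (fun i hi => hV i (by omega)) hq
    have h2 := hV l (by omega)
    dsimp only
    generalize z l / E = y at *
    rw [pow_succ', ← Nat.div_div_eq_div_mul, add_assoc, mul_comm q.1,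
      Nat.mul_add_div (by omega), Nat.div_eq_of_lt (a := y + u) (by omega), add_zero, h1]

theorem frontier_lt {l : ℕ} (hV : ∀ i < l, z i / E + 2 * t < V) {p : ℕ × ℕ} (hV0 : 0 < V)
    (hp : p ∈ frontier E t V g z l) : p.1 < (g + 1) * V ^ l := by
  rw [← frontier_lead hV hp]
  exact Nat.lt_mul_of_div_lt (Nat.lt_succ_self _) (pow_pos hV0 l)

theorem expand_nodup {z : ℕ} (p : ℕ × ℕ) : ((expand E t V z p).map Prod.fst).Nodup := by
  refine List.Nodup.map_on ?_ ?_
  · intro q hq q' hq' h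
    obtain ⟨u, -, -, rfl⟩ := mem_expand.1 hq
    obtain ⟨u', -, -, rfl⟩ := mem_expand.1 hq'
    have : u = u' := by simpa using h
    rw [this]
  · refine List.Nodup.filterMap ?_ List.nodup_range
    intro u u' q hq hq'
    split_ifs at hq <;> split_ifs at hq' <;> simp_all
    have := hq.trans hq'.symm
    rw [Prod.ext_iff] at this
    simpa using this.1

/-- Needed so that summing the table over the cells found counts no point twice. -/
theorem frontier_nodup {l : ℕ} (hV : ∀ i < l, z i / E + 2 * t < V) :
    ((frontier E t V g z l).map Prod.fst).Nodup := by
  induction l with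
  | zero => simp [frontier]
  | succ l ih =>
    rw [frontier, List.map_flatMap, List.nodup_flatMap]
    refine ⟨fun p _ => expand_nodup p, ?_⟩
    have h := ih fun i hi => hV i (by omega)
    have hl := hV l (by omega)
    rw [List.Nodup, List.pairwise_map] at h
    refine h.imp fun {p p'} hne => ?_
    simp only [Function.onFun, List.Disjoint, List.mem_map]
    rintro x ⟨q, hq, rfl⟩ ⟨q', hq', h'⟩
    obtain ⟨u, hu, -, rfl⟩ := mem_expand.1 hq
    obtain ⟨u', hu', -, rfl⟩ := mem_expand.1 hq'
    dsimp only at h'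
    rw [add_assoc, add_assoc, mul_add_inj (by omega) (by omega)] at h'
    exact hne h'.1.symm

/-- Which cells are found: those whose gaps to the point have square sum below `t ^ 2`. -/
theorem mem_frontier {c : ℕ → ℕ} {l : ℕ} (hE : 0 < E) (ht : 1 ≤ t)
    (hV : ∀ i < l, z i / E + 2 * t < V) (hc : ∀ i < l, c i + t < V) {rem : ℕ} :
    (horner V g (fun i => c i + t) l, rem) ∈ frontier E t V g z l ↔
      rem + ∑ i ∈ Finset.range l, gap E (z i) (c i) * gap E (z i) (c i) = t * t ∧ 0 < rem := by
  induction l generalizing rem with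
  | zero =>
    simp only [horner, frontier, List.mem_singleton, Prod.mk.injEq, true_and, Finset.range_zero,
      Finset.sum_empty, add_zero]
    refine ⟨fun h => ⟨h, h ▸ Nat.mul_pos ht ht⟩, fun h => h.1⟩
  | succ l ih =>
    have hl := hV l (by omega)
    have hcl := hc l (by omega)
    have ih' := fun {rem} => ih (fun i hi => hV i (by omega)) (fun i hi => hc i (by omega))
      (rem := rem)
    rw [Finset.sum_range_succ, frontier, List.mem_flatMap, horner]
    constructor
    · rintro ⟨p, hp, hq⟩
      obtain ⟨u, hu, hlt, h⟩ := mem_expand.1 hq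
      rw [Prod.mk.injEq, add_assoc, mul_add_inj hcl (by omega)] at h
      obtain ⟨⟨h1, h2⟩, h3⟩ := h
      rw [gapAt_eq h2.symm] at h3 hlt
      obtain ⟨p1, p2⟩ := p
      dsimp only at h1 h3 hlt
      subst h1
      have := ih'.1 hp
      omega
    · rintro ⟨h1, h2⟩
      set G := gap E (z l) (c l) with hG
      have hGt : G < t := by
        by_contra hcon
        have := Nat.mul_le_mul (not_lt.1 hcon) (not_lt.1 hcon)
        omega
      -- A gap below `t` puts the cell into the window that `expand` scans.
      have hn : ¬ (c l + t < z l / E ∨ z l / E + t < c l) := fun h =>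
        absurd (le_gap_of_lt hE h) (by omega)
      refine ⟨(_, rem + G * G), ih'.2 (by omega), mem_expand.2 ⟨c l + t - z l / E, by omega, ?_⟩⟩
      rw [gapAt_eq (c := c l) (by omega), ← hG]
      dsimp only
      refine ⟨by omega, Prod.ext ?_ ?_⟩ <;> dsimp only <;> omega

end OneMeans

namespace OneMeans

/-! ### Cells and distances -/

/-- The cell of `q` lies before, at or after that of `p`. The `+ 1` pays for rounding: if integer
parts differ by at least the gap plus 1, the unrounded positions differ by more than the gap. -/
theorem gap_bounds {E p q j : ℕ} (hE : 0 < E) :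
    (gap E (p + j) ((q + j) / E) = 0 ∨ gap E (p + j) ((q + j) / E) + 1 + q ≤ p ∨
      gap E (p + j) ((q + j) / E) + 1 + p ≤ q) ∧
    p ≤ q + gap E (p + j) ((q + j) / E) + E ∧ q ≤ p + gap E (p + j) ((q + j) / E) + E := by
  have hz := Nat.div_add_mod (p + j) E
  have hw := Nat.div_add_mod (q + j) E
  have hk := Nat.mod_lt (p + j) hE
  have hk' := Nat.mod_lt (q + j) hE
  unfold gap
  generalize (p + j) / E = c at *
  generalize (p + j) % E = k at *
  generalize (q + j) / E = c' at *
  generalize (q + j) % E = k' at *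
  rcases lt_trichotomy c c' with h | rfl | h
  · obtain ⟨b, rfl⟩ := Nat.exists_eq_add_of_lt h
    have e1 : c - (c + b + 1) = 0 := by omega
    have e2 : c + b + 1 - c = b + 1 := by omega
    have e3 : E * (c + b + 1) = E * c + b * E + E := by ring
    rw [e1, e2, add_mul, one_mul, zero_mul]
    omega
  · simp only [Nat.sub_self, zero_mul]
    omega
  · obtain ⟨b, rfl⟩ := Nat.exists_eq_add_of_lt h
    have e1 : c' - (c' + b + 1) = 0 := by omega
    have e2 : c' + b + 1 - c' = b + 1 := by omega
    have e3 : E * (c' + b + 1) = E * c' + b * E + E := by ring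
    rw [e1, e2, add_mul, one_mul, zero_mul]
    omega

/-- One `E` in the upper bound is the length of a cell; the other absorbs the rounding error, which
is less than 1. -/
theorem gap_abs {E p q j : ℕ} (hE : 0 < E) {α β : ℝ} (hp : (p : ℝ) ≤ α) (hp' : α < p + 1)
    (hq : (q : ℝ) ≤ β) (hq' : β < q + 1) :
    (gap E (p + j) ((q + j) / E) = 0 ∨ (gap E (p + j) ((q + j) / E) : ℝ) < |α - β|) ∧
      |α - β| ≤ gap E (p + j) ((q + j) / E) + 2 * E := by
  obtain ⟨h1, h2, h3⟩ := gap_bounds (p := p) (q := q) (j := j) hE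
  generalize gap E (p + j) ((q + j) / E) = G at *
  have hE' : (1 : ℝ) ≤ E := by exact_mod_cast hE
  have h2' : (p : ℝ) ≤ q + G + E := by exact_mod_cast h2
  have h3' : (q : ℝ) ≤ p + G + E := by exact_mod_cast h3
  refine ⟨?_, abs_le.2 ⟨by linarith, by linarith⟩⟩
  rcases h1 with h | h | h
  · exact .inl h
  · have h' : (G : ℝ) + 1 + q ≤ p := by exact_mod_cast h
    exact .inr (lt_of_lt_of_le (by linarith) (le_abs_self _))
  · have h' : (G : ℝ) + 1 + p ≤ q := by exact_mod_cast h
    exact .inr (lt_of_lt_of_le (by linarith) (neg_le_abs _))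

/-- The rounded position at scale `i` of a point with integer coordinate `y`. -/
def pos (E t i y : ℕ) : ℕ := 4 * E * E * t * y / 2 ^ i

/-- The unit of length in which rounded positions at scale `i` are measured. -/
noncomputable def radius (E i : ℕ) : ℝ := 2 ^ i / (4 * E * E)

theorem radius_pos {E : ℕ} (hE : 0 < E) (i : ℕ) : 0 < radius E i := by
  unfold radius; positivity

/-- `pos` is the integer part of `t / radius E i * y`, so `gap_abs` applies. -/
theorem pos_gap {E t : ℕ} (hE : 0 < E) (i j x y : ℕ) :
    (gap E (pos E t i x + j) ((pos E t i y + j) / E) = 0 ∨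
      (gap E (pos E t i x + j) ((pos E t i y + j) / E) : ℝ) < |t / radius E i * ((x : ℝ) - y)|) ∧
    |t / radius E i * ((x : ℝ) - y)| ≤
      gap E (pos E t i x + j) ((pos E t i y + j) / E) + 2 * E := by
  have key : ∀ y : ℕ, ((pos E t i y : ℕ) : ℝ) ≤ t / radius E i * y ∧
      t / radius E i * y < (pos E t i y : ℕ) + 1 := by
    intro y
    have hpow : (0 : ℝ) < 2 ^ i := by positivity
    have e : (t / radius E i * y : ℝ) = ((4 * E * E * t * y : ℕ) : ℝ) / ((2 ^ i : ℕ) : ℝ) := by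
      have hE' : (E : ℝ) ≠ 0 := by positivity
      unfold radius; push_cast; field_simp
    rw [e]
    refine ⟨Nat.cast_div_le, ?_⟩
    rw [div_lt_iff₀ (by exact_mod_cast hpow)]
    have : 4 * E * E * t * y < (pos E t i y + 1) * 2 ^ i := by
      rw [mul_comm (_ + 1)]
      exact Nat.lt_mul_div_succ _ (by positivity)
    exact_mod_cast this
  rw [mul_sub]
  exact gap_abs hE (key x).1 (key x).2 (key y).1 (key y).2

/-- The conclusion is strict even on the boundary of the ball: every nonzero gap is strictly below
the coordinate difference, and if all gaps vanish then the sum is 0. -/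
theorem sum_gap_lt {E t d : ℕ} (hE : 0 < E) (ht : 0 < t) {i : ℕ} (j : ℕ) {x y : ℕ → ℕ}
    (h : ∑ l ∈ Finset.range d, ((x l : ℝ) - y l) ^ 2 ≤ radius E i ^ 2) :
    ∑ l ∈ Finset.range d, gap E (pos E t i (x l) + j) ((pos E t i (y l) + j) / E) *
      gap E (pos E t i (x l) + j) ((pos E t i (y l) + j) / E) < t * t := by
  set G := fun l => gap E (pos E t i (x l) + j) ((pos E t i (y l) + j) / E) with hG
  change ∑ l ∈ Finset.range d, G l * G l < t * t
  have hr := radius_pos hE i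
  have hD : ∑ l ∈ Finset.range d, (t / radius E i * ((x l : ℝ) - y l)) ^ 2 ≤ t ^ 2 := by
    simp only [mul_pow, div_pow]
    rw [← Finset.mul_sum, div_mul_eq_mul_div, div_le_iff₀ (by positivity)]
    exact mul_le_mul_of_nonneg_left h (by positivity)
  have hle : ∀ l, G l ≠ 0 → (G l : ℝ) ^ 2 < (t / radius E i * ((x l : ℝ) - y l)) ^ 2 := by
    intro l hl
    rcases (pos_gap (t := t) hE i j (x l) (y l)).1 with h | h
    · exact absurd h hl
    · rw [← sq_abs (t / radius E i * _)]
      exact pow_lt_pow_left₀ h (by positivity) (by norm_num)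
  by_cases h0 : ∀ l ∈ Finset.range d, G l = 0
  · rw [Finset.sum_eq_zero fun l hl => by rw [h0 l hl, zero_mul]]
    positivity
  · push Not at h0
    obtain ⟨l₀, hl₀, hne⟩ := h0
    have : (∑ l ∈ Finset.range d, (G l : ℝ) ^ 2) < t ^ 2 := by
      refine lt_of_lt_of_le (Finset.sum_lt_sum (fun l _ => ?_) ⟨l₀, hl₀, hle l₀ hne⟩) hD
      by_cases hl : G l = 0
      · rw [hl]; simpa using sq_nonneg _
      · exact (hle l hl).le
    simp only [sq] at this
    exact_mod_cast this

/-- In each coordinate the difference is at most the gap plus 2E, so the squares sum to at most 2t²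
+ 8dE² units. Then d ≤ t²E turns this into 10E³t². This is the source of the exponent 3/2. -/
theorem sum_sq_le {E t d : ℕ} (hE : 0 < E) (ht : 0 < t) (htd : d ≤ t * t * E) {i j : ℕ}
    {x y : ℕ → ℕ}
    (h : ∑ l ∈ Finset.range d, gap E (pos E t i (x l) + j) ((pos E t i (y l) + j) / E) *
      gap E (pos E t i (x l) + j) ((pos E t i (y l) + j) / E) < t * t) :
    ∑ l ∈ Finset.range d, ((x l : ℝ) - y l) ^ 2 ≤ 10 * E ^ 3 * radius E i ^ 2 := by
  set G := fun l => gap E (pos E t i (x l) + j) ((pos E t i (y l) + j) / E) with hG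
  change ∑ l ∈ Finset.range d, G l * G l < t * t at h
  have hr := radius_pos hE i
  have hE1 : (1 : ℝ) ≤ E := by exact_mod_cast hE
  have htpos : (0 : ℝ) < t := by exact_mod_cast ht
  have hG2 : ∑ l ∈ Finset.range d, (G l : ℝ) ^ 2 ≤ t ^ 2 := by
    simp only [sq]
    exact_mod_cast h.le
  have htd' : (d : ℝ) ≤ t ^ 2 * E := by rw [sq]; exact_mod_cast htd
  have hD : ∑ l ∈ Finset.range d, (t / radius E i * ((x l : ℝ) - y l)) ^ 2 ≤
      10 * E ^ 3 * t ^ 2 := by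
    calc _ ≤ ∑ l ∈ Finset.range d, (2 * (G l : ℝ) ^ 2 + 8 * E ^ 2) := by
          refine Finset.sum_le_sum fun l _ => ?_
          have h1 := (pos_gap (t := t) hE i j (x l) (y l)).2
          rw [← sq_abs]
          calc _ ≤ ((G l : ℝ) + 2 * E) ^ 2 := pow_le_pow_left₀ (abs_nonneg _) h1 2
            _ ≤ _ := by nlinarith [sq_nonneg ((G l : ℝ) - 2 * E)]
      _ = 2 * ∑ l ∈ Finset.range d, (G l : ℝ) ^ 2 + d * (8 * E ^ 2) := by
          rw [Finset.sum_add_distrib, Finset.mul_sum]; simp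
      _ ≤ 2 * t ^ 2 + t ^ 2 * E * (8 * E ^ 2) := by gcongr
      _ ≤ 10 * E ^ 3 * t ^ 2 := by
          have : (1 : ℝ) ≤ E ^ 3 := one_le_pow₀ hE1
          nlinarith [mul_le_mul_of_nonneg_right this (sq_nonneg (t : ℝ))]
  simp only [mul_pow, div_pow] at hD
  rw [← Finset.mul_sum, div_mul_eq_mul_div, div_le_iff₀ (by positivity)] at hD
  have : (0 : ℝ) < t ^ 2 := by positivity
  nlinarith

/-- At scale `0` no cell contains two points. -/
theorem eq_of_cells_eq {E t d : ℕ} (hE : 0 < E) (ht : 0 < t) (htd : d ≤ t * t * E) {j : ℕ}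
    (hE4 : 4 ≤ E) {x y : ℕ → ℕ}
    (h : ∑ l ∈ Finset.range d, gap E (pos E t 0 (x l) + j) ((pos E t 0 (y l) + j) / E) *
      gap E (pos E t 0 (x l) + j) ((pos E t 0 (y l) + j) / E) < t * t) :
    ∀ l < d, x l = y l := by
  have h1 := sum_sq_le hE ht htd h
  have hE' : (4 : ℝ) ≤ E := by exact_mod_cast hE4
  -- The denominator 4E² of `radius` is chosen for this: the bound becomes 10/(16E), less than the
  -- least squared distance 1 of distinct grid points.
  have h2 : 10 * (E : ℝ) ^ 3 * radius E 0 ^ 2 < 1 := by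
    have : 10 * (E : ℝ) ^ 3 * radius E 0 ^ 2 = 10 / 16 / E := by
      unfold radius; field_simp; norm_num
    rw [this, div_lt_one (by positivity)]
    linarith
  intro l hl
  by_contra hne
  have h3 : ((x l : ℝ) - y l) ^ 2 < 1 := by
    refine lt_of_le_of_lt ?_ (h1.trans_lt h2)
    exact Finset.single_le_sum (f := fun l => ((x l : ℝ) - y l) ^ 2) (fun _ _ => sq_nonneg _)
      (Finset.mem_range.2 hl)
  have h4 : ((x l : ℤ) - y l) ^ 2 < 1 := by exact_mod_cast h3
  have h5 : (x l : ℤ) - y l ≠ 0 := by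
    rw [sub_ne_zero]; exact_mod_cast hne
  have := sq_pos_of_ne_zero h5
  omega

theorem gap_self (E z : ℕ) (hE : 0 < E) : gap E z (z / E) = 0 := by
  have := Nat.mod_lt z hE
  simp only [gap, Nat.sub_self, zero_mul]
  omega

end OneMeans

namespace OneMeans

/-! ### Counting the cells near a point -/

/-- Penalty of a point with offset `k` in its cell of length `E`, for closeness to the ends. -/
def penalty (E k : ℕ) : ℕ := E * E / (1 + k * k) + E * E / (1 + (E - 1 - k) * (E - 1 - k))

/-- Telescoping: the term with index n + 1 is at most 2/(n+1) - 2/(n+2). -/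
theorem sum_one_div_sq_le (n : ℕ) :
    ∑ k ∈ Finset.range (n + 1), (1 : ℝ) / (1 + k * k) ≤ 3 - 2 / (n + 1) := by
  induction n with
  | zero => norm_num
  | succ n ih =>
    rw [Finset.sum_range_succ]
    have : (1 : ℝ) / (1 + (n + 1 : ℕ) * (n + 1 : ℕ)) ≤ 2 / (n + 1) - 2 / (n + 2) := by
      push_cast
      rw [div_sub_div _ _ (by positivity) (by positivity), div_le_div_iff₀ (by positivity)
        (by positivity)]
      nlinarith [(Nat.cast_nonneg n : (0 : ℝ) ≤ n)]
    push_cast at this ⊢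
    have e : (n : ℝ) + 1 + 1 = n + 2 := by ring
    rw [e]
    linarith

/-- Only the nearest cell, b = 0, matters. For b ≥ 1 the term is at most 1/(bE)², and 1/b² ≤ 2(1/b -
1/(b+1)) telescopes. -/
theorem sum_one_div_le (E k n : ℕ) (hE : 0 < E) :
    ∑ b ∈ Finset.range n, (1 : ℝ) / (1 + (b * E + k) * (b * E + k)) ≤
      1 / (1 + k * k) + 2 / (E * E) := by
  suffices H : ∑ b ∈ Finset.range (n + 1), (1 : ℝ) / (1 + (b * E + k) * (b * E + k)) ≤
      1 / (1 + k * k) + 2 / (E * E) * (1 - 1 / (n + 1)) by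
    rw [Finset.sum_range_succ] at H
    have h1 : (0 : ℝ) ≤ 1 / (1 + (n * E + k) * (n * E + k)) := by positivity
    have h2 : (0 : ℝ) ≤ 2 / (E * E) * (1 / (n + 1)) := by positivity
    linarith
  induction n with
  | zero => simp
  | succ n ih =>
    rw [Finset.sum_range_succ]
    have hE' : (0 : ℝ) < E := by exact_mod_cast hE
    have h1 : (1 : ℝ) / (1 + ((n + 1 : ℕ) * E + k) * ((n + 1 : ℕ) * E + k)) ≤
        2 / (E * E) * (1 / (n + 1) - 1 / (n + 2)) := by
      have e : (2 : ℝ) / (E * E) * (1 / (n + 1) - 1 / (n + 2)) =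
          1 / ((E * E) * ((n + 1) * (n + 2) / 2)) := by field_simp; ring
      rw [e]
      refine one_div_le_one_div_of_le (by positivity) ?_
      have h2 : ((n : ℝ) + 1) * (n + 2) / 2 ≤ (n + 1) * (n + 1) := by
        nlinarith [(Nat.cast_nonneg n : (0 : ℝ) ≤ n)]
      have h3 : (E * E : ℝ) * ((n + 1) * (n + 2) / 2) ≤ E * E * ((n + 1) * (n + 1)) := by gcongr
      have h4 : (0 : ℝ) ≤ (n + 1) * E * k := by positivity
      have h5 : (0 : ℝ) ≤ (k : ℝ) * k := by positivity
      push_cast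
      nlinarith
    push_cast at h1 ⊢
    have e : (n : ℝ) + 1 + 1 = n + 2 := by ring
    rw [e]
    linarith

theorem exp_neg_le (x : ℝ) : Real.exp (-(x * x)) ≤ 1 / (1 + x * x) := by
  rw [Real.exp_neg, one_div]
  exact inv_anti₀ (by nlinarith [mul_self_nonneg x]) (by linarith [Real.add_one_le_exp (x * x)])

theorem gapAt_lower (E k b t : ℕ) (hb : b < t) : gapAt E t k (t - 1 - b) = b * E + k := by
  have e1 : t - (t - 1 - b) = b + 1 := by omega
  have e2 : t - 1 - b - t = 0 := by omega
  rw [gapAt, e1, e2, add_mul]; omega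

theorem gapAt_upper (E k b t : ℕ) (hk : k < E) :
    gapAt E t k (t + 1 + b) = b * E + (E - 1 - k) := by
  have e1 : t - (t + 1 + b) = 0 := by omega
  have e2 : t + 1 + b - t = b + 1 := by omega
  rw [gapAt, e1, e2, add_mul]; omega

theorem gapAt_middle (E k t : ℕ) (hk : k < E) : gapAt E t k t = 0 := by
  simp only [gapAt, Nat.sub_self, zero_mul]; omega

/-- As 1 + k² ≤ E², the quotient E²/(1 + k²) is at least 1, so rounding it down, as the program
must, loses at most a factor 2. -/
theorem one_div_le_penalty {E k : ℕ} (hk : k < E) :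
    (1 : ℝ) / (1 + k * k) ≤ 2 * (E * E / (1 + k * k) : ℕ) / (E * E) := by
  have hE : (0 : ℝ) < E := by exact_mod_cast (by omega : 0 < E)
  rw [div_le_div_iff₀ (by positivity) (by positivity)]
  have h1 : 1 + k * k ≤ E * E := by
    have := Nat.mul_le_mul (show k + 1 ≤ E from hk) (show k + 1 ≤ E from hk)
    nlinarith
  have h2 : 1 ≤ E * E / (1 + k * k) := (Nat.one_le_div_iff (by omega)).2 h1
  have h3 := Nat.lt_mul_div_succ (E * E) (show 0 < 1 + k * k by omega)
  have h4 : E * E ≤ 2 * (E * E / (1 + k * k)) * (1 + k * k) := by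
    generalize E * E / (1 + k * k) = q at *
    nlinarith
  have : (E * E : ℝ) ≤ 2 * (E * E / (1 + k * k) : ℕ) * (1 + k * k) := by exact_mod_cast h4
  linarith

/-- The cell of the point itself contributes 1. On its two sides the gaps are bE + k and bE +
(E-1-k) with b = 0, 1, …, which give the two halves of the penalty and two tails 2/E². Finally 1 + x
≤ exp x. -/
theorem sum_exp_gapAt_le {E t k : ℕ} (hk : k < E) :
    ∑ u ∈ Finset.range (2 * t + 1), Real.exp (-((gapAt E t k u : ℝ) * gapAt E t k u)) ≤
      Real.exp (2 * penalty E k / (E * E) + 4 / (E * E)) := by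
  have hE : (0 : ℝ) < E := by exact_mod_cast (by omega : 0 < E)
  have h1 : ∑ u ∈ Finset.range t, Real.exp (-((gapAt E t k u : ℝ) * gapAt E t k u)) ≤
      1 / (1 + k * k) + 2 / (E * E) := by
    rw [← Finset.sum_range_reflect]
    refine le_trans (Finset.sum_le_sum fun b hb => ?_) (sum_one_div_le E k t (by omega))
    rw [gapAt_lower _ _ _ _ (Finset.mem_range.1 hb)]
    refine (exp_neg_le _).trans (le_of_eq ?_)
    push_cast; ring
  have h2 : ∑ b ∈ Finset.range t,
      Real.exp (-((gapAt E t k (t + 1 + b) : ℝ) * gapAt E t k (t + 1 + b))) ≤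
      1 / (1 + (E - 1 - k : ℕ) * (E - 1 - k : ℕ)) + 2 / (E * E) := by
    refine le_trans (Finset.sum_le_sum fun b hb => ?_) (sum_one_div_le E (E - 1 - k) t (by omega))
    rw [gapAt_upper _ _ _ _ hk]
    refine (exp_neg_le _).trans (le_of_eq ?_)
    push_cast; ring
  have h3 : 2 * t + 1 = t + 1 + t := by ring
  rw [h3, Finset.sum_range_add, Finset.sum_range_succ, gapAt_middle _ _ _ hk]
  have h4 := one_div_le_penalty hk
  have h5 := one_div_le_penalty (show E - 1 - k < E by omega)
  have h6 := Real.add_one_le_exp (2 * (penalty E k : ℝ) / (E * E) + 4 / (E * E))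
  have h7 : 2 * (penalty E k : ℝ) / (E * E) = 2 * (E * E / (1 + k * k) : ℕ) / (E * E) +
      2 * (E * E / (1 + (E - 1 - k) * (E - 1 - k)) : ℕ) / (E * E) := by
    unfold penalty; push_cast; ring
  have h8 : (4 : ℝ) / (E * E) = 2 / (E * E) + 2 / (E * E) := by ring
  simp only [Nat.cast_zero, mul_zero, neg_zero, Real.exp_zero]
  linarith

/-- A child that is kept has weight exp(budget)·exp(-gap²); those over budget are dropped, which
only removes positive terms from the right-hand side. -/
theorem sum_expand_le {E t V z : ℕ} (p : ℕ × ℕ) :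
    ((expand E t V z p).map fun q => Real.exp q.2).sum ≤
      Real.exp p.2 * ∑ u ∈ Finset.range (2 * t + 1),
        Real.exp (-((gapAt E t (z % E) u : ℝ) * gapAt E t (z % E) u)) := by
  have H : ∀ l : List ℕ, ((l.filterMap fun u =>
      if gapAt E t (z % E) u * gapAt E t (z % E) u < p.2 then
        some (p.1 * V + z / E + u, p.2 - gapAt E t (z % E) u * gapAt E t (z % E) u)
      else none).map fun q => Real.exp q.2).sum ≤ (l.map fun u => Real.exp p.2 *
        Real.exp (-((gapAt E t (z % E) u : ℝ) * gapAt E t (z % E) u))).sum := by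
    intro l
    induction l with
    | nil => simp
    | cons u l ih =>
      rw [List.filterMap_cons, List.map_cons, List.sum_cons]
      have h0 : 0 ≤ Real.exp p.2 *
        Real.exp (-((gapAt E t (z % E) u : ℝ) * gapAt E t (z % E) u)) := by positivity
      split_ifs with h
      · simp only [List.map_cons, List.sum_cons]
        refine add_le_add (le_of_eq ?_) ih
        rw [← Real.exp_add, Nat.cast_sub h.le]
        push_cast; rfl
      · dsimp only; linarith
  rw [Finset.mul_sum]
  exact H _

/-- The potential starts at exp(t²) and each coordinate multiplies it by at most the factor of
`sum_exp_gapAt_le`. -/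
theorem sum_frontier_le {E t V g : ℕ} {z : ℕ → ℕ} (hE : 0 < E) (l : ℕ) :
    ((frontier E t V g z l).map fun q => Real.exp q.2).sum ≤
      Real.exp (t * t + 2 * (∑ i ∈ Finset.range l, penalty E (z i % E) : ℕ) / (E * E) +
        l * (4 / (E * E))) := by
  induction l with
  | zero => simp [frontier]
  | succ l ih =>
    have hG := sum_exp_gapAt_le (E := E) (t := t) (Nat.mod_lt (z l) hE)
    set G := ∑ u ∈ Finset.range (2 * t + 1),
        Real.exp (-((gapAt E t (z l % E) u : ℝ) * gapAt E t (z l % E) u)) with hGdef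
    have hG0 : 0 ≤ G := Finset.sum_nonneg fun _ _ => (Real.exp_pos _).le
    have H : ∀ L : List (ℕ × ℕ), ((L.flatMap (expand E t V (z l))).map
        fun q => Real.exp q.2).sum ≤ (L.map fun q => Real.exp q.2).sum * G := by
      intro L
      induction L with
      | nil => simp
      | cons p L ihL =>
        simp only [List.flatMap_cons, List.map_append, List.sum_append, List.map_cons,
          List.sum_cons, add_mul]
        exact add_le_add (sum_expand_le p) ihL
    rw [frontier, Finset.sum_range_succ]
    refine (H _).trans ((mul_le_mul ih hG hG0 (Real.exp_pos _).le).trans (le_of_eq ?_))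
    rw [← Real.exp_add]
    push_cast
    ring_nf

/-- Each entry has weight at least 1. All levels are covered, not just the last, since the search
also pays for partial cells. -/
theorem length_frontier_le {E t V g d : ℕ} {z : ℕ → ℕ} (hE : 0 < E) {l : ℕ} (hl : l ≤ d) :
    ((frontier E t V g z l).length : ℝ) ≤
      Real.exp (t * t + 2 * (∑ i ∈ Finset.range d, penalty E (z i % E) : ℕ) / (E * E) +
        d * (4 / (E * E))) := by
  have H : ∀ L : List (ℕ × ℕ), (L.length : ℝ) ≤ (L.map fun q => Real.exp q.2).sum := by
    intro L
    induction L with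
    | nil => simp
    | cons p L ih =>
      have : 1 ≤ Real.exp p.2 := Real.one_le_exp (Nat.cast_nonneg _)
      simp only [List.length_cons, List.map_cons, List.sum_cons]
      push_cast
      linarith
  refine (H _).trans ((sum_frontier_le hE l).trans (Real.exp_le_exp.2 ?_))
  have h1 : (∑ i ∈ Finset.range l, penalty E (z i % E)) ≤
      ∑ i ∈ Finset.range d, penalty E (z i % E) :=
    Finset.sum_le_sum_of_subset (Finset.range_mono hl)
  gcongr

/-! ### A good shift -/

/-- The shifts run through all residues. The induction step trades the residue of `a` for the equal
residue of `a + E`. -/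
theorem sum_shift_mod {E : ℕ} (hE : 0 < E) (f : ℕ → ℕ) (a : ℕ) :
    ∑ j ∈ Finset.range E, f ((a + j) % E) = ∑ k ∈ Finset.range E, f k := by
  induction a with
  | zero =>
    refine Finset.sum_congr rfl fun j hj => ?_
    rw [zero_add, Nat.mod_eq_of_lt (Finset.mem_range.1 hj)]
  | succ a ih =>
    obtain ⟨n, rfl⟩ : ∃ n, E = n + 1 := ⟨E - 1, by omega⟩
    rw [← ih, Finset.sum_range_succ, Finset.sum_range_succ' (n := n)]
    congr 1
    · exact Finset.sum_congr rfl fun j _ => by congr 2; ring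
    · rw [show a + 1 + n = a + 0 + (n + 1) by ring, Nat.add_mod_right]

theorem sum_penalty_le (E : ℕ) (hE : 0 < E) :
    ∑ k ∈ Finset.range E, penalty E k ≤ 6 * (E * E) := by
  obtain ⟨n, hn⟩ : ∃ n, E = n + 1 := ⟨E - 1, by omega⟩
  have h1 : ∑ k ∈ Finset.range E, E * E / (1 + k * k) ≤ 3 * (E * E) := by
    have h2 := sum_one_div_sq_le n
    rw [← hn] at h2
    have h3 : (∑ k ∈ Finset.range E, ((E * E / (1 + k * k) : ℕ) : ℝ)) ≤ 3 * (E * E) := by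
      calc _ ≤ ∑ k ∈ Finset.range E, (E * E : ℝ) * (1 / (1 + k * k)) := by
            refine Finset.sum_le_sum fun k _ => Nat.cast_div_le.trans (le_of_eq ?_)
            push_cast; ring
        _ ≤ E * E * (3 - 2 / (n + 1)) := by
            rw [← Finset.mul_sum]
            exact mul_le_mul_of_nonneg_left h2 (by positivity)
        _ ≤ 3 * (E * E) := by
            have : (0 : ℝ) ≤ E * E * (2 / (n + 1)) := by positivity
            linarith
    exact_mod_cast h3
  unfold penalty
  rw [Finset.sum_add_distrib, Finset.sum_range_reflect (fun k => E * E / (1 + k * k)) E]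
  omega

/-- Averaging. Linearity makes it harmless that all coordinates use the same shift, so E grids per
scale suffice instead of one for each vector of shifts. -/
theorem exists_shift {E d : ℕ} (hE : 0 < E) (a : ℕ → ℕ) :
    ∃ j < E, ∑ i ∈ Finset.range d, penalty E ((a i + j) % E) ≤ 6 * E * d := by
  by_contra! h
  have h1 : ∑ j ∈ Finset.range E, ∑ i ∈ Finset.range d, penalty E ((a i + j) % E) ≤
      d * (6 * (E * E)) := by
    rw [Finset.sum_comm]
    calc _ ≤ ∑ i ∈ Finset.range d, 6 * (E * E) := by
          refine Finset.sum_le_sum fun i _ => ?_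
          rw [sum_shift_mod hE (penalty E)]
          exact sum_penalty_le E hE
      _ = _ := by simp
  have h2 : ∑ j ∈ Finset.range E, 6 * E * d <
      ∑ j ∈ Finset.range E, ∑ i ∈ Finset.range d, penalty E ((a i + j) % E) :=
    Finset.sum_lt_sum_of_nonempty (Finset.nonempty_range_iff.2 hE.ne')
      fun j hj => h j (Finset.mem_range.1 hj)
  simp only [Finset.sum_const, Finset.card_range, smul_eq_mul] at h2
  have : E * (6 * E * d) = d * (6 * (E * E)) := by ring
  omega

/-- The number of cells near a point, for a shift of least penalty. -/
theorem length_frontier_le_exp {E t V g d : ℕ} {z : ℕ → ℕ} (hE : 0 < E)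
    (ht : (t : ℝ) * t ≤ 2 + 2 * d / E)
    (hz : ∑ i ∈ Finset.range d, penalty E (z i % E) ≤ 6 * E * d) {l : ℕ} (hl : l ≤ d) :
    ((frontier E t V g z l).length : ℝ) ≤ Real.exp (2 + 18 * d / E) := by
  refine (length_frontier_le hE hl).trans (Real.exp_le_exp.2 ?_)
  have hE1 : (1 : ℝ) ≤ E := by exact_mod_cast hE
  have h1 : (2 * (∑ i ∈ Finset.range d, penalty E (z i % E) : ℕ) / (E * E) : ℝ) ≤ 12 * d / E := by
    have : ((∑ i ∈ Finset.range d, penalty E (z i % E) : ℕ) : ℝ) ≤ 6 * E * d := by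
      exact_mod_cast hz
    rw [div_le_div_iff₀ (by positivity) (by positivity)]
    nlinarith
  have h2 : (d * (4 / (E * E)) : ℝ) ≤ 4 * d / E := by
    rw [mul_div_assoc', div_le_div_iff₀ (by positivity) (by positivity)]
    have : (0 : ℝ) ≤ d * E := by positivity
    nlinarith
  -- The three shares come from the budget t², the penalties and the tails.
  have h3 : (18 * d / E : ℝ) = 2 * d / E + 12 * d / E + 4 * d / E := by ring
  linarith

end OneMeans

namespace OneMeans

/-! ### The program

Integer variables: `0` code of the request, `1` the dimension `d`, `2` the side `Δ` of the grid,
`3` the square root `t` of the budget, `4` the largest scale `L`, `5` the base `V` of cell numbers,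
`6` scale, `7` its power of two, `8` shift, `9` coordinate, `10` cell number, `11` penalty,
`12` least penalty, `13` its shift, `14` and `15` head and tail of the queue, `16` the end of the
current level, `17` counter, `18` number and `19` offset of the cell in one coordinate,
`20` budget, `21` gap, `22`-`24` binary search.

Real variables: `0` the input and the weight, `1` cost of the query point, `2` and `3` first and
second moments, `4` cost of the center, `5` change of the weight. -/

open NExp (lit var inp arr)

/-- Rounded position of the current point in the current coordinate. -/
def posExp (E : ℕ) : NExp := 4 * lit E * lit E * var 3 * inp (var 9) / var 7

/-- Compute the number of the cell of the current point. -/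
def keyCmd (E : ℕ) : Cmd :=
  .set 10 (var 6 * lit E + var 8) ;;
  .forTo 9 (var 1) (.set 10 (var 10 * var 5 + ((posExp E + var 8) / lit E + var 3)))

/-- Address of the current cell and coordinate in the table. -/
def addrExp : NExp := 3 * (var 10 * var 1 + var 9)

/-- Add the change of weight to the table for the current cell and all coordinates. -/
def addCmd : Cmd :=
  .forTo 9 (var 1)
    (.setTab (addrExp + 1) (.tab (addrExp + 1) + .var 5) ;;
     .setTab (addrExp + 2) (.tab (addrExp + 2) + .var 5 * .cast (inp (var 9))) ;;
     .setTab (addrExp + 3) (.tab (addrExp + 3) + .var 5 * .cast (inp (var 9) * inp (var 9))))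

/-- Set the weight of the current point to the input. -/
def updateCmd (E : ℕ) : Cmd :=
  .set 6 0 ;; .set 7 1 ;; .set 8 0 ;; keyCmd E ;; .set 9 0 ;;
  .rset 5 (.var 0 - .tab (addrExp + 1)) ;;
  .forTo 6 (var 4 + 1)
    (.forTo 8 (lit E) (keyCmd E ;; addCmd) ;; .set 7 (var 7 * 2))

/-- Compute the parameters. -/
def initCmd (E : ℕ) : Cmd :=
  .set 1 (inp 0) ;; .set 2 (inp 1) ;; .set 3 1 ;;
  .loop (.nlt (var 3 * var 3 * lit E) (var 1)) (.set 3 (var 3 + 1)) ;;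
  .set 4 0 ;; .set 7 1 ;;
  .loop (.nlt (var 7) (4 * lit E * lit E * var 1 * var 2))
    (.set 7 (var 7 * 2) ;; .set 4 (var 4 + 1)) ;;
  .set 5 (4 * lit E * lit E * var 3 * var 2 + 2 * var 3 + 2)

/-- Number of the cell of the point with coordinates `y`, at scale `i` and with shift `j`. -/
def keyOf (E t V d i j : ℕ) (y : ℕ → ℕ) : ℕ :=
  horner V (i * E + j) (fun l => (pos E t i (y l) + j) / E + t) d

/-- Address in the table of the moment number `q` in coordinate `l` of cell number `k`. -/
def addr (d k l q : ℕ) : ℕ := 3 * (k * d + l) + q + 1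

/-- The parameters and the bounds on the integers that occur. -/
structure Params (E d Δ t L V b : ℕ) : Prop where
  E_pos : 4 ≤ E
  d_pos : 1 ≤ d
  Δ_pos : 1 ≤ Δ
  t_pos : 1 ≤ t
  d_le : d ≤ t * t * E
  t_le : t ≤ d
  le_L : 4 * E * E * d * Δ ≤ 2 ^ L
  V_eq : V = 4 * E * E * t * Δ + 2 * t + 2
  key_lt : (L + 1) * E * V ^ d < 2 ^ b
  num_lt : 20 * E * E * d * d * Δ < 2 ^ b
  L_lt : L + 1 < b

/-- The variables that hold the parameters. -/
structure Holds (d Δ t L V : ℕ) (s : Mem) : Prop where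
  n1 : s.n 1 = d
  n2 : s.n 2 = Δ
  n3 : s.n 3 = t
  n4 : s.n 4 = L
  n5 : s.n 5 = V

/-! ### Bounds on the integers that occur, and the computation of cell numbers -/

section
variable {E d Δ t L V b : ℕ} {s : Mem}

theorem Holds.frame {c : Cmd} {s' : Mem} (h : Holds d Δ t L V s) (hF : Frame c s s')
    (h1 : c.writes (.n 1) = false) (h2 : c.writes (.n 2) = false) (h3 : c.writes (.n 3) = false)
    (h4 : c.writes (.n 4) = false) (h5 : c.writes (.n 5) = false) : Holds d Δ t L V s' :=
  ⟨(hF.n _ h1).trans h.n1, (hF.n _ h2).trans h.n2, (hF.n _ h3).trans h.n3,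
    (hF.n _ h4).trans h.n4, (hF.n _ h5).trans h.n5⟩

namespace Params

theorem le_num (P : Params E d Δ t L V b) {x : ℕ} (hx : x ≤ 20 * E * E * d * d * Δ) :
    x < 2 ^ b := hx.trans_lt P.num_lt

theorem lit_lt (P : Params E d Δ t L V b) : E < 2 ^ b := by
  refine P.le_num ?_
  have h1 := P.d_pos
  have h2 := P.Δ_pos
  have h3 := P.E_pos
  calc E = 1 * E * 1 * 1 * 1 * 1 := by ring
    _ ≤ 20 * E * E * d * d * Δ := by gcongr <;> omega

theorem d_lt (P : Params E d Δ t L V b) : d < 2 ^ b := by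
  refine P.le_num ?_
  have h1 := P.d_pos
  have h2 := P.Δ_pos
  have h3 := P.E_pos
  calc d = 1 * 1 * 1 * 1 * d * 1 := by ring
    _ ≤ 20 * E * E * d * d * Δ := by gcongr <;> omega

theorem V_pos (P : Params E d Δ t L V b) : 0 < V := by rw [P.V_eq]; omega

theorem V_le_num (P : Params E d Δ t L V b) : 4 * V ≤ 20 * E * E * d * d * Δ := by
  have h1 := P.d_pos
  have h2 := P.Δ_pos
  have h3 := P.E_pos
  rw [P.V_eq]
  have e1 : 4 * E * E * t * Δ ≤ 4 * E * E * (d * d) * Δ := by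
    gcongr; exact P.t_le.trans (Nat.le_mul_of_pos_left _ h1)
  have e2 : 16 * (d * d) ≤ E * E * (d * d) * Δ := by
    calc 16 * (d * d) = 4 * 4 * (d * d) * 1 := by ring
      _ ≤ _ := by gcongr
  have e3 : t ≤ d * d := P.t_le.trans (Nat.le_mul_of_pos_left _ h1)
  have e4 : 1 ≤ d * d := Nat.mul_pos h1 h1
  have e5 : 20 * E * E * d * d * Δ = 20 * (E * E * (d * d) * Δ) := by ring
  have e6 : 4 * E * E * (d * d) * Δ = 4 * (E * E * (d * d) * Δ) := by ring
  omega

theorem pos_le (P : Params E d Δ t L V b) {i y : ℕ} (hy : y ≤ Δ) :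
    pos E t i y + 2 * t + 2 ≤ V := by
  have h1 : pos E t i y ≤ 4 * E * E * t * Δ :=
    (Nat.div_le_self _ _).trans (Nat.mul_le_mul_left _ hy)
  rw [P.V_eq]; omega

theorem cell_le (P : Params E d Δ t L V b) {i j y : ℕ} (hy : y ≤ Δ) (hj : j < E) :
    (pos E t i y + j) / E + 2 * t + 1 ≤ V := by
  have h1 := P.pos_le (i := i) hy
  have h2 : (pos E t i y + j) / E ≤ (pos E t i y + E) / E := Nat.div_le_div_right (by omega)
  have h3 : pos E t i y / E ≤ pos E t i y := Nat.div_le_self _ _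
  rw [Nat.add_div_right _ (by omega)] at h2
  omega

theorem lead_le {i j : ℕ} (hi : i ≤ L) (hj : j < E) : i * E + j + 1 ≤ (L + 1) * E := by
  have := Nat.mul_le_mul_right E hi
  rw [add_mul]; omega

theorem horner_lt (P : Params E d Δ t L V b) {i j l : ℕ} {f : ℕ → ℕ} (hi : i ≤ L) (hj : j < E)
    (hl : l ≤ d) (hf : ∀ k < l, f k < V) : horner V (i * E + j) f l < 2 ^ b := by
  refine lt_of_lt_of_le (OneMeans.horner_lt hf) (le_trans ?_ P.key_lt.le)
  exact Nat.mul_le_mul (lead_le hi hj) (Nat.pow_le_pow_right P.V_pos hl)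

end Params

theorem keyCmd_runs (P : Params E d Δ t L V b) (H : Holds d Δ t L V s) (hi : s.n 6 ≤ L)
    (hden : s.n 7 = 2 ^ s.n 6) (hj : s.n 8 < E) (hy : ∀ l < d, s.inp l ≤ Δ) :
    Runs b (keyCmd E) s (3 * d + 3)
      (fun s' => s'.n 10 = keyOf E t V d (s.n 6) (s.n 8) s.inp) := by
  have hf : ∀ k < d, (pos E t (s.n 6) (s.inp k) + s.n 8) / E + t < V := fun k hk => by
    have := P.cell_le (i := s.n 6) (hy k hk) hj
    have := P.t_pos
    omega
  refine Runs.seq_set ?_ (by omega) ?_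
  · exact P.horner_lt (l := 0) (f := fun _ => 0) hi hj (by omega) (by simp)
  refine (Runs.forTo (fun l s' => s'.n 10 = horner V (s.n 6 * E + s.n 8)
    (fun l => (pos E t (s.n 6) (s.inp l) + s.n 8) / E + t) l) d 1 P.d_lt rfl ?_ ?_ ?_
    (by omega)).mono le_rfl fun s' _ h => h.2
  · intro j s' hF _ _ _
    rw [NExp.eval_var, hF.n 1 rfl]
    exact H.n1
  · simp [horner]
  · intro l hl s' hF h9 hI
    have e3 := hF.n 3 rfl
    have e5 := hF.n 5 rfl
    have e6 := hF.n 6 rfl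
    have e7 := hF.n 7 rfl
    have e8 := hF.n 8 rfl
    have ein := hF.inp rfl
    simp only [Mem.setN_n, Mem.setN_inp] at e3 e5 e6 e7 e8 ein
    norm_num at e3 e5 e6 e7 e8
    have hev : NExp.eval s' (var 10 * var 5 + ((posExp E + var 8) / lit E + var 3)) =
        horner V (s.n 6 * E + s.n 8)
          (fun l => (pos E t (s.n 6) (s.inp l) + s.n 8) / E + t) (l + 1) := by
      simp [posExp, horner, pos, hI, h9, e3, e5, e7, e8, ein, H.n3, H.n5, hden]
    refine Runs.set ?_ le_rfl ?_
    · rw [hev]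
      exact P.horner_lt hi hj hl fun k hk => hf k (by omega)
    · rw [hev]; simp

end
end OneMeans

/-! ### Updates of the table and the initialization -/

namespace OneMeans
open NExp (lit var inp arr)

section
variable {E d Δ t L V b : ℕ} {s : Mem}

theorem addr_inj {k k' l l' q q' : ℕ} (hl : l < d) (hl' : l' < d) (hq : q < 3) (hq' : q' < 3) :
    addr d k l q = addr d k' l' q' ↔ k = k' ∧ l = l' ∧ q = q' := by
  unfold addr
  rw [add_left_inj, mul_comm 3, mul_comm 3, mul_add_inj hq hq', mul_add_inj hl hl', and_assoc]

theorem addCmd_runs (P : Params E d Δ t L V b) (H : Holds d Δ t L V s) :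
    Runs b addCmd s (5 * d + 2) (fun s' => ∀ K l q, l < d → q < 3 →
      s'.tab (addr d K l q) =
        s.tab (addr d K l q) + if K = s.n 10 then s.r 5 * (s.inp l : ℝ) ^ q else 0) := by
  refine (Runs.forTo (fun j s' => ∀ K l q, l < d → q < 3 →
      s'.tab (addr d K l q) = s.tab (addr d K l q) +
        if K = s.n 10 ∧ l < j then s.r 5 * (s.inp l : ℝ) ^ q else 0) d 3 P.d_lt rfl ?_ ?_ ?_
    (by omega)).mono le_rfl fun s' _ h => ?_
  · intro j s' hF _ _ _
    rw [NExp.eval_var, hF.n 1 rfl]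
    exact H.n1
  · simp
  · intro j hj s' hF h9 hI
    have e1 := hF.n 1 rfl
    have e10 := hF.n 10 rfl
    have e5 := hF.r 5 rfl
    have ein := hF.inp rfl
    have a0 : NExp.eval s' (addrExp + 1) = addr d (s.n 10) j 0 := by
      simp [addrExp, addr, e1, e10, h9, H.n1]
    have a1 : NExp.eval s' (addrExp + 2) = addr d (s.n 10) j 1 := by
      simp [addrExp, addr, e1, e10, h9, H.n1]
    have a2 : NExp.eval s' (addrExp + 3) = addr d (s.n 10) j 2 := by
      simp [addrExp, addr, e1, e10, h9, H.n1]
    have n01 : addr d (s.n 10) j 1 ≠ addr d (s.n 10) j 0 := by simp [addr]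
    have n02 : addr d (s.n 10) j 2 ≠ addr d (s.n 10) j 0 := by simp [addr]
    have n12 : addr d (s.n 10) j 2 ≠ addr d (s.n 10) j 1 := by simp [addr]
    refine Runs.seq_setTab (by omega) (Runs.seq_setTab (by omega) (Runs.setTab le_rfl ?_))
    intro K l q hl hq
    have hcase := addr_inj (k := K) (k' := s.n 10) (l := l) (l' := j) (q := q) (q' := 0)
      hl hj hq (by norm_num)
    have hcase1 := addr_inj (k := K) (k' := s.n 10) (l := l) (l' := j) (q := q) (q' := 1)
      hl hj hq (by norm_num)
    have hcase2 := addr_inj (k := K) (k' := s.n 10) (l := l) (l' := j) (q := q) (q' := 2)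
      hl hj hq (by norm_num)
    simp only [RExp.eval_add, RExp.eval_mul, RExp.eval_tab, RExp.eval_cast, RExp.eval_var,
      Mem.setN_tab, Mem.setTab_tab, Mem.setTab_r, Mem.setTab_inp, NExp.eval_setTab, a0, a1, a2]
    simp only [Function.update_apply, hcase, hcase1, hcase2, n01, n02, n12, if_false]
    have hI' := hI K l q hl hq
    by_cases hK : K = s.n 10
    · subst hK
      by_cases hlj : l = j
      · subst hlj
        rw [if_neg (by simp)] at hI'
        interval_cases q <;>
          simp_all [sq]
      · have : l < j + 1 ↔ l < j := by omega
        simp [hlj, hI', this]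
    · simp [hK, hI']
  · intro K l q hl hq
    rw [h.2 K l q hl hq]
    simp [hl]

end
end OneMeans

namespace OneMeans
open NExp (lit var inp arr)

section
variable {E d Δ t L V b : ℕ} {s : Mem}

theorem Params.one_lt (P : Params E d Δ t L V b) : 1 < 2 ^ b :=
  Nat.one_lt_two_pow (by have := P.L_lt; omega)

theorem Params.pow_lt (P : Params E d Δ t L V b) {i : ℕ} (hi : i ≤ L + 1) : 2 ^ i < 2 ^ b :=
  Nat.pow_lt_pow_right (by norm_num) (hi.trans_lt P.L_lt)

theorem Params.L_lt' (P : Params E d Δ t L V b) : L + 1 < 2 ^ b :=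
  P.L_lt.trans Nat.lt_two_pow_self

/-- The subtracted table entry is the old weight, read in the cell of scale 0 and shift 0. Adding
only the difference makes insertion, replacement and deletion one operation. -/
theorem updateCmd_runs (P : Params E d Δ t L V b) (H : Holds d Δ t L V s)
    (hy : ∀ l < d, s.inp l ≤ Δ) :
    Runs b (updateCmd E) s ((L + 1) * (E * (8 * d + 7) + 5) + 3 * d + 10)
      (fun s' => ∀ K l q, l < d → q < 3 → s'.tab (addr d K l q) = s.tab (addr d K l q) +
        ∑ i ∈ Finset.range (L + 1), ∑ j ∈ Finset.range E,
          if K = keyOf E t V d i j s.inp then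
            (s.r 0 - s.tab (addr d (keyOf E t V d 0 0 s.inp) 0 0)) * (s.inp l : ℝ) ^ q
          else 0) := by
  have hE := P.E_pos
  have a1 : (L + 1) * (E * (8 * d + 7) + 3 + 2) = (L + 1) * (E * (8 * d + 7) + 5) := rfl
  have a2 : E * (8 * d + 5 + 2) = E * (8 * d + 7) := rfl
  refine Runs.seq_set (by simp) (by omega) (Runs.seq_set (by simpa using P.one_lt) (by omega)
    (Runs.seq_set (by simp) (by omega) ?_))
  simp only [NExp.eval_ofNat]
  set s₀ := ((s.setN 6 0).setN 7 1).setN 8 0 with hs₀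
  have H₀ : Holds d Δ t L V s₀ := by
    constructor <;> simp [hs₀, H.n1, H.n2, H.n3, H.n4, H.n5]
  refine (keyCmd_runs P H₀ (by simp [hs₀]) (by simp [hs₀]) (by simp [hs₀]; omega)
    (by simpa [hs₀] using hy)).seq (by omega) fun s₁ hF₁ hkey => ?_
  have hkey' : s₁.n 10 = keyOf E t V d 0 0 s.inp := by simpa [hs₀] using hkey
  have H₁ : Holds d Δ t L V s₁ := H₀.frame hF₁ rfl rfl rfl rfl rfl
  refine Runs.seq_set (by simp) (by omega) (Runs.seq_rset (by omega) ?_)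
  set δ := s.r 0 - s.tab (addr d (keyOf E t V d 0 0 s.inp) 0 0) with hδ
  have hr0 : s₁.r 0 = s.r 0 := hF₁.r 0 rfl
  have htab : s₁.tab = s.tab := hF₁.tab rfl
  have hinp : s₁.inp = s.inp := hF₁.inp rfl
  have hδ' : RExp.eval (s₁.setN 9 (NExp.eval s₁ 0)) (.var 0 - .tab (addrExp + 1)) = δ := by
    simp [addrExp, hr0, htab, hkey', hδ, addr, H₁.n1]
  rw [hδ']
  set s₂ := (s₁.setN 9 (NExp.eval s₁ 0)).setR 5 δ with hs₂
  have H₂ : Holds d Δ t L V s₂ := by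
    constructor <;> simp [hs₂, H₁.n1, H₁.n2, H₁.n3, H₁.n4, H₁.n5]
  have hinp₂ : s₂.inp = s.inp := by simp [hs₂, hinp]
  have hr5 : s₂.r 5 = δ := by simp [hs₂]
  have htab₂ : s₂.tab = s.tab := by simp [hs₂, htab]
  have h7 : s₂.n 7 = 1 := by
    simp only [hs₂, Mem.setR_n, Mem.setN_n]
    rw [if_neg (by norm_num), hF₁.n 7 rfl]; simp [hs₀]
  refine (Runs.forTo (fun i s' => s'.n 7 = 2 ^ i ∧ ∀ K l q, l < d → q < 3 →
      s'.tab (addr d K l q) = s.tab (addr d K l q) +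
        ∑ i ∈ Finset.range i, ∑ j ∈ Finset.range E,
          if K = keyOf E t V d i j s.inp then δ * (s.inp l : ℝ) ^ q else 0)
    (L + 1) (E * (8 * d + 7) + 3) P.L_lt' rfl ?_ ?_ ?_ (by omega)).mono le_rfl fun s' _ h => h.2.2
  · intro j s' hF _ _ _
    rw [NExp.eval_add, NExp.eval_var, hF.n 4 rfl, H₂.n4]; rfl
  · simp [htab₂, h7]
  · rintro i hi s₃ hF₃ h6 ⟨h7, hI⟩
    have H₃ : Holds d Δ t L V s₃ := H₂.frame hF₃ rfl rfl rfl rfl rfl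
    have hinp₃ : s₃.inp = s.inp := (hF₃.inp rfl).trans hinp₂
    have hr5₃ : s₃.r 5 = δ := (hF₃.r 5 rfl).trans hr5
    refine (Runs.forTo (fun j s' => ∀ K l q, l < d → q < 3 →
      s'.tab (addr d K l q) = s₃.tab (addr d K l q) + ∑ j ∈ Finset.range j,
          if K = keyOf E t V d i j s.inp then δ * (s.inp l : ℝ) ^ q else 0)
      E (8 * d + 5) P.lit_lt rfl (fun _ _ _ _ _ _ => rfl) ?_ ?_ le_rfl).seq (by omega) ?_
    · simp
    · intro j hj s₄ hF₄ h8 hI₄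
      have H₄ : Holds d Δ t L V s₄ := H₃.frame hF₄ rfl rfl rfl rfl rfl
      have hinp₄ : s₄.inp = s.inp := (hF₄.inp rfl).trans hinp₃
      have h6₄ : s₄.n 6 = i := (hF₄.n 6 rfl).trans h6
      have h7₄ : s₄.n 7 = 2 ^ i := (hF₄.n 7 rfl).trans h7
      have hr5₄ : s₄.r 5 = δ := (hF₄.r 5 rfl).trans hr5₃
      refine (keyCmd_runs P H₄ (by omega) (by rw [h6₄, h7₄]) (by omega)
        (by rwa [hinp₄])).seq (by omega) fun s₅ hF₅ hkey₅ => ?_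
      rw [h6₄, h8, hinp₄] at hkey₅
      refine (addCmd_runs P (H₄.frame hF₅ rfl rfl rfl rfl rfl)).mono (by omega)
        fun s₆ hF₆ hadd K l q hl hq => ?_
      rw [Mem.setN_tab, hadd K l q hl hq, hF₅.tab rfl, hI₄ K l q hl hq, hkey₅, hF₅.r 5 rfl, hr5₄,
        hF₅.inp rfl, hinp₄, Finset.sum_range_succ, add_assoc]
    · rintro s₄ hF₄ ⟨-, hI₄⟩
      have h7₄ : s₄.n 7 = 2 ^ i := (hF₄.n 7 rfl).trans h7
      have hev : NExp.eval s₄ (var 7 * 2) = 2 ^ (i + 1) := by simp [h7₄, pow_succ]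
      refine Runs.set ?_ (by omega) ?_
      · rw [hev]; exact P.pow_lt (by omega)
      · rw [hev]
        refine ⟨by simp, fun K l q hl hq => ?_⟩
        simp only [Mem.setN_tab]
        rw [hI₄ K l q hl hq, hI K l q hl hq, Finset.sum_range_succ _ i, add_assoc]

/-- The square root of the budget. -/
theorem exists_budget {E d : ℕ} (hE : 0 < E) (hd : 1 ≤ d) : ∃ t, 1 ≤ t ∧ t ≤ d ∧ d ≤ t * t * E ∧
    (∀ u, 1 ≤ u → u < t → u * u * E < d) ∧ (t : ℝ) * t ≤ 2 + 2 * d / E := by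
  have hex : ∃ t, 1 ≤ t ∧ d ≤ t * t * E :=
    ⟨d, hd, (Nat.le_mul_of_pos_left d hd).trans (Nat.le_mul_of_pos_right _ hE)⟩
  classical
  obtain ⟨h1, h2⟩ := Nat.find_spec hex
  have hmin : ∀ u, 1 ≤ u → u < Nat.find hex → u * u * E < d := fun u hu hlt => by
    have := Nat.find_min hex hlt
    push Not at this
    exact this hu
  refine ⟨Nat.find hex, h1, Nat.find_min' hex ⟨hd, (Nat.le_mul_of_pos_left d hd).trans
    (Nat.le_mul_of_pos_right _ hE)⟩, h2, hmin, ?_⟩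
  obtain ⟨u, hu⟩ : ∃ u, Nat.find hex = u + 1 := ⟨Nat.find hex - 1, by omega⟩
  rw [hu] at hmin ⊢
  have hE' : (0 : ℝ) < E := by exact_mod_cast hE
  -- With t = u + 1 minimal, u²E < d or u = 0; afterwards (u + 1)² ≤ 2u² + 2.
  have h3 : (u : ℝ) * u ≤ d / E := by
    rw [le_div_iff₀ hE']
    rcases Nat.eq_zero_or_pos u with rfl | hpos
    · simp
    · exact_mod_cast (hmin u hpos (by omega)).le
  push_cast
  have h4 : (2 * d / E : ℝ) = 2 * (d / E) := by ring
  nlinarith [sq_nonneg ((u : ℝ) - 1)]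

/-- Minimality of `t` and `L` keeps the two search loops from stopping early; `d_le` and `le_L` stop
them in time. -/
theorem initCmd_runs (P : Params E d Δ t L V b) (ht : ∀ u, 1 ≤ u → u < t → u * u * E < d)
    (hL : ∀ k < L, 2 ^ k < 4 * E * E * d * Δ) (hd : s.inp 0 = d) (hΔ : s.inp 1 = Δ)
    (hΔb : Δ < 2 ^ b) (hVb : V < 2 ^ b) :
    Runs b (initCmd E) s (2 * d + 3 * L + 8) (Holds d Δ t L V) := by
  have ht1 := P.t_pos
  have htd := P.t_le
  refine Runs.seq_set (by simpa [hd] using P.d_lt) (by omega)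
    (Runs.seq_set (by simpa [hΔ] using hΔb) (by omega)
      (Runs.seq_set (by simpa using P.one_lt) (by omega) ?_))
  simp only [NExp.eval_ofNat, NExp.eval_inp, Mem.setN_inp, hd, hΔ]
  set s₀ := ((s.setN 1 d).setN 2 Δ).setN 3 1 with hs₀
  refine (Runs.loop (J := fun s' => 1 ≤ s'.n 3 ∧ s'.n 3 ≤ t) (fun s' => t - s'.n 3) (T := 1)
    (by simp [hs₀, ht1]) ?_ le_rfl).seq (by simp [hs₀]; omega) ?_
  · rintro s' hF ⟨h1, h2⟩ hq
    have e1 : s'.n 1 = d := by rw [hF.n 1 rfl]; simp [hs₀]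
    have hlt : s'.n 3 < t := by
      by_contra hcon
      have : s'.n 3 = t := by omega
      simp only [Cond.holds_nlt, NExp.eval_mul, NExp.eval_var, NExp.eval_lit, this, e1] at hq
      exact absurd P.d_le (by omega)
    have := P.d_lt
    refine Runs.set (by simp; omega) le_rfl ⟨⟨by simp, by simpa using hlt⟩, by simp; omega⟩
  rintro s₁ hF₁ ⟨⟨h1, h2⟩, hq⟩
  have e1 : s₁.n 1 = d := by rw [hF₁.n 1 rfl]; simp [hs₀]
  have e2 : s₁.n 2 = Δ := by rw [hF₁.n 2 rfl]; simp [hs₀]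
  have e3 : s₁.n 3 = t := by
    by_contra hne
    refine hq ?_
    simp only [Cond.holds_nlt, NExp.eval_mul, NExp.eval_var, NExp.eval_lit, e1]
    exact ht _ h1 (by omega)
  have hK : (t - s₀.n 3) * 2 + 1 ≤ 2 * d := by simp [hs₀]; omega
  refine Runs.seq_set (by simp) (by simp [hs₀]; omega)
    (Runs.seq_set (by simpa using P.one_lt) (by simp [hs₀]; omega) ?_)
  simp only [NExp.eval_ofNat]
  set s₂ := (s₁.setN 4 0).setN 7 1 with hs₂
  refine (Runs.loop (J := fun s' => s'.n 4 ≤ L ∧ s'.n 7 = 2 ^ s'.n 4) (fun s' => L - s'.n 4)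
    (T := 2) (by simp [hs₂]) ?_ le_rfl).seq (by simp [hs₂, hs₀]; omega) ?_
  · rintro s' hF ⟨h1, h2⟩ hq
    have e1' : s'.n 1 = d := by rw [hF.n 1 rfl]; simp [hs₂, e1]
    have e2' : s'.n 2 = Δ := by rw [hF.n 2 rfl]; simp [hs₂, e2]
    have hlt : s'.n 4 < L := by
      by_contra hcon
      have : s'.n 4 = L := by omega
      simp only [Cond.holds_nlt, NExp.eval_mul, NExp.eval_var, NExp.eval_lit, NExp.eval_ofNat,
        this, h2, e1', e2'] at hq
      exact absurd P.le_L (by omega)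
    have hev : NExp.eval s' (var 7 * 2) = 2 ^ (s'.n 4 + 1) := by simp [h2, pow_succ]
    refine Runs.seq_set (by rw [hev]; exact P.pow_lt (by omega)) (by omega) ?_
    rw [hev]
    have := P.L_lt'
    refine Runs.set (by simp; omega) (by omega) ⟨⟨by simp; omega, by simp⟩, by simp; omega⟩
  rintro s₃ hF₃ ⟨⟨h1, h2⟩, hq⟩
  have e1' : s₃.n 1 = d := by rw [hF₃.n 1 rfl]; simp [hs₂, e1]
  have e2' : s₃.n 2 = Δ := by rw [hF₃.n 2 rfl]; simp [hs₂, e2]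
  have e3' : s₃.n 3 = t := by rw [hF₃.n 3 rfl]; simp [hs₂, e3]
  have e4 : s₃.n 4 = L := by
    by_contra hne
    refine hq ?_
    simp only [Cond.holds_nlt, NExp.eval_mul, NExp.eval_var, NExp.eval_lit, NExp.eval_ofNat,
      h2, e1', e2']
    exact hL _ (by omega)
  have hev : NExp.eval s₃ (4 * lit E * lit E * var 3 * var 2 + 2 * var 3 + 2) = V := by
    simp [e2', e3', P.V_eq]
  refine Runs.set (by rw [hev]; exact hVb) (by simp [hs₂, hs₀]; omega) ?_
  rw [hev]
  constructor <;> simp [e1', e2', e3', e4]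

end
end OneMeans

namespace OneMeans
open NExp (lit var inp arr)

/-! ### Queries: scale and shift -/

/-- Find the scale of the radius. -/
def scaleCmd (E : ℕ) : Cmd :=
  .set 6 0 ;; .set 7 1 ;; .rset 5 (.cast (4 * lit E * lit E) * .var 0) ;;
  .forTo 8 (var 4) (.ite (.rlt (.var 5) (.cast (var 7))) .skip
    (.set 6 (var 6 + 1) ;; .set 7 (var 7 * 2)))

/-- Compute the penalty of the current shift. -/
def penaltyCmd (E : ℕ) : Cmd :=
  .set 11 0 ;;
  .forTo 9 (var 1) (.set 25 (posExp E + var 8) ;; .set 19 (var 25 - lit E * (var 25 / lit E)) ;;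
    .set 11 (var 11 + (lit E * lit E / (1 + var 19 * var 19) +
      lit E * lit E / (1 + (lit E - 1 - var 19) * (lit E - 1 - var 19)))))

/-- Find the shift of least penalty. -/
def shiftCmd (E : ℕ) : Cmd :=
  .set 12 (2 * lit E * lit E * var 1 + 1) ;; .set 13 0 ;;
  .forTo 8 (lit E) (penaltyCmd E ;;
    .ite (.nlt (var 11) (var 12)) (.set 12 (var 11) ;; .set 13 (var 8)) .skip) ;;
  .set 8 (var 13)

section
variable {E d Δ t L V b : ℕ} {s : Mem}

/-- The scale stops at the first radius above the query radius. The two exceptions are harmless: the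
top radius exceeds the diameter of the grid, and at scale 0 only the query point itself can be
found. -/
theorem scaleCmd_runs (P : Params E d Δ t L V b) (H : Holds d Δ t L V s) :
    Runs b (scaleCmd E) s (5 * L + 5) (fun s' => s'.n 6 ≤ L ∧ s'.n 7 = 2 ^ s'.n 6 ∧
      (s'.n 6 = L ∨ s.r 0 < radius E (s'.n 6)) ∧
      (s'.n 6 = 0 ∨ radius E (s'.n 6) ≤ 2 * s.r 0)) := by
  have hE : (0 : ℝ) < E := by exact_mod_cast (by have := P.E_pos; omega : 0 < E)
  refine Runs.seq_set (by simp) (by omega) (Runs.seq_set (by simpa using P.one_lt) (by omega)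
    (Runs.seq_rset (by omega) ?_))
  simp only [NExp.eval_ofNat]
  set s₀ := ((s.setN 6 0).setN 7 1).setR 5
    (RExp.eval ((s.setN 6 0).setN 7 1) (.cast (4 * lit E * lit E) * .var 0)) with hs₀
  have h5 : s₀.r 5 = 4 * E * E * s.r 0 := by simp [hs₀]
  refine (Runs.forTo (fun j s' => s'.n 6 ≤ j ∧ s'.n 7 = 2 ^ s'.n 6 ∧
      (s'.n 6 = j ∨ s.r 0 < radius E (s'.n 6)) ∧
      (s'.n 6 = 0 ∨ radius E (s'.n 6) ≤ 2 * s.r 0)) L 3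
      (by have := P.L_lt'; omega) rfl ?_ ?_ ?_ (by omega)).mono le_rfl fun s' _ h => h.2
  · intro j s' hF _ _ _
    rw [NExp.eval_var, hF.n 4 rfl]; simpa [hs₀] using H.n4
  · simp [hs₀]
  · rintro j hj s' hF - ⟨h1, h2, h3, h4⟩
    have hr5 : s'.r 5 = 4 * E * E * s.r 0 := (hF.r 5 rfl).trans h5
    refine Runs.ite (by omega) (fun hq => ?_) (fun hq => ?_)
    · refine Runs.skip ?_
      simp only [Cond.holds_rlt, RExp.eval_var, RExp.eval_cast, NExp.eval_var, hr5, h2] at hq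
      push_cast at hq
      have hlt : s.r 0 < radius E (s'.n 6) := by
        unfold radius; rw [lt_div_iff₀ (by positivity)]; linarith
      simp only [Mem.setN_n]
      norm_num
      exact ⟨by omega, h2, .inr hlt, h4⟩
    · simp only [Cond.holds_rlt, RExp.eval_var, RExp.eval_cast, NExp.eval_var, hr5, h2] at hq
      push_cast at hq
      have hge : radius E (s'.n 6 + 1) ≤ 2 * s.r 0 := by
        unfold radius; rw [div_le_iff₀ (by positivity), pow_succ]; linarith
      -- A scale that lags behind the counter has a radius above the query radius, and then the test
      -- would have succeeded.
      have h6 : s'.n 6 = j := by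
        rcases h3 with h | h
        · exact h
        · exfalso
          unfold radius at h
          rw [lt_div_iff₀ (by positivity)] at h
          linarith
      have hL := P.L_lt'
      have hev : NExp.eval (s'.setN 6 (NExp.eval s' (var 6 + 1))) (var 7 * 2) =
          2 ^ (s'.n 6 + 1) := by simp [h2, pow_succ]
      refine Runs.seq_set (by simp; omega) (by omega) (Runs.set ?_ (by omega) ?_)
      · rw [hev]; exact P.pow_lt (by omega)
      · rw [hev]
        simp only [Mem.setN_n]
        norm_num
        exact ⟨by omega, .inl h6, hge⟩

theorem penalty_le {k : ℕ} : penalty E k ≤ 2 * (E * E) := by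
  have h1 : E * E / (1 + k * k) ≤ E * E := Nat.div_le_self _ _
  have h2 : E * E / (1 + (E - 1 - k) * (E - 1 - k)) ≤ E * E := Nat.div_le_self _ _
  unfold penalty; omega

theorem Params.penalty_bound (P : Params E d Δ t L V b) :
    2 * (E * E) * d + 1 ≤ 20 * E * E * d * d * Δ := by
  have h1 := P.d_pos
  have h2 := P.Δ_pos
  have h3 := P.E_pos
  have h4 : 1 ≤ E * E * d := Nat.mul_pos (Nat.mul_pos (by omega) (by omega)) h1
  calc 2 * (E * E) * d + 1 ≤ 20 * (E * E * d) * 1 * 1 := by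
        rw [mul_assoc 2]; omega
    _ ≤ 20 * (E * E * d) * d * Δ := by gcongr
    _ = _ := by ring

theorem penaltyCmd_runs (P : Params E d Δ t L V b) (H : Holds d Δ t L V s) (hj : s.n 8 < E)
    (hden : s.n 7 = 2 ^ s.n 6) (hy : ∀ l < d, s.inp l ≤ Δ) :
    Runs b (penaltyCmd E) s (5 * d + 3) (fun s' => s'.n 11 =
      ∑ l ∈ Finset.range d, penalty E ((pos E t (s.n 6) (s.inp l) + s.n 8) % E)) := by
  have hE := P.E_pos
  have hV := P.V_le_num
  have hElt := P.lit_lt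
  refine Runs.seq_set (by simp) (by omega) ?_
  simp only [NExp.eval_ofNat]
  set φ := fun l => penalty E ((pos E t (s.n 6) (s.inp l) + s.n 8) % E) with hφ
  have hsum : ∀ l ≤ d, ∑ l ∈ Finset.range l, φ l < 2 ^ b := by
    intro l hl
    refine P.le_num (le_trans ?_ P.penalty_bound)
    calc ∑ l ∈ Finset.range l, φ l ≤ ∑ _l ∈ Finset.range l, 2 * (E * E) :=
          Finset.sum_le_sum fun _ _ => penalty_le
      _ = l * (2 * (E * E)) := by simp
      _ ≤ d * (2 * (E * E)) := Nat.mul_le_mul_right _ hl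
      _ ≤ _ := by rw [mul_comm]; omega
  refine (Runs.forTo (fun l s' => s'.n 11 = ∑ l ∈ Finset.range l, φ l) d 3 P.d_lt rfl ?_ ?_ ?_
    (by omega)).mono le_rfl fun s' _ h => h.2
  · intro j s' hF _ _ _
    rw [NExp.eval_var, hF.n 1 rfl]; simpa using H.n1
  · simp
  · intro l hl s' hF h9 hI
    have e3 := hF.n 3 rfl
    have e7 := hF.n 7 rfl
    have e8 := hF.n 8 rfl
    have ein := hF.inp rfl
    simp only [Mem.setN_n, Mem.setN_inp] at e3 e7 e8 ein
    norm_num at e3 e7 e8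
    set z := pos E t (s.n 6) (s.inp l) + s.n 8 with hz
    have hev : NExp.eval s' (posExp E + var 8) = z := by
      simp [posExp, hz, pos, h9, e3, e7, e8, ein, H.n3, hden]
    have hzlt : z < 2 ^ b := by
      refine P.le_num ?_
      have := P.pos_le (i := s.n 6) (hy l hl)
      have h4 : E ≤ V := by
        rw [P.V_eq]
        have : E * 1 ≤ E * (4 * E * t * Δ) := Nat.mul_le_mul_left _
          (Nat.mul_pos (Nat.mul_pos (by omega) P.t_pos) P.Δ_pos)
        have e : E * (4 * E * t * Δ) = 4 * E * E * t * Δ := by ring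
        omega
      omega
    -- The machine has no remainder instruction.
    have hmod : z - E * (z / E) = z % E := (Nat.mod_eq_sub z E).symm
    have hmodlt := Nat.mod_lt z (show 0 < E by omega)
    refine Runs.seq_set (by rwa [hev]) (by omega) ?_
    rw [hev]
    refine Runs.seq_set (by simp [hmod]; omega) (by omega) ?_
    have hev2 : NExp.eval (s'.setN 25 z) (var 25 - lit E * (var 25 / lit E)) = z % E := by
      simp [hmod]
    rw [hev2]
    have hev3 : NExp.eval ((s'.setN 25 z).setN 19 (z % E)) (var 11 +
        (lit E * lit E / (1 + var 19 * var 19) +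
      lit E * lit E / (1 + (lit E - 1 - var 19) * (lit E - 1 - var 19)))) =
        ∑ l ∈ Finset.range (l + 1), φ l := by
      rw [Finset.sum_range_succ]
      simp [hI, hφ, penalty, ← hz]
    refine Runs.set ?_ (by omega) ?_
    · rw [hev3]; exact hsum _ hl
    · rw [hev3]; simp

theorem shiftCmd_runs (P : Params E d Δ t L V b) (H : Holds d Δ t L V s)
    (hden : s.n 7 = 2 ^ s.n 6) (hy : ∀ l < d, s.inp l ≤ Δ) :
    Runs b (shiftCmd E) s (E * (5 * d + 8) + 5) (fun s' => s'.n 8 < E ∧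
      ∑ l ∈ Finset.range d, penalty E ((pos E t (s.n 6) (s.inp l) + s'.n 8) % E) ≤
        6 * E * d) := by
  have hE := P.E_pos
  have hpb := P.penalty_bound
  have hElt := P.lit_lt
  have a1 : E * (5 * d + 6 + 2) = E * (5 * d + 8) := rfl
  have hbig : NExp.eval s (2 * lit E * lit E * var 1 + 1) = 2 * (E * E) * d + 1 := by
    simp [H.n1, mul_assoc]
  refine Runs.seq_set (by rw [hbig]; exact P.le_num hpb) (by omega)
    (Runs.seq_set (by simp) (by omega) ?_)
  rw [hbig]
  simp only [NExp.eval_ofNat]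
  set φ := fun j => ∑ l ∈ Finset.range d,
    penalty E ((pos E t (s.n 6) (s.inp l) + j) % E) with hφ
  refine (Runs.forTo (fun j s' => s'.n 13 < E ∧ (∀ j' < j, s'.n 12 ≤ φ j') ∧ s'.n 12 < 2 ^ b ∧
    (s'.n 12 = 2 * (E * E) * d + 1 ∨ s'.n 12 = φ (s'.n 13))) E (5 * d + 6) hElt rfl
    (fun _ _ _ _ _ _ => rfl) ?_ ?_ le_rfl).seq (by omega) ?_
  · simp only [Mem.setN_n]
    norm_num
    exact ⟨by omega, P.le_num hpb⟩
  · rintro j hj s' hF h8 ⟨h1, h2, h3, h4⟩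
    have e1 := hF.n 1 rfl
    have e3 := hF.n 3 rfl
    have e6 := hF.n 6 rfl
    have e7 := hF.n 7 rfl
    have ein := hF.inp rfl
    have H' : Holds d Δ t L V s' := Holds.frame
      (⟨by simp [H.n1], by simp [H.n2], by simp [H.n3], by simp [H.n4], by simp [H.n5]⟩)
      hF rfl rfl rfl rfl rfl
    simp only [Mem.setN_n, Mem.setN_inp] at e1 e3 e6 e7 ein
    norm_num at e1 e3 e6 e7
    refine (penaltyCmd_runs P H' (by omega) (by rw [e7, e6, hden]) (by rwa [ein])).seq
      (by omega) fun s₁ hF₁ hp => ?_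
    rw [e6, h8, ein] at hp
    change s₁.n 11 = φ j at hp
    have f8 : s₁.n 8 = j := (hF₁.n 8 rfl).trans h8
    have f12 : s₁.n 12 = s'.n 12 := hF₁.n 12 rfl
    have f13 : s₁.n 13 = s'.n 13 := hF₁.n 13 rfl
    refine Runs.ite (by omega) (fun hq => ?_) (fun hq => ?_)
    · simp only [Cond.holds_nlt, NExp.eval_var, hp, f12] at hq
      refine Runs.seq_set (by simp [hp]; omega) (by omega) (Runs.set (by simp [f8]; omega)
        (by omega) ?_)
      simp only [Mem.setN_n, NExp.eval_var, hp]
      norm_num [f8]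
      refine ⟨hj, fun j' hj' => ?_, by omega⟩
      rcases lt_or_eq_of_le hj' with h | rfl
      · exact (hq.le).trans (h2 _ h)
      · exact le_rfl
    · simp only [Cond.holds_nlt, NExp.eval_var, hp, f12, not_lt] at hq
      refine Runs.skip ?_
      simp only [Mem.setN_n]
      norm_num [f12, f13]
      refine ⟨h1, fun j' hj' => ?_, h3, h4⟩
      rcases lt_or_eq_of_le hj' with h | rfl
      exacts [h2 _ h, hq]
  · rintro s₁ hF₁ ⟨-, h1, h2, h3, h4⟩
    refine Runs.set (by simp; omega) (by omega) ?_
    obtain ⟨j₀, hj₀, hle⟩ := exists_shift (E := E) (d := d) (by omega)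
      (fun l => pos E t (s.n 6) (s.inp l))
    have h5 := (h2 j₀ hj₀).trans hle
    -- The initial value 2E²d + 1 of the minimum lies above what the best shift attains, so the
    -- final minimum belongs to an actual shift.
    have h6 : 6 * E * d ≤ 2 * (E * E) * d := by
      refine Nat.mul_le_mul_right _ ?_
      have := Nat.mul_le_mul_right E hE
      omega
    have h7 : s₁.n 12 = φ (s₁.n 13) := by
      rcases h4 with h | h
      · omega
      · exact h
    simp only [Mem.setN_n, NExp.eval_var]
    norm_num
    rw [h7] at h5
    exact ⟨h1, h5⟩

end
end OneMeans

namespace OneMeans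
open NExp (lit var inp arr)

/-! ### Queries: enumeration of cells -/

/-- Process the entry at the head of the queue. -/
def entryCmd (E : ℕ) : Cmd :=
  .set 10 (arr (2 * var 14) * var 5 + var 18) ;; .set 20 (arr (2 * var 14 + 1)) ;;
  .forTo 17 (2 * var 3 + 1)
    (.set 21 (((var 3 - var 17) * lit E + var 19 - lit E) +
        ((var 17 - var 3) * lit E - (var 19 + 1))) ;;
     .ite (.nlt (var 21 * var 21) (var 20))
      (.setArr (2 * var 15) (var 10 + var 17) ;;
       .setArr (2 * var 15 + 1) (var 20 - var 21 * var 21) ;; .set 15 (var 15 + 1))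
      .skip) ;;
  .set 14 (var 14 + 1)

/-- Process all entries of one level. -/
def levelCmd (E : ℕ) : Cmd :=
  .set 25 (posExp E + var 8) ;; .set 18 (var 25 / lit E) ;; .set 19 (var 25 - lit E * var 18) ;;
  .set 16 (var 15) ;; .loop (.nlt (var 14) (var 16)) (entryCmd E)

/-- Enumerate the cells near the query point. -/
def queueCmd (E : ℕ) : Cmd :=
  .setArr 0 (var 6 * lit E + var 8) ;; .setArr 1 (var 3 * var 3) ;; .set 14 0 ;; .set 15 1 ;;
  .forTo 9 (var 1) (levelCmd E)

/-- The queue, from its very first entry on, is `Q`. -/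
structure Queue (s : Mem) (Q : List (ℕ × ℕ)) : Prop where
  entry : ∀ i p, Q[i]? = some p → s.arr (2 * i) = p.1 ∧ s.arr (2 * i + 1) = p.2
  tail : s.n 15 = Q.length

theorem Queue.of_eq {s s' : Mem} {Q : List (ℕ × ℕ)} (h : Queue s Q) (ha : s'.arr = s.arr)
    (hn : s'.n 15 = s.n 15) : Queue s' Q :=
  ⟨fun i p hp => by rw [ha]; exact h.entry i p hp, hn.trans h.tail⟩

theorem Queue.push {s : Mem} {Q : List (ℕ × ℕ)} (h : Queue s Q) (p : ℕ × ℕ) :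
    Queue (((s.setArr (2 * Q.length) p.1).setArr (2 * Q.length + 1) p.2).setN 15 (Q.length + 1))
      (Q ++ [p]) := by
  refine ⟨fun i q hq => ?_, by simp⟩
  have h1 : i < Q.length + 1 := by
    by_contra hcon
    rw [List.getElem?_eq_none (by simpa using hcon)] at hq
    cases hq
  rcases lt_or_eq_of_le (Nat.le_of_lt_succ h1) with hlt | rfl
  · rw [List.getElem?_append_left hlt] at hq
    have e1 : 2 * i ≠ 2 * Q.length := by omega
    have e2 : 2 * i ≠ 2 * Q.length + 1 := by omega
    have e3 : 2 * i + 1 ≠ 2 * Q.length := by omega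
    have e4 : 2 * i + 1 ≠ 2 * Q.length + 1 := by omega
    simpa only [Mem.setN_arr, Mem.setArr_arr, Function.update_of_ne e1, Function.update_of_ne e2,
      Function.update_of_ne e3, Function.update_of_ne e4] using h.entry i q hq
  · have : q = p := by simpa [eq_comm] using hq
    subst this
    simp

section
variable {E d Δ t L V b : ℕ} {s : Mem}

theorem Params.t_mul_E (P : Params E d Δ t L V b) : 2 * (t * E) + E + t * t < 2 ^ b := by
  refine P.le_num ?_
  have h1 := P.d_pos
  have h2 := P.Δ_pos
  have h3 := P.E_pos
  have h4 := P.t_le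
  have e1 : t * E ≤ E * E * d * d * Δ := by
    calc t * E = 1 * E * t * 1 * 1 := by ring
      _ ≤ _ := by gcongr; omega
  have e2 : E ≤ E * E * d * d * Δ := by
    calc E = 1 * E * 1 * 1 * 1 := by ring
      _ ≤ _ := by gcongr; omega
  have e3 : t * t ≤ E * E * d * d * Δ := by
    calc t * t = 1 * 1 * t * t * 1 := by ring
      _ ≤ _ := by gcongr <;> omega
  have e4 : 20 * E * E * d * d * Δ = 20 * (E * E * d * d * Δ) := by ring
  omega

theorem entryCmd_runs (P : Params E d Δ t L V b) (H : Holds d Δ t L V s) {Q : List (ℕ × ℕ)}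
    {p : ℕ × ℕ} {z : ℕ} (h18 : s.n 18 = z / E) (h19 : s.n 19 = z % E) (hQ : Queue s Q)
    (hp : Q[s.n 14]? = some p) (hlen : Q.length + (expand E t V z p).length < 2 ^ b)
    (hk : (p.1 + 1) * V ≤ 2 ^ b) (hp2 : p.2 ≤ t * t) (hzV : z / E + 2 * t < V)
    (hlt : s.n 14 + 1 < 2 ^ b) :
    Runs b (entryCmd E) s (14 * t + 12)
      (fun s' => Queue s' (Q ++ expand E t V z p) ∧ s'.n 14 = s.n 14 + 1) := by
  have hE := P.E_pos
  have htE := P.t_mul_E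
  rw [add_mul, one_mul] at hk
  obtain ⟨he1, he2⟩ := hQ.entry _ _ hp
  have hev : NExp.eval s (arr (2 * var 14) * var 5 + var 18) = p.1 * V + z / E := by
    simp [he1, H.n5, h18]
  refine Runs.seq_set (by rw [hev]; omega) (by omega) ?_
  rw [hev]
  refine Runs.seq_set (by simp [he2]; omega) (by omega) ?_
  have hev2 : NExp.eval (s.setN 10 (p.1 * V + z / E)) (arr (2 * var 14 + 1)) = p.2 := by
    simp [he2]
  rw [hev2]
  set s₀ := (s.setN 10 (p.1 * V + z / E)).setN 20 p.2 with hs₀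
  set G := gapAt E t (z % E) with hG
  set f : ℕ → Option (ℕ × ℕ) := fun u => if G u * G u < p.2 then
      some (p.1 * V + z / E + u, p.2 - G u * G u) else none with hf
  have hex : expand E t V z p = (List.range (2 * t + 1)).filterMap f := rfl
  have hmod := Nat.mod_lt z (show 0 < E by omega)
  refine (Runs.forTo (fun u s' => Queue s' (Q ++ (List.range u).filterMap f)) (2 * t + 1) 5
    (by have := P.t_le; have := P.V_le_num; have := P.le_num this; omega) rfl ?_ ?_ ?_
    le_rfl).seq (by omega) ?_
  · intro j s' hF _ _ _
    have : s'.n 3 = t := by rw [hF.n 3 rfl]; simp [hs₀, H.n3]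
    simp [this]
  · simpa using hQ.of_eq (s' := s₀.setN 17 0) rfl (by simp [hs₀])
  · intro u hu s' hF h17 hI
    have e3 : s'.n 3 = t := by rw [hF.n 3 rfl]; simp [hs₀, H.n3]
    have e19 : s'.n 19 = z % E := by rw [hF.n 19 rfl]; simp [hs₀, h19]
    have e10 : s'.n 10 = p.1 * V + z / E := by rw [hF.n 10 rfl]; simp [hs₀]
    have e20 : s'.n 20 = p.2 := by rw [hF.n 20 rfl]; simp [hs₀]
    have hgev : NExp.eval s' (((var 3 - var 17) * lit E + var 19 - lit E) +
        ((var 17 - var 3) * lit E - (var 19 + 1))) = G u := by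
      simp [hG, gapAt, e3, e19, h17]
    have hGlt : G u < 2 ^ b := by
      have h1 : (t - u) * E ≤ t * E := Nat.mul_le_mul_right _ (by omega)
      have h2 : (u - t) * E ≤ t * E := Nat.mul_le_mul_right _ (by omega)
      simp only [hG, gapAt]; omega
    have hQlen : (Q ++ (List.range (u + 1)).filterMap f).length < 2 ^ b := by
      rw [hex] at hlen
      have hsub : ((List.range (u + 1)).filterMap f).Sublist ((List.range (2 * t + 1)).filterMap f) :=
        (List.range_sublist.2 hu).filterMap f
      have := hsub.length_le
      rw [List.length_append]; omega
    refine Runs.seq_set (by rwa [hgev]) (by omega) ?_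
    rw [hgev]
    have htail := hI.tail
    rw [List.range_succ, List.filterMap_append, ← List.append_assoc] at hQlen ⊢
    set Q' := Q ++ (List.range u).filterMap f with hQ'
    refine Runs.ite (by omega) (fun hq => ?_) (fun hq => ?_)
    · have hlt' : G u * G u < p.2 := by simpa [e20] using hq
      have hfu : List.filterMap f [u] = [(p.1 * V + z / E + u, p.2 - G u * G u)] := by
        simp [hf, hlt']
      rw [hfu] at hQlen ⊢
      rw [List.length_append, List.length_singleton] at hQlen
      refine Runs.seq_setArr (by simp [e10, h17]; omega) (by omega)
        (Runs.seq_setArr (by simp [e20]; omega) (by omega)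
          (Runs.set (by simp [htail]; omega) (by omega) ?_))
      refine (hI.push (p.1 * V + z / E + u, p.2 - G u * G u)).of_eq ?_ ?_
      · simp [htail, e10, h17, e20]
      · simp [htail]
    · have hlt' : ¬ G u * G u < p.2 := by simpa [e20] using hq
      have hfu : List.filterMap f [u] = [] := by simp [hf, hlt']
      rw [hfu, List.append_nil]
      exact Runs.skip (hI.of_eq rfl (by simp))
  · rintro s₁ hF₁ ⟨-, hI⟩
    have e14 : s₁.n 14 = s.n 14 := by rw [hF₁.n 14 rfl]; simp [hs₀]
    refine Runs.set (by simp [e14, hlt]) (by omega) ⟨?_, by simp [e14]⟩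
    rw [hex]
    exact hI.of_eq rfl (by simp)

/-- `A` has been processed and `B` is the level at hand. Its children are appended behind it, and
variable 16 remembers where `B` ended. -/
theorem levelCmd_runs (P : Params E d Δ t L V b) (H : Holds d Δ t L V s)
    {A B : List (ℕ × ℕ)} {z i : ℕ} (hi : s.n 7 = 2 ^ i)
    (hz : pos E t i (s.inp (s.n 9)) + s.n 8 = z)
    (hQ : Queue s (A ++ B)) (h14 : s.n 14 = A.length)
    (hlen : A.length + B.length + (B.flatMap (expand E t V z)).length < 2 ^ b)
    (hk : ∀ p ∈ B, (p.1 + 1) * V ≤ 2 ^ b) (hp2 : ∀ p ∈ B, p.2 ≤ t * t)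
    (hzV : z / E + 2 * t < V) (hzlt : z < 2 ^ b) :
    Runs b (levelCmd E) s (B.length * (14 * t + 13) + 5)
      (fun s' => Queue s' ((A ++ B) ++ B.flatMap (expand E t V z)) ∧
        s'.n 14 = (A ++ B).length) := by
  have hE := P.E_pos
  have htail := hQ.tail
  have hmod : z - E * (z / E) = z % E := (Nat.mod_eq_sub z E).symm
  have hz' : NExp.eval s (posExp E + var 8) = z := by
    simp [posExp, ← hz, pos, hi, H.n3]
  refine Runs.seq_set (by rwa [hz']) (by omega) ?_
  rw [hz']
  refine Runs.seq_set ?_ (by omega) (Runs.seq_set ?_ (by omega) (Runs.seq_set ?_ (by omega) ?_))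
  · simpa using (Nat.div_le_self z E).trans_lt hzlt
  · simp; omega
  · simp only [NExp.eval_var, Mem.setN_n]
    norm_num [htail]; omega
  set s₀ := (((s.setN 25 z).setN 18 (NExp.eval (s.setN 25 z) (var 25 / lit E))).setN 19
    (NExp.eval ((s.setN 25 z).setN 18 (NExp.eval (s.setN 25 z) (var 25 / lit E)))
      (var 25 - lit E * var 18))).setN 16 (NExp.eval (((s.setN 25 z).setN 18
        (NExp.eval (s.setN 25 z) (var 25 / lit E))).setN 19
    (NExp.eval ((s.setN 25 z).setN 18 (NExp.eval (s.setN 25 z) (var 25 / lit E)))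
      (var 25 - lit E * var 18))) (var 15)) with hs₀
  have e18 : s₀.n 18 = z / E := by simp [hs₀]
  have e19 : s₀.n 19 = z % E := by simp [hs₀, hmod]
  have e16 : s₀.n 16 = (A ++ B).length := by simp [hs₀, htail]
  have e14 : s₀.n 14 = A.length := by simp [hs₀, h14]
  have H₀ : Holds d Δ t L V s₀ := by
    constructor <;> simp [hs₀, H.n1, H.n2, H.n3, H.n4, H.n5]
  have hQ₀ : Queue s₀ (A ++ B) := hQ.of_eq rfl (by simp [hs₀])
  clear_value s₀
  have hAB : (A ++ B).length = A.length + B.length := List.length_append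
  refine (Runs.loop (J := fun s' => ∃ h, s'.n 14 = A.length + h ∧ h ≤ B.length ∧
      Queue s' ((A ++ B) ++ (B.take h).flatMap (expand E t V z)))
    (fun s' => A.length + B.length - s'.n 14) (T := 14 * t + 12)
    ⟨0, by simpa using e14, by omega, by simpa using hQ₀⟩ ?_ ?_).mono (le_refl _) ?_
  · rintro s' hF ⟨h, h1, h2, h3⟩ hq
    have f16 : s'.n 16 = A.length + B.length := by rw [hF.n 16 rfl, e16, hAB]
    simp only [Cond.holds_nlt, NExp.eval_var, f16, h1] at hq
    have hhB : h < B.length := by omega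
    have hget : ((A ++ B) ++ (B.take h).flatMap (expand E t V z))[s'.n 14]? = some B[h] := by
      rw [h1, List.getElem?_append_left (by rw [hAB]; omega),
        List.getElem?_append_right (by omega)]
      simp [hhB]
    have hmem : B[h] ∈ B := List.getElem_mem hhB
    have htake : (B.take (h + 1)).flatMap (expand E t V z) =
        (B.take h).flatMap (expand E t V z) ++ expand E t V z B[h] := by
      rw [← List.take_append_getElem hhB, List.flatMap_append]; simp
    have hle : ((B.take (h + 1)).flatMap (expand E t V z)).length ≤
        (B.flatMap (expand E t V z)).length := by
      conv_rhs => rw [← List.take_append_drop (h + 1) B, List.flatMap_append, List.length_append]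
      omega
    rw [htake, List.length_append] at hle
    refine (entryCmd_runs P (H₀.frame hF rfl rfl rfl rfl rfl) ((hF.n 18 rfl).trans e18)
      ((hF.n 19 rfl).trans e19) h3 hget ?_ (hk _ hmem) (hp2 _ hmem) hzV (by omega)).mono le_rfl ?_
    · rw [List.length_append, hAB]; omega
    · rintro s'' - ⟨hQ', h14'⟩
      refine ⟨⟨h + 1, by omega, by omega, ?_⟩, by omega⟩
      rw [htake, ← List.append_assoc]
      exact hQ'
  · rw [e14, Nat.add_sub_cancel_left]
    have : B.length * (14 * t + 12 + 1) = B.length * (14 * t + 13) := rfl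
    omega
  · rintro s' hF ⟨⟨h, h1, h2, h3⟩, hq⟩
    have f16 : s'.n 16 = A.length + B.length := by rw [hF.n 16 rfl, e16, hAB]
    simp only [Cond.holds_nlt, NExp.eval_var, f16, h1] at hq
    have : h = B.length := by omega
    rw [this, List.take_length] at h3
    exact ⟨h3, by omega⟩

/-- A breadth-first search with one level per coordinate. Old levels stay in the queue, hence the
assumption on `(d + 1) * N`; at the end the head points to the last level, the complete cells. -/
theorem queueCmd_runs (P : Params E d Δ t L V b) (H : Holds d Δ t L V s) {i j N : ℕ}
    (h6 : s.n 6 = i) (h7 : s.n 7 = 2 ^ i) (h8 : s.n 8 = j) (hi : i ≤ L) (hj : j < E)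
    (hy : ∀ l < d, s.inp l ≤ Δ)
    (hN : ∀ l ≤ d, (frontier E t V (i * E + j) (fun l => pos E t i (s.inp l) + j) l).length ≤ N)
    (hNb : (d + 1) * N < 2 ^ b) :
    Runs b (queueCmd E) s (d * (N * (14 * t + 13) + 7) + 6) (fun s' => ∃ A,
      Queue s' (A ++ frontier E t V (i * E + j) (fun l => pos E t i (s.inp l) + j) d) ∧
      s'.n 14 = A.length ∧ A.length ≤ d * N) := by
  have hE := P.E_pos
  have htE := P.t_mul_E
  set z := fun l => pos E t i (s.inp l) + j with hz
  set F := frontier E t V (i * E + j) z with hF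
  have a1 : d * (N * (14 * t + 13) + 5 + 2) = d * (N * (14 * t + 13) + 7) := rfl
  have hg : NExp.eval s (var 6 * lit E + var 8) = i * E + j := by simp [h6, h8]
  have hgb : i * E + j < 2 ^ b := P.horner_lt (l := 0) (f := fun _ => 0) hi hj (by omega) (by simp)
  have hzV : ∀ l < d, z l / E + 2 * t < V := fun l hl => P.cell_le (hy l hl) hj
  refine Runs.seq_setArr (by rwa [hg]) (by omega) (Runs.seq_setArr (by simp [H.n3]; omega)
    (by omega) (Runs.seq_set (by simp) (by omega) (Runs.seq_set (by simpa using P.one_lt)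
      (by omega) ?_)))
  rw [hg]
  simp only [NExp.eval_ofNat, NExp.eval_mul, NExp.eval_var, Mem.setArr_n, H.n3]
  set s₀ := (((s.setArr 0 (i * E + j)).setArr 1 (t * t)).setN 14 0).setN 15 1 with hs₀
  have hQ₀ : Queue s₀ (F 0) := by
    refine ⟨fun k p hp => ?_, by simp [hs₀, hF, frontier]⟩
    rcases k with _ | k
    · have : p = (i * E + j, t * t) := by simpa [hF, frontier, eq_comm] using hp
      subst this
      simp [hs₀]
    · simp [hF, frontier] at hp
  refine (Runs.forTo (fun l s' => ∃ A, Queue s' (A ++ F l) ∧ s'.n 14 = A.length ∧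
      A.length ≤ l * N) d (N * (14 * t + 13) + 5) P.d_lt rfl ?_ ?_ ?_ (by omega)).mono le_rfl
    fun s' _ h => h.2
  · intro j s' hF _ _ _
    rw [NExp.eval_var, hF.n 1 rfl]; simpa [hs₀] using H.n1
  · exact ⟨[], by rw [List.nil_append]; exact hQ₀.of_eq rfl (by simp), by simp [hs₀], by simp⟩
  · rintro l hl s' hFr h9 ⟨A, hQ, h14, hA⟩
    have H' : Holds d Δ t L V s' := Holds.frame
      (⟨by simp [hs₀, H.n1], by simp [hs₀, H.n2], by simp [hs₀, H.n3], by simp [hs₀, H.n4],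
        by simp [hs₀, H.n5]⟩ : Holds d Δ t L V s₀) hFr rfl rfl rfl rfl rfl
    have f7 : s'.n 7 = 2 ^ i := by rw [hFr.n 7 rfl]; simp [hs₀, h7]
    have f8 : s'.n 8 = j := by rw [hFr.n 8 rfl]; simp [hs₀, h8]
    have fin : s'.inp = s.inp := by rw [hFr.inp rfl]; simp [hs₀]
    have hNl := hN l hl.le
    have hzl : z l < 2 ^ b := by
      have h1 := P.pos_le (i := i) (hy l hl)
      have h2 := P.V_le_num
      have h3 := P.le_num h2
      have h4 : E ≤ V := by
        rw [P.V_eq]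
        have : E * 1 ≤ E * (4 * E * t * Δ) := Nat.mul_le_mul_left _
          (Nat.mul_pos (Nat.mul_pos (by omega) P.t_pos) P.Δ_pos)
        have e : E * (4 * E * t * Δ) = 4 * E * E * t * Δ := by ring
        omega
      simp only [hz]; omega
    have hFs : (F l).flatMap (expand E t V (z l)) = F (l + 1) := rfl
    have hNl' := hN (l + 1) hl
    have hbound : (l + 1) * N + N ≤ (d + 1) * N := by
      have := Nat.mul_le_mul_right N (show l + 2 ≤ d + 1 by omega)
      linarith
    have hb2 : (l + 1) * N = l * N + N := by ring
    refine (levelCmd_runs P H' f7 (z := z l) (by simp [f8, fin, h9, hz]) hQ h14 ?_ ?_ ?_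
      (hzV l hl) hzl).mono ?_ ?_
    · rw [hFs]
      change (F l).length ≤ N at hNl
      change (F (l + 1)).length ≤ N at hNl'
      omega
    · intro p hp
      have h1 := frontier_lt (fun k hk => hzV k (by omega)) P.V_pos hp
      calc (p.1 + 1) * V ≤ (i * E + j + 1) * V ^ l * V := Nat.mul_le_mul_right _ h1
        _ = (i * E + j + 1) * V ^ (l + 1) := by rw [pow_succ, mul_assoc]
        _ ≤ (L + 1) * E * V ^ d := Nat.mul_le_mul (Params.lead_le hi hj)
            (Nat.pow_le_pow_right P.V_pos hl)
        _ ≤ 2 ^ b := P.key_lt.le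
    · exact fun p hp => (frontier_budget P.t_pos hp).2
    · exact Nat.add_le_add_right (Nat.mul_le_mul_right _ hNl) _
    · rintro s'' - ⟨hQ', h14'⟩
      refine ⟨A ++ F l, ?_, by simpa using h14', ?_⟩
      · rw [hFs] at hQ'
        exact hQ'.of_eq rfl (by simp)
      · rw [List.length_append]
        change (F l).length ≤ N at hNl
        omega

end
end OneMeans

namespace OneMeans
open NExp (lit var inp arr)

/-! ### Queries: center and costs -/

/-- Sum up the table over the cells in the queue, in the current coordinate. -/
def sumCmd : Cmd :=
  .rset 0 (.cast 0) ;; .rset 2 (.cast 0) ;; .rset 3 (.cast 0) ;; .set 17 (var 14) ;;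
  .loop (.nlt (var 17) (var 15))
    (.set 10 (arr (2 * var 17)) ;; .rset 0 (.var 0 + .tab (addrExp + 1)) ;;
     .rset 2 (.var 2 + .tab (addrExp + 2)) ;; .rset 3 (.var 3 + .tab (addrExp + 3)) ;;
     .set 17 (var 17 + 1))

/-- Binary search for the grid coordinate next to the mean. -/
def searchCmd : Cmd :=
  .set 22 1 ;; .set 23 (var 2) ;;
  .loop (.nlt (var 22) (var 23))
    (.set 24 ((var 22 + var 23) / 2) ;;
     .ite (.rlt (.cast (2 * var 24 + 1) * .var 0) (.cast 2 * .var 2))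
      (.set 22 (var 24 + 1)) (.set 23 (var 24)))

/-- Compute the costs and the center. -/
def finishCmd : Cmd :=
  .rset 1 (.cast 0) ;; .rset 4 (.cast 0) ;;
  .forTo 9 (var 1)
    (sumCmd ;; searchCmd ;;
     .rset 1 (.var 1 + (.var 3 - .cast (2 * inp (var 9)) * .var 2 +
      .cast (inp (var 9) * inp (var 9)) * .var 0)) ;;
     .rset 4 (.var 4 + (.var 3 - .cast (2 * var 22) * .var 2 +
      .cast (var 22 * var 22) * .var 0)) ;;
     .setInp (var 9) (var 22)) ;;
  .setTab 0 (.var 4)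

/-- `c` is a grid coordinate next to the mean `S / W`. -/
structure NextToMean (Δ : ℕ) (W S : ℝ) (c : ℕ) : Prop where
  one_le : 1 ≤ c
  le : c ≤ Δ
  left : c = 1 ∨ (2 * c - 1) * W < 2 * S
  right : c = Δ ∨ 2 * S ≤ (2 * c + 1) * W

/-- The sum of the table over a list of cells. -/
noncomputable def moment (d : ℕ) (tab : ℕ → ℝ) (B : List (ℕ × ℕ)) (l q : ℕ) : ℝ :=
  (B.map fun p => tab (addr d p.1 l q)).sum

/-- The bit length of the interval serves as the variant of the binary search. -/
theorem size_lt_of_le_half {m n : ℕ} (hn : 0 < n) (h : m ≤ n / 2) : m.size < n.size := by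
  have h1 : n < 2 ^ n.size := Nat.lt_size_self n
  have h2 : 0 < n.size := Nat.size_pos.2 hn
  obtain ⟨k, hk⟩ : ∃ k, n.size = k + 1 := ⟨n.size - 1, by omega⟩
  rw [hk] at h1 ⊢
  rw [Nat.lt_succ_iff, Nat.size_le]
  rw [pow_succ] at h1
  omega

section
variable {E d Δ t L V b : ℕ} {s : Mem}

theorem sumCmd_runs (H : Holds d Δ t L V s) {A B : List (ℕ × ℕ)}
    (hQ : Queue s (A ++ B)) (h14 : s.n 14 = A.length) (h15b : s.n 15 < 2 ^ b)
    (harr : ∀ i, s.arr i < 2 ^ b) :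
    Runs b sumCmd s (B.length * 6 + 5) (fun s' => s'.r 0 = moment d s.tab B (s.n 9) 0 ∧
      s'.r 2 = moment d s.tab B (s.n 9) 1 ∧ s'.r 3 = moment d s.tab B (s.n 9) 2) := by
  have htail := hQ.tail
  have hAB : (A ++ B).length = A.length + B.length := List.length_append
  refine Runs.seq_rset (by omega) (Runs.seq_rset (by omega) (Runs.seq_rset (by omega)
    (Runs.seq_set (by simp; omega) (by omega) ?_)))
  set s₀ := (((s.setR 0 (RExp.eval s (.cast 0))).setR 2
    (RExp.eval (s.setR 0 (RExp.eval s (.cast 0))) (.cast 0))).setR 3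
    (RExp.eval ((s.setR 0 (RExp.eval s (.cast 0))).setR 2
    (RExp.eval (s.setR 0 (RExp.eval s (.cast 0))) (.cast 0))) (.cast 0))).setN 17
      (NExp.eval (((s.setR 0 (RExp.eval s (.cast 0))).setR 2
    (RExp.eval (s.setR 0 (RExp.eval s (.cast 0))) (.cast 0))).setR 3
    (RExp.eval ((s.setR 0 (RExp.eval s (.cast 0))).setR 2
    (RExp.eval (s.setR 0 (RExp.eval s (.cast 0))) (.cast 0))) (.cast 0))) (var 14)) with hs₀
  have e17 : s₀.n 17 = A.length := by simp [hs₀, h14]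
  have e15 : s₀.n 15 = A.length + B.length := by simp [hs₀, htail]
  have e9 : s₀.n 9 = s.n 9 := by simp [hs₀]
  have e1 : s₀.n 1 = d := by simp [hs₀, H.n1]
  have earr : s₀.arr = s.arr := by simp [hs₀]
  have etab : s₀.tab = s.tab := by simp [hs₀]
  have er0 : s₀.r 0 = 0 := by simp [hs₀]
  have er2 : s₀.r 2 = 0 := by simp [hs₀]
  have er3 : s₀.r 3 = 0 := by simp [hs₀]
  clear_value s₀
  refine (Runs.loop (J := fun s' => ∃ h, s'.n 17 = A.length + h ∧ h ≤ B.length ∧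
      s'.r 0 = moment d s.tab (B.take h) (s.n 9) 0 ∧
      s'.r 2 = moment d s.tab (B.take h) (s.n 9) 1 ∧
      s'.r 3 = moment d s.tab (B.take h) (s.n 9) 2)
    (fun s' => A.length + B.length - s'.n 17) (T := 5)
    ⟨0, by simpa using e17, by omega, by simp [moment, er0], by simp [moment, er2],
      by simp [moment, er3]⟩ ?_ (by omega)).mono (le_refl _) ?_
  · rintro s' hF ⟨h, h1, h2, h3, h4, h5⟩ hq
    have f15 : s'.n 15 = A.length + B.length := by rw [hF.n 15 rfl, e15]
    simp only [Cond.holds_nlt, NExp.eval_var, f15, h1] at hq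
    have hhB : h < B.length := by omega
    have f9 : s'.n 9 = s.n 9 := (hF.n 9 rfl).trans e9
    have f1 : s'.n 1 = d := (hF.n 1 rfl).trans e1
    have ftab : s'.tab = s.tab := (hF.tab rfl).trans etab
    have hget : (A ++ B)[A.length + h]? = some B[h] := by
      rw [List.getElem?_append_right (by omega)]; simp [hhB]
    have hkey : s.arr (2 * (A.length + h)) = B[h].1 := (hQ.entry _ _ hget).1
    have hev : NExp.eval s' (arr (2 * var 17)) = B[h].1 := by
      simp [h1, (hF.arr rfl).trans earr, hkey]
    have htk : ∀ q, moment d s.tab (B.take (h + 1)) (s.n 9) q =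
        moment d s.tab (B.take h) (s.n 9) q + s.tab (addr d B[h].1 (s.n 9) q) := by
      intro q
      rw [moment, ← List.take_append_getElem hhB, List.map_append, List.sum_append]
      simp [moment]
    have a0 : ∀ s₁ : Mem, s₁.n 10 = B[h].1 → s₁.n 1 = d → s₁.n 9 = s.n 9 → ∀ k,
        NExp.eval s₁ addrExp + k + 1 = addr d B[h].1 (s.n 9) k := by
      intro s₁ h1 h2 h3 k; simp [addrExp, addr, h1, h2, h3]
    have hb10 : B[h].1 < 2 ^ b := hkey ▸ harr _
    refine Runs.seq_set (by rwa [hev]) (by omega) ?_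
    rw [hev]
    set s₁ := s'.setN 10 B[h].1 with hs₁
    have g := a0 s₁ (by simp [hs₁]) (by simp [hs₁, f1]) (by simp [hs₁, f9])
    have g0 := g 0
    have g1 := g 1
    have g2 := g 2
    refine Runs.seq_rset (by omega) (Runs.seq_rset (by omega) (Runs.seq_rset (by omega)
      (Runs.set (by simp [hs₁, h1]; omega) (by omega) ?_)))
    simp only [RExp.eval_add, RExp.eval_var, RExp.eval_tab, NExp.eval_setR, NExp.eval_add,
      NExp.eval_ofNat, NExp.eval_var, Mem.setR_tab, Mem.setR_n, Mem.setN_n, Mem.setN_r,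
      Mem.setR_r, g0, g1, g2]
    norm_num
    refine ⟨⟨h + 1, ?_, hhB, ?_, ?_, ?_⟩, ?_⟩
    · simp [hs₁, h1]; omega
    · rw [htk, ← h3, hs₁]; simp [ftab, ← g0]
    · rw [htk, ← h4, hs₁]; simp [ftab, ← g1]
    · rw [htk, ← h5, hs₁]; simp [ftab, ← g2]
    · simp [hs₁, h1]; omega
  · rintro s' hF ⟨⟨h, h1, h2, h3, h4, h5⟩, hq⟩
    have f15 : s'.n 15 = A.length + B.length := by rw [hF.n 15 rfl, e15]
    simp only [Cond.holds_nlt, NExp.eval_var, f15, h1] at hq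
    have : h = B.length := by omega
    rw [this, List.take_length] at h3 h4 h5
    exact ⟨h3, h4, h5⟩

/-- Reals cannot be divided or rounded, so the mean S/W is located by comparing (2m+1)W with 2S. The
test also makes sense for W = 0. -/
theorem searchCmd_runs (P : Params E d Δ t L V b) (H : Holds d Δ t L V s) :
    Runs b searchCmd s (Δ.size * 4 + 3) (fun s' => NextToMean Δ (s.r 0) (s.r 2) (s'.n 22)) := by
  have hΔ := P.Δ_pos
  have hΔb : 2 * Δ < 2 ^ b := by
    refine P.le_num ?_
    have h1 := P.d_pos
    have h3 := P.E_pos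
    calc 2 * Δ = 2 * 1 * 1 * 1 * 1 * Δ := by ring
      _ ≤ _ := by gcongr <;> omega
  refine Runs.seq_set (by simpa using P.one_lt) (by omega)
    (Runs.seq_set (by simp [H.n2]; omega) (by omega) ?_)
  have hev : NExp.eval (s.setN 22 (NExp.eval s 1)) (var 2) = Δ := by simp [H.n2]
  rw [hev]
  simp only [NExp.eval_ofNat]
  set s₀ := (s.setN 22 1).setN 23 Δ with hs₀
  refine (Runs.loop (J := fun s' => 1 ≤ s'.n 22 ∧ s'.n 22 ≤ s'.n 23 ∧ s'.n 23 ≤ Δ ∧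
      (s'.n 22 = 1 ∨ (2 * (s'.n 22 : ℝ) - 1) * s.r 0 < 2 * s.r 2) ∧
      (s'.n 23 = Δ ∨ 2 * s.r 2 ≤ (2 * (s'.n 23 : ℝ) + 1) * s.r 0))
    (fun s' => (s'.n 23 - s'.n 22).size) (T := 3) ?_ ?_ ?_).mono le_rfl ?_
  · simp [hs₀, hΔ]
  · rintro s' hF ⟨h1, h2, h3, h4, h5⟩ hq
    simp only [Cond.holds_nlt, NExp.eval_var] at hq
    have e0 : s'.r 0 = s.r 0 := by rw [hF.r 0 rfl]; simp [hs₀]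
    have e2 : s'.r 2 = s.r 2 := by rw [hF.r 2 rfl]; simp [hs₀]
    have hm : NExp.eval s' ((var 22 + var 23) / 2) = (s'.n 22 + s'.n 23) / 2 := rfl
    refine Runs.seq_set (by rw [hm]; omega) (by omega) ?_
    rw [hm]
    set m := (s'.n 22 + s'.n 23) / 2 with hmdef
    refine Runs.ite (by omega) (fun hq' => ?_) (fun hq' => ?_)
    · simp [e0, e2] at hq'
      refine Runs.set (by simp; omega) (by omega) ?_
      simp only [Mem.setN_n, NExp.eval_add, NExp.eval_var, NExp.eval_ofNat]
      norm_num
      refine ⟨⟨by omega, h3, .inr (by linarith), h5⟩, ?_⟩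
      exact size_lt_of_le_half (by omega) (by omega)
    · simp [e0, e2] at hq'
      refine Runs.set (by simp; omega) (by omega) ?_
      simp only [Mem.setN_n, NExp.eval_var]
      norm_num
      refine ⟨⟨h1, by omega, by omega, h4, .inr (by linarith)⟩, ?_⟩
      exact size_lt_of_le_half (by omega) (by omega)
  · have h1 : (s₀.n 23 - s₀.n 22).size ≤ Δ.size := Nat.size_le_size (by simp [hs₀])
    have := Nat.mul_le_mul_right 4 h1
    simp only [Nat.reduceAdd]
    omega
  · rintro s' - ⟨⟨h1, h2, h3, h4, h5⟩, hq⟩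
    simp only [Cond.holds_nlt, NExp.eval_var] at hq
    have : s'.n 23 = s'.n 22 := by omega
    rw [this] at h5 h3
    exact ⟨h1, h3, h4, h5⟩

/-- The cost, in coordinate `l`, of the coordinate `c` of a center. -/
noncomputable def coordCost (d : ℕ) (tab : ℕ → ℝ) (B : List (ℕ × ℕ)) (l c : ℕ) : ℝ :=
  moment d tab B l 2 - 2 * c * moment d tab B l 1 + c * c * moment d tab B l 0

/-- Expanding ∑ w(y - c)² expresses both costs through the moments. The center overwrites the query
point in the input array, each coordinate only after it has been used. The weight is summed anew for
each coordinate, and the last sum remains. -/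
theorem finishCmd_runs (P : Params E d Δ t L V b) (H : Holds d Δ t L V s) {A B : List (ℕ × ℕ)}
    (hQ : Queue s (A ++ B)) (h14 : s.n 14 = A.length) (hs : s.Small b) :
    Runs b finishCmd s (d * (B.length * 6 + Δ.size * 4 + 13) + 5) (fun s' =>
      (∀ l < d, NextToMean Δ (moment d s.tab B l 0) (moment d s.tab B l 1) (s'.inp l)) ∧
      s'.r 0 = moment d s.tab B (d - 1) 0 ∧
      s'.r 1 = ∑ l ∈ Finset.range d, coordCost d s.tab B l (s.inp l) ∧
      s'.tab 0 = ∑ l ∈ Finset.range d, coordCost d s.tab B l (s'.inp l) ∧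
      ∀ a, s'.tab (a + 1) = s.tab (a + 1)) := by
  have hd := P.d_pos
  have a1 : d * (B.length * 6 + Δ.size * 4 + 11 + 2) = d * (B.length * 6 + Δ.size * 4 + 13) := rfl
  refine Runs.seq_rset (by omega) (Runs.seq_rset (by omega) ?_)
  set s₀ := (s.setR 1 (RExp.eval s (.cast 0))).setR 4
    (RExp.eval (s.setR 1 (RExp.eval s (.cast 0))) (.cast 0)) with hs₀
  have hQ₀ : Queue s₀ (A ++ B) := hQ.of_eq rfl rfl
  refine (Runs.forTo (fun l s' =>
      (∀ k < l, NextToMean Δ (moment d s.tab B k 0) (moment d s.tab B k 1) (s'.inp k)) ∧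
      (∀ k, l ≤ k → s'.inp k = s.inp k) ∧ (0 < l → s'.r 0 = moment d s.tab B (l - 1) 0) ∧
      s'.r 1 = ∑ k ∈ Finset.range l, coordCost d s.tab B k (s.inp k) ∧
      s'.r 4 = ∑ k ∈ Finset.range l, coordCost d s.tab B k (s'.inp k)) d
      (B.length * 6 + Δ.size * 4 + 11) P.d_lt rfl ?_ ?_ ?_ le_rfl).seq (by omega) ?_
  · intro j s' hF _ _ _
    rw [NExp.eval_var, hF.n 1 rfl]; simpa [hs₀] using H.n1
  · exact ⟨by simp, by simp [hs₀], by simp, by simp [hs₀], by simp [hs₀]⟩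
  · rintro l hl s' hF h9 ⟨hI1, hI2, hI3, hI4, hI5⟩
    have H₀ : Holds d Δ t L V s₀ := by
      constructor <;> simp [hs₀, H.n1, H.n2, H.n3, H.n4, H.n5]
    have H' : Holds d Δ t L V s' := H₀.frame hF rfl rfl rfl rfl rfl
    have hQ' : Queue s' (A ++ B) := hQ₀.of_eq (hF.arr rfl) (hF.n 15 rfl)
    have h14' : s'.n 14 = A.length := (hF.n 14 rfl).trans h14
    have htab : s'.tab = s.tab := (hF.tab rfl).trans rfl
    refine (sumCmd_runs H' hQ' h14' (((hF.n 15 rfl).trans rfl).trans_lt (hs.n 15))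
      fun i => (congrFun ((hF.arr rfl).trans rfl) i).trans_lt (hs.arr i)).seq (by omega) ?_
    rintro s₁ hF₁ ⟨g0, g1, g2⟩
    rw [htab, h9] at g0 g1 g2
    refine (searchCmd_runs P (H'.frame hF₁ rfl rfl rfl rfl rfl)).seq (by omega) ?_
    rintro s₂ hF₂ hnext
    rw [g0, g1] at hnext
    have k0 : s₂.r 0 = moment d s.tab B l 0 := (hF₂.r 0 rfl).trans g0
    have k2 : s₂.r 2 = moment d s.tab B l 1 := (hF₂.r 2 rfl).trans g1
    have k3 : s₂.r 3 = moment d s.tab B l 2 := (hF₂.r 3 rfl).trans g2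
    have k1 : s₂.r 1 = s'.r 1 := (hF₂.r 1 rfl).trans (hF₁.r 1 rfl)
    have k4 : s₂.r 4 = s'.r 4 := (hF₂.r 4 rfl).trans (hF₁.r 4 rfl)
    have k9 : s₂.n 9 = l := ((hF₂.n 9 rfl).trans (hF₁.n 9 rfl)).trans h9
    have kin : s₂.inp = s'.inp := (hF₂.inp rfl).trans (hF₁.inp rfl)
    have kx : s'.inp l = s.inp l := hI2 l le_rfl
    set c := s₂.n 22 with hc
    have hΔb : Δ < 2 ^ b := H.n2 ▸ hs.n 2
    have hcb : c < 2 ^ b := hnext.le.trans_lt hΔb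
    have hrun : Runs b (.rset 1 (.var 1 + (.var 3 - .cast (2 * inp (var 9)) * .var 2 +
          .cast (inp (var 9) * inp (var 9)) * .var 0)) ;;
        .rset 4 (.var 4 + (.var 3 - .cast (2 * var 22) * .var 2 +
          .cast (var 22 * var 22) * .var 0)) ;;
        .setInp (var 9) (var 22)) s₂ 3 (fun s'' => s''.inp = Function.update s'.inp l c ∧
          s''.r 0 = moment d s.tab B l 0 ∧
          s''.r 1 = s'.r 1 + coordCost d s.tab B l (s.inp l) ∧
          s''.r 4 = s'.r 4 + coordCost d s.tab B l c) := by
      refine Runs.seq_rset (by omega) (Runs.seq_rset (by omega) (Runs.setInp (by simpa using hcb)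
        (by omega) ?_))
      refine ⟨?_, ?_, ?_, ?_⟩
      · simp [k9, kin, ← hc]
      · simp [k0]
      · simp [k0, k1, k2, k3, k9, kin, kx, coordCost]
      · simp [k0, k2, k3, k4, ← hc, coordCost]
    refine hrun.mono (by omega) ?_
    rintro s₃ hF₃ ⟨m1, m2, m3, m4⟩
    have hup : ∀ k < l, s₃.inp k = s'.inp k := fun k hk => by
      rw [m1, Function.update_of_ne (by omega)]
    have hul : s₃.inp l = c := by rw [m1, Function.update_self]
    simp only [Mem.setN_inp, Mem.setN_r]
    refine ⟨?_, ?_, by simpa using m2, ?_, ?_⟩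
    · intro k hk
      rcases Nat.lt_succ_iff_lt_or_eq.1 hk with h | rfl
      · rw [hup k h]; exact hI1 k h
      · rw [hul]; exact hnext
    · intro k hk
      rw [m1, Function.update_of_ne (by omega)]
      exact hI2 k (by omega)
    · rw [m3, hI4, Finset.sum_range_succ]
    · rw [m4, hI5, Finset.sum_range_succ, hul]
      congr 1
      exact Finset.sum_congr rfl fun k hk => by rw [hup k (Finset.mem_range.1 hk)]
  · rintro s₁ hF₁ ⟨-, hI1, hI2, hI3, hI4, hI5⟩
    -- Address 0 of the real array is real cell 1, where the cost of the center is returned; the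
    -- table itself begins at address 1.
    refine Runs.setTab (by omega) ?_
    refine ⟨hI1, hI3 hd, hI4, by simpa using hI5, fun a => ?_⟩
    simp [hF₁.tab rfl, hs₀]

end
end OneMeans

/-! ### The complete program and its ticks -/

namespace OneMeans
open NExp (lit var inp arr)

/-- Answer a query. -/
def queryCmd (E : ℕ) : Cmd := scaleCmd E ;; shiftCmd E ;; queueCmd E ;; finishCmd

/-- The whole program. -/
def mainCmd (E : ℕ) : Cmd :=
  .ite (.nlt (var 0) 1) (initCmd E) (.ite (.nlt (var 0) 3) (updateCmd E) (queryCmd E))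

theorem Runs.and_small {b : ℕ} {c : Cmd} {s : Mem} {K : ℕ} {Q : Mem → Prop}
    (h : Runs b c s K Q) (hs : s.Small b) : Runs b c s K (fun s' => Q s' ∧ s'.Small b) := by
  obtain ⟨s', k, he, hk, hQ⟩ := h
  exact ⟨s', k, he, hk, hQ, he.small hs⟩

/-- The bound on the number of ticks of a query. -/
def queryTicks (E d Δ t L N : ℕ) : ℕ :=
  (5 * L + 5) + ((E * (5 * d + 8) + 5) + ((d * (N * (14 * t + 13) + 7) + 6) +
    (d * (N * 6 + Δ.size * 4 + 13) + 5)))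

section
variable {E d Δ t L V b : ℕ} {s : Mem}

/-- What a query leaves in memory. -/
structure QueryPost (E d Δ t L V : ℕ) (s s' : Mem) (i j : ℕ) (B : List (ℕ × ℕ)) : Prop where
  scale_le : i ≤ L
  shift_lt : j < E
  lt_radius : i = L ∨ s.r 0 < radius E i
  radius_le : i = 0 ∨ radius E i ≤ 2 * s.r 0
  cells : B = frontier E t V (i * E + j) (fun l => pos E t i (s.inp l) + j) d
  center : ∀ l < d, NextToMean Δ (moment d s.tab B l 0) (moment d s.tab B l 1) (s'.inp l)
  weight : s'.r 0 = moment d s.tab B (d - 1) 0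
  costPoint : s'.r 1 = ∑ l ∈ Finset.range d, coordCost d s.tab B l (s.inp l)
  costCenter : s'.tab 0 = ∑ l ∈ Finset.range d, coordCost d s.tab B l (s'.inp l)
  tab : ∀ a, s'.tab (a + 1) = s.tab (a + 1)

theorem queryCmd_runs (P : Params E d Δ t L V b) (H : Holds d Δ t L V s) (hs : s.Small b)
    (hy : ∀ l < d, s.inp l ≤ Δ) (ht : (t : ℝ) * t ≤ 2 + 2 * d / E) {N : ℕ}
    (hN : Real.exp (2 + 18 * d / E) < N + 1) (hNb : (d + 1) * N < 2 ^ b) :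
    Runs b (queryCmd E) s (queryTicks E d Δ t L N)
      (fun s' => ∃ i j B, QueryPost E d Δ t L V s s' i j B) := by
  have hE : 0 < E := by have := P.E_pos; omega
  unfold queryTicks
  refine ((scaleCmd_runs P H).and_small hs).seq (by omega) ?_
  rintro s₁ hF₁ ⟨⟨hi, h7, hr1, hr2⟩, hs₁⟩
  have H₁ := H.frame hF₁ rfl rfl rfl rfl rfl
  have hin₁ : s₁.inp = s.inp := hF₁.inp rfl
  have htab₁ : s₁.tab = s.tab := hF₁.tab rfl
  generalize hi' : s₁.n 6 = i at *
  refine ((shiftCmd_runs P H₁ (hi'.symm ▸ h7) (by rwa [hin₁])).and_small hs₁).seq (by omega) ?_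
  rintro s₂ hF₂ ⟨⟨hj, hpen⟩, hs₂⟩
  have H₂ := H₁.frame hF₂ rfl rfl rfl rfl rfl
  have hin₂ : s₂.inp = s.inp := (hF₂.inp rfl).trans hin₁
  have htab₂ : s₂.tab = s.tab := (hF₂.tab rfl).trans htab₁
  have h6₂ : s₂.n 6 = i := (hF₂.n 6 rfl).trans hi'
  have h7₂ : s₂.n 7 = 2 ^ i := (hF₂.n 7 rfl).trans h7
  rw [hi', hin₁] at hpen
  generalize hj' : s₂.n 8 = j at *
  -- The chosen shift has total penalty at most 6Ed, so `N` bounds every level of the search.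
  have hlen : ∀ l ≤ d,
      (frontier E t V (i * E + j) (fun l => pos E t i (s.inp l) + j) l).length ≤ N := by
    intro l hl
    have h := (length_frontier_le_exp (V := V) (g := i * E + j) hE ht hpen hl).trans_lt hN
    exact Nat.lt_succ_iff.1 (by exact_mod_cast h)
  refine ((queueCmd_runs P H₂ h6₂ h7₂ hj' hi hj (by rwa [hin₂]) (N := N) (by rwa [hin₂])
    hNb).and_small hs₂).seq (by omega) ?_
  rintro s₃ hF₃ ⟨⟨A, hQ, h14, -⟩, hs₃⟩
  have H₃ := H₂.frame hF₃ rfl rfl rfl rfl rfl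
  have hin₃ : s₃.inp = s.inp := (hF₃.inp rfl).trans hin₂
  have htab₃ : s₃.tab = s.tab := (hF₃.tab rfl).trans htab₂
  rw [hin₂] at hQ
  have hlast := hlen d le_rfl
  refine (finishCmd_runs P H₃ hQ h14 hs₃).mono ?_ ?_
  · have := Nat.mul_le_mul_left d (show (frontier E t V (i * E + j)
      (fun l => pos E t i (s.inp l) + j) d).length * 6 + Δ.size * 4 + 13 ≤
        N * 6 + Δ.size * 4 + 13 by omega)
    omega
  · rintro s₄ - ⟨g1, g2, g3, g4, g5⟩
    rw [htab₃] at g1 g2 g3 g4 g5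
    rw [hin₃] at g3
    exact ⟨i, j, _, hi, hj, hr1, hr2, rfl, g1, g2, g3, g4, g5⟩

theorem mainCmd_init (P : Params E d Δ t L V b) (ht : ∀ u, 1 ≤ u → u < t → u * u * E < d)
    (hL : ∀ k < L, 2 ^ k < 4 * E * E * d * Δ) (h0 : s.n 0 = 0) (hd : s.inp 0 = d)
    (hΔ : s.inp 1 = Δ) (hΔb : Δ < 2 ^ b) (hVb : V < 2 ^ b) :
    Runs b (mainCmd E) s (2 * d + 3 * L + 9)
      (fun s' => Holds d Δ t L V s' ∧ s'.tab = s.tab) := by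
  refine Runs.ite (by omega) (fun _ => ?_) fun h => absurd ?_ h
  · exact (initCmd_runs P ht hL hd hΔ hΔb hVb).mono (by omega) fun s' hF h => ⟨h, hF.tab rfl⟩
  · simp [h0]

theorem mainCmd_update (P : Params E d Δ t L V b) (H : Holds d Δ t L V s)
    (hy : ∀ l < d, s.inp l ≤ Δ) (h0 : s.n 0 = 1 ∨ s.n 0 = 2) :
    Runs b (mainCmd E) s ((L + 1) * (E * (8 * d + 7) + 5) + 3 * d + 12)
      (fun s' => Holds d Δ t L V s' ∧ ∀ K l q, l < d → q < 3 →
        s'.tab (addr d K l q) = s.tab (addr d K l q) +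
        ∑ i ∈ Finset.range (L + 1), ∑ j ∈ Finset.range E,
          if K = keyOf E t V d i j s.inp then
            (s.r 0 - s.tab (addr d (keyOf E t V d 0 0 s.inp) 0 0)) * (s.inp l : ℝ) ^ q
          else 0) := by
  refine Runs.ite (by omega) (fun h => absurd h ?_) fun _ => Runs.ite (by omega) (fun _ => ?_)
    fun h => absurd ?_ h
  · simp; omega
  · exact (updateCmd_runs P H hy).mono (by omega) fun s' hF h =>
      ⟨H.frame hF rfl rfl rfl rfl rfl, h⟩
  · simp; omega

theorem mainCmd_query (P : Params E d Δ t L V b) (H : Holds d Δ t L V s) (hs : s.Small b)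
    (hy : ∀ l < d, s.inp l ≤ Δ) (ht : (t : ℝ) * t ≤ 2 + 2 * d / E) {N : ℕ}
    (hN : Real.exp (2 + 18 * d / E) < N + 1) (hNb : (d + 1) * N < 2 ^ b) (h0 : s.n 0 = 3) :
    Runs b (mainCmd E) s (queryTicks E d Δ t L N + 2)
      (fun s' => Holds d Δ t L V s' ∧ ∃ i j B, QueryPost E d Δ t L V s s' i j B) := by
  refine Runs.ite (by omega) (fun h => absurd h ?_) fun _ => Runs.ite (by omega)
    (fun h => absurd h ?_) fun _ => ?_
  · simp; omega
  · simp; omega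
  · exact (queryCmd_runs P H hs hy ht hN hNb).mono (by omega) fun s' hF h =>
      ⟨H.frame hF rfl rfl rfl rfl rfl, h⟩

theorem NExp.width_hSub (a b : NExp) : (a - b).width = a.width + b.width := rfl
theorem NExp.width_hDiv (a b : NExp) : (a / b).width = a.width + b.width := rfl
theorem NExp.work_hSub (a b : NExp) :
    (a - b).work = a.work + b.work + a.width + b.width + 1 := rfl
theorem NExp.work_hDiv (a b : NExp) :
    (a / b).work = a.work + b.work + a.width + b.width + 1 := rfl
theorem RExp.work_hSub (a b : RExp) : (a - b).work = a.work + b.work + 1 := rfl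

/-- Independent of `E`, because a literal is charged in units of `b` bits whatever its value. -/
theorem work_mainCmd (E : ℕ) : (mainCmd E).work ≤ 200 := by
  simp [mainCmd, initCmd, updateCmd, queryCmd, scaleCmd, shiftCmd, queueCmd, finishCmd, keyCmd,
    addCmd, penaltyCmd, levelCmd, entryCmd, sumCmd, searchCmd, posExp, addrExp, Cmd.forTo,
    Cmd.work, Cond.work, RExp.work, NExp.work, NExp.width, NExp.width_hSub,
    NExp.width_hDiv, NExp.work_hSub, NExp.work_hDiv, RExp.work_hSub]

theorem mainCmd_ok (hE : E < 2 ^ b) (hb : 5 ≤ b) : (mainCmd E).Ok b := by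
  have h5 : 2 ^ 5 ≤ 2 ^ b := Nat.pow_le_pow_right (by norm_num) hb
  have h0 : 0 < 2 ^ b := by omega
  have h1 : 1 < 2 ^ b := by omega
  have h2 : 2 < 2 ^ b := by omega
  have h3 : 3 < 2 ^ b := by omega
  have h4 : 4 < 2 ^ b := by omega
  repeat' constructor
  all_goals assumption

end
end OneMeans

namespace OneMeans

/-! ### The center -/

/-- The mean μ minimizes the sum on the right, and |c - μ| ≤ 1/2. An integer y ≠ c is at distance at
least 1 from c, so |y - c| ≤ 2|y - μ| for every point. -/
theorem NextToMean.sum_le {ι : Type*} {Δ c : ℕ} {B : Finset ι} {w : ι → ℝ} {y : ι → ℕ}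
    (hw : ∀ k ∈ B, 0 ≤ w k) (hy : ∀ k ∈ B, 1 ≤ y k ∧ y k ≤ Δ)
    (h : NextToMean Δ (∑ k ∈ B, w k) (∑ k ∈ B, w k * y k) c) (z : ℝ) :
    ∑ k ∈ B, w k * ((y k : ℝ) - c) ^ 2 ≤ 4 * ∑ k ∈ B, w k * ((y k : ℝ) - z) ^ 2 := by
  obtain ⟨-, -, h1, h2⟩ := h
  set W := ∑ k ∈ B, w k with hW
  set S := ∑ k ∈ B, w k * y k with hS
  have hW0 : 0 ≤ W := Finset.sum_nonneg hw
  rcases hW0.eq_or_lt with h0 | hpos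
  -- Without total weight there is no mean, but then both sums vanish.
  · have hz : ∀ k ∈ B, w k = 0 := (Finset.sum_eq_zero_iff_of_nonneg hw).1 h0.symm
    rw [Finset.sum_eq_zero fun k hk => by rw [hz k hk, zero_mul],
      Finset.sum_eq_zero fun k hk => by rw [hz k hk, zero_mul], mul_zero]
  obtain ⟨μ, hμ⟩ : ∃ μ : ℝ, S = μ * W := ⟨S / W, by field_simp⟩
  have hSge : W ≤ S := Finset.sum_le_sum fun k hk =>
    le_mul_of_one_le_right (hw k hk) (by exact_mod_cast (hy k hk).1)
  have hSle : S ≤ Δ * W := by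
    rw [hW, Finset.mul_sum]
    refine Finset.sum_le_sum fun k hk => ?_
    rw [mul_comm]
    exact mul_le_mul_of_nonneg_right (by exact_mod_cast (hy k hk).2) (hw k hk)
  rw [hμ] at hSge hSle h1 h2
  have hμ1 : 1 ≤ μ := le_of_mul_le_mul_right (by linarith) hpos
  have hμ2 : μ ≤ Δ := le_of_mul_le_mul_right hSle hpos
  -- At the end c = 1 of the range the search gives no inequality, but μ ≥ 1 does; the other end is
  -- similar.
  have hc1 : (c : ℝ) - μ ≤ 1 / 2 := by
    rcases h1 with h1 | h1
    · rw [h1]; push_cast; linarith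
    · have : 2 * (c : ℝ) - 1 < 2 * μ := lt_of_mul_lt_mul_right (by linarith) hpos.le
      linarith
  have hc2 : μ - c ≤ 1 / 2 := by
    rcases h2 with h2 | h2
    · rw [h2]; linarith
    · have : 2 * μ ≤ 2 * c + 1 := le_of_mul_le_mul_right (by linarith) hpos
      linarith
  have hpt : ∀ k, ((y k : ℝ) - c) ^ 2 ≤ 4 * ((y k : ℝ) - μ) ^ 2 := by
    intro k
    rcases lt_trichotomy (y k) c with hlt | heq | hgt
    · have : (y k : ℝ) + 1 ≤ c := by exact_mod_cast hlt
      nlinarith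
    · rw [heq]; nlinarith [sq_nonneg ((c : ℝ) - μ)]
    · have : (c : ℝ) + 1 ≤ y k := by exact_mod_cast hgt
      nlinarith
  -- The difference of the two sums is (μ - z)²·W.
  have hmean : ∑ k ∈ B, w k * ((y k : ℝ) - μ) ^ 2 ≤ ∑ k ∈ B, w k * ((y k : ℝ) - z) ^ 2 := by
    have e : ∑ k ∈ B, w k * ((y k : ℝ) - z) ^ 2 - ∑ k ∈ B, w k * ((y k : ℝ) - μ) ^ 2 =
        2 * (μ - z) * S + (z ^ 2 - μ ^ 2) * W := by
      rw [hS, hW, ← Finset.sum_sub_distrib, Finset.mul_sum, Finset.mul_sum,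
        ← Finset.sum_add_distrib]
      exact Finset.sum_congr rfl fun k _ => by ring
    rw [hμ] at e
    have : 0 ≤ (μ - z) ^ 2 * W := by positivity
    nlinarith
  calc _ ≤ ∑ k ∈ B, w k * (4 * ((y k : ℝ) - μ) ^ 2) :=
        Finset.sum_le_sum fun k hk => mul_le_mul_of_nonneg_left (hpt k) (hw k hk)
    _ = 4 * ∑ k ∈ B, w k * ((y k : ℝ) - μ) ^ 2 := by
        rw [Finset.mul_sum]; exact Finset.sum_congr rfl fun k _ => by ring
    _ ≤ _ := by linarith

/-! ### Coordinates of grid points -/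

/-- The coordinates of a grid point. -/
def Grid.co {d Δ : ℕ} (y : Grid d Δ) (l : ℕ) : ℕ := if h : l < d then y ⟨l, h⟩ else 0

section
variable {d Δ : ℕ}

theorem Grid.co_coe (y : Grid d Δ) (i : Fin d) : y.co i = y i := by simp [Grid.co]

theorem Grid.one_le_co (y : Grid d Δ) {l : ℕ} (hl : l < d) : 1 ≤ y.co l := by
  simp only [Grid.co, hl, dif_pos]
  exact (Finset.mem_Icc.1 (y ⟨l, hl⟩).2).1

theorem Grid.co_le (y : Grid d Δ) {l : ℕ} (hl : l < d) : y.co l ≤ Δ := by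
  simp only [Grid.co, hl, dif_pos]
  exact (Finset.mem_Icc.1 (y ⟨l, hl⟩).2).2

theorem Grid.ext_co {x y : Grid d Δ} (h : ∀ l < d, x.co l = y.co l) : x = y := by
  funext i
  have := h i i.2
  rw [Grid.co_coe, Grid.co_coe] at this
  exact Subtype.ext this

theorem Grid.dist_sq (y : Grid d Δ) (c : EuclideanSpace ℝ (Fin d)) :
    dist y.pt c ^ 2 = ∑ i : Fin d, ((y i : ℕ) - c i : ℝ) ^ 2 := by
  rw [EuclideanSpace.dist_eq, Real.sq_sqrt (Finset.sum_nonneg fun _ _ => sq_nonneg _)]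
  refine Finset.sum_congr rfl fun i _ => ?_
  rw [Real.dist_eq, sq_abs]
  rfl

theorem Grid.dist_sq_co (x y : Grid d Δ) :
    dist x.pt y.pt ^ 2 = ∑ l ∈ Finset.range d, ((x.co l : ℝ) - y.co l) ^ 2 := by
  rw [Grid.dist_sq, Finset.sum_range]
  exact Finset.sum_congr rfl fun i _ => by rw [Grid.co_coe, Grid.co_coe]; rfl

theorem cost_eq (w : Grid d Δ → ℝ≥0) (B : Finset (Grid d Δ)) (c : EuclideanSpace ℝ (Fin d)) :
    cost w B c = ∑ i : Fin d, ∑ y ∈ B, (w y : ℝ) * ((y.co i : ℝ) - c i) ^ 2 := by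
  rw [cost, Finset.sum_comm]
  refine Finset.sum_congr rfl fun y _ => ?_
  rw [Grid.dist_sq, Finset.mul_sum]
  exact Finset.sum_congr rfl fun i _ => by rw [Grid.co_coe]

theorem cost_nonneg (w : Grid d Δ → ℝ≥0) (B : Finset (Grid d Δ))
    (c : EuclideanSpace ℝ (Fin d)) : 0 ≤ cost w B c :=
  Finset.sum_nonneg fun _ _ => by positivity

/-- Squared distances split over the coordinates, so the one-dimensional estimate applies in each of
them against an arbitrary real center. -/
theorem cost_le_opt₁ (w : Grid d Δ → ℝ≥0) (B : Finset (Grid d Δ)) (c : Grid d Δ)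
    (h : ∀ l < d, NextToMean Δ (∑ y ∈ B, (w y : ℝ)) (∑ y ∈ B, (w y : ℝ) * y.co l) (c.co l)) :
    cost w B c.pt ≤ 4 * opt₁ w B := by
  suffices H : ∀ z, cost w B c.pt / 4 ≤ cost w B z by
    have := le_ciInf H
    unfold opt₁
    linarith
  intro z
  rw [div_le_iff₀' (by norm_num), cost_eq, cost_eq, Finset.mul_sum]
  refine Finset.sum_le_sum fun i _ => ?_
  have := (h i i.2).sum_le (fun y _ => (w y).2) (fun y _ => ⟨y.one_le_co i.2, y.co_le i.2⟩) (z i)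
  rwa [Grid.co_coe] at this

end
end OneMeans

namespace OneMeans

/-! ### The table -/

theorem horner_congr {V g : ℕ} {f f' : ℕ → ℕ} {l : ℕ} (h : ∀ k < l, f k = f' k) :
    horner V g f l = horner V g f' l := by
  induction l with
  | zero => rfl
  | succ l ih => rw [horner, horner, ih fun k hk => h k (by omega), h l (by omega)]

theorem horner_div {V g : ℕ} {f : ℕ → ℕ} {l : ℕ} (hf : ∀ k < l, f k < V) :
    horner V g f l / V ^ l = g := by
  induction l with
  | zero => simp [horner]
  | succ l ih =>
    have hl := hf l (by omega)
    rw [horner, pow_succ', ← Nat.div_div_eq_div_mul, mul_comm _ V, Nat.mul_add_div (by omega),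
      Nat.div_eq_of_lt hl, add_zero, ih fun k hk => hf k (by omega)]

section
variable {E d Δ t L V b : ℕ}

/-- The weight, as a function on the whole grid. -/
noncomputable def WSet.wt (X : WSet d Δ) (y : Grid d Δ) : ℝ :=
  if y ∈ X.pts then (X.w y : ℝ) else 0

/-- The table holds, for each cell, the moments of the weighted points in it. -/
def TabInv (E t V d L : ℕ) {Δ : ℕ} (X : WSet d Δ) (tab : ℕ → ℝ) : Prop :=
  ∀ K l q, l < d → q < 3 → tab (addr d K l q) = ∑ y : Grid d Δ, X.wt y *
    ∑ i ∈ Finset.range (L + 1), ∑ j ∈ Finset.range E,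
      if K = keyOf E t V d i j y.co then (y.co l : ℝ) ^ q else 0

theorem Params.digit_lt (P : Params E d Δ t L V b) {i j : ℕ} (hj : j < E) (y : Grid d Δ) :
    ∀ l < d, (pos E t i (y.co l) + j) / E + t < V := fun l hl => by
  have := P.cell_le (i := i) (y.co_le hl) hj
  have := P.t_pos
  omega

/-- The leading digit separates the grids, and cells of scale 0 separate grid points. -/
theorem Params.keyOf_eq_zero (P : Params E d Δ t L V b) {i j : ℕ} (hj : j < E)
    (x y : Grid d Δ) :
    keyOf E t V d 0 0 x.co = keyOf E t V d i j y.co ↔ (i = 0 ∧ j = 0) ∧ x = y := by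
  have hE := P.E_pos
  constructor
  · intro h
    obtain ⟨h1, h2⟩ := (horner_inj (P.digit_lt (by omega) x) (P.digit_lt hj y)).1 h
    have hj0 : j = 0 := by omega
    have hi0 : i = 0 := by
      have : i * E = 0 := by omega
      rcases Nat.mul_eq_zero.1 this with h | h <;> omega
    subst hj0 hi0
    refine ⟨⟨rfl, rfl⟩, Grid.ext_co ?_⟩
    refine eq_of_cells_eq (t := t) (j := 0) (by omega) P.t_pos P.d_le hE ?_
    have ht := P.t_pos
    rw [Finset.sum_eq_zero]
    · positivity
    · intro l hl
      have := h2 l (Finset.mem_range.1 hl)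
      rw [Nat.add_right_cancel_iff] at this
      rw [← this, gap_self _ _ (by omega), zero_mul]
  · rintro ⟨⟨rfl, rfl⟩, rfl⟩; rfl

/-- This replaces a dictionary of current weights; absent points read as 0. -/
theorem TabInv.weight (P : Params E d Δ t L V b) {X : WSet d Δ} {tab : ℕ → ℝ}
    (h : TabInv E t V d L X tab) (x : Grid d Δ) :
    tab (addr d (keyOf E t V d 0 0 x.co) 0 0) = X.wt x := by
  have hE := P.E_pos
  rw [h _ _ _ P.d_pos (by norm_num), Finset.sum_eq_single x]
  · rw [Finset.sum_eq_single 0, Finset.sum_eq_single 0]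
    · simp
    · intro j hj hne
      rw [if_neg]
      rw [P.keyOf_eq_zero (Finset.mem_range.1 hj)]
      tauto
    · simp; omega
    · intro i hi hne
      refine Finset.sum_eq_zero fun j hj => if_neg ?_
      rw [P.keyOf_eq_zero (Finset.mem_range.1 hj)]
      tauto
    · simp
  · intro y _ hne
    rw [Finset.sum_eq_zero, mul_zero]
    refine fun i hi => Finset.sum_eq_zero fun j hj => if_neg ?_
    rw [P.keyOf_eq_zero (Finset.mem_range.1 hj)]
    exact fun h => hne h.2.symm
  · simp

theorem keyOf_congr {x y : ℕ → ℕ} (h : ∀ l < d, x l = y l) (i j : ℕ) :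
    keyOf E t V d i j x = keyOf E t V d i j y :=
  horner_congr fun k hk => by rw [h k hk]

/-- The invariant is linear in the weight function, which changes at a single point. -/
theorem TabInv.update (P : Params E d Δ t L V b) {X X' : WSet d Δ} {tab tab' : ℕ → ℝ}
    (h : TabInv E t V d L X tab) {x : Grid d Δ} {v : ℝ} {z : ℕ → ℕ} (hz : ∀ l < d, z l = x.co l)
    (hX : ∀ y, X'.wt y = if y = x then v else X.wt y)
    (ht : ∀ K l q, l < d → q < 3 → tab' (addr d K l q) = tab (addr d K l q) +
        ∑ i ∈ Finset.range (L + 1), ∑ j ∈ Finset.range E,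
          if K = keyOf E t V d i j z then
            (v - tab (addr d (keyOf E t V d 0 0 z) 0 0)) * (z l : ℝ) ^ q
          else 0) : TabInv E t V d L X' tab' := by
  intro K l q hl hq
  have hX' : ∀ y, X'.wt y = X.wt y + if y = x then v - X.wt x else 0 := by
    intro y
    rw [hX]
    split_ifs with hy
    · rw [hy]; ring
    · ring
  rw [ht K l q hl hq, h K l q hl hq, keyOf_congr hz, h.weight P x]
  simp only [hX', add_mul, Finset.sum_add_distrib]
  congr 1
  rw [Finset.sum_eq_single x (fun y _ hy => by rw [if_neg hy, zero_mul]) (by simp)]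
  simp only [Finset.mul_sum, if_true, mul_ite, mul_zero, hz l hl,
    fun i j => keyOf_congr (E := E) (t := t) (V := V) hz i j]

theorem tabInv_empty (w : Grid d Δ → ℝ≥0) : TabInv E t V d L ⟨∅, w⟩ (fun _ => 0) := by
  intro K l q _ _
  simp [WSet.wt]

theorem wt_apply_insert (X : WSet d Δ) (x : Grid d Δ) (v : ℝ≥0) (y : Grid d Δ) :
    ((Request.insert x v).apply X).wt y = if y = x then (v : ℝ) else X.wt y := by
  by_cases h : y = x <;> simp [WSet.wt, Request.apply, h]

theorem wt_apply_delete (X : WSet d Δ) (x y : Grid d Δ) :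
    ((Request.delete x).apply X).wt y = if y = x then 0 else X.wt y := by
  by_cases h : y = x <;> simp [WSet.wt, Request.apply, h]

/-! ### The points near a query point -/

/-- The points whose cells are found by a query. -/
noncomputable def near (E t i j : ℕ) (X : WSet d Δ) (x : Grid d Δ) : Finset (Grid d Δ) :=
  X.pts.filter fun y => ∑ l ∈ Finset.range d,
    gap E (pos E t i (x.co l) + j) ((pos E t i (y.co l) + j) / E) *
    gap E (pos E t i (x.co l) + j) ((pos E t i (y.co l) + j) / E) < t * t

theorem frontier_congr {g : ℕ} {z z' : ℕ → ℕ} {l : ℕ} (h : ∀ k < l, z k = z' k) :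
    frontier E t V g z l = frontier E t V g z' l := by
  induction l with
  | zero => rfl
  | succ l ih => rw [frontier, frontier, ih fun k hk => h k (by omega), h l (by omega)]

variable {i j : ℕ} {X : WSet d Δ} {x : Grid d Δ}

theorem Params.cell_lt (P : Params E d Δ t L V b) (hj : j < E) (x : Grid d Δ) :
    ∀ l < d, (pos E t i (x.co l) + j) / E + 2 * t < V := fun l hl => by
  have := P.cell_le (i := i) (x.co_le hl) hj
  omega

theorem keyOf_mem_frontier (P : Params E d Δ t L V b) (hj : j < E) (y : Grid d Δ) :
    keyOf E t V d i j y.co ∈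
      (frontier E t V (i * E + j) (fun l => pos E t i (x.co l) + j) d).map Prod.fst ↔
    ∑ l ∈ Finset.range d, gap E (pos E t i (x.co l) + j) ((pos E t i (y.co l) + j) / E) *
      gap E (pos E t i (x.co l) + j) ((pos E t i (y.co l) + j) / E) < t * t := by
  have hE := P.E_pos
  have key := fun {rem} => mem_frontier (g := i * E + j) (z := fun l => pos E t i (x.co l) + j)
    (c := fun l => (pos E t i (y.co l) + j) / E) (l := d) (rem := rem) (by omega) P.t_pos
    (P.cell_lt hj x) (P.digit_lt hj y)
  rw [List.mem_map]
  constructor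
  · rintro ⟨⟨p1, p2⟩, hp, rfl : p1 = _⟩
    have := key.1 hp
    omega
  · intro h
    exact ⟨(_, t * t - ∑ l ∈ Finset.range d, gap E (pos E t i (x.co l) + j)
      ((pos E t i (y.co l) + j) / E) * gap E (pos E t i (x.co l) + j)
      ((pos E t i (y.co l) + j) / E)), key.2 (by omega), rfl⟩

theorem lead_inj {i' j' : ℕ} (hj : j < E) (hj' : j' < E) (h : i' * E + j' = i * E + j) :
    i' = i ∧ j' = j := (mul_add_inj hj' hj).1 h

/-- Exchange the sums over cells and points. The leading part of the cells found leaves only the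
grid (i, j), in which a point has one cell, and that cell occurs at most once in the list. -/
theorem moment_eq (P : Params E d Δ t L V b) {tab : ℕ → ℝ} (hT : TabInv E t V d L X tab)
    (hi : i ≤ L) (hj : j < E) {l q : ℕ} (hl : l < d) (hq : q < 3) :
    moment d tab (frontier E t V (i * E + j) (fun l => pos E t i (x.co l) + j) d) l q =
      ∑ y ∈ near E t i j X x, (X.w y : ℝ) * (y.co l : ℝ) ^ q := by
  classical
  set B := frontier E t V (i * E + j) (fun l => pos E t i (x.co l) + j) d with hB
  have hnd : (B.map Prod.fst).Nodup := frontier_nodup (P.cell_lt hj x)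
  have h1 : moment d tab B l q =
      ∑ K ∈ (B.map Prod.fst).toFinset, tab (addr d K l q) := by
    rw [List.sum_toFinset _ hnd, List.map_map]; rfl
  have hin : ∀ y : Grid d Δ, (∑ K ∈ (B.map Prod.fst).toFinset, ∑ i' ∈ Finset.range (L + 1),
      ∑ j' ∈ Finset.range E, if K = keyOf E t V d i' j' y.co then (y.co l : ℝ) ^ q else 0) =
      if keyOf E t V d i j y.co ∈ B.map Prod.fst then (y.co l : ℝ) ^ q else 0 := by
    intro y
    rw [Finset.sum_comm, Finset.sum_eq_single i, Finset.sum_comm, Finset.sum_eq_single j]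
    · simp
    · intro j' hj' hne
      refine Finset.sum_eq_zero fun K hK => if_neg ?_
      rintro rfl
      obtain ⟨p, hp, hpk⟩ := List.mem_map.1 (List.mem_toFinset.1 hK)
      have e1 := frontier_lead (P.cell_lt hj x) hp
      rw [hpk, keyOf, horner_div (P.digit_lt (Finset.mem_range.1 hj') y)] at e1
      omega
    · simp [hj.not_ge]
    · intro i' hi' hne
      refine Finset.sum_eq_zero fun K hK => Finset.sum_eq_zero fun j' hj' => if_neg ?_
      rintro rfl
      obtain ⟨p, hp, hpk⟩ := List.mem_map.1 (List.mem_toFinset.1 hK)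
      have e1 := frontier_lead (P.cell_lt hj x) hp
      rw [hpk, keyOf, horner_div (P.digit_lt (Finset.mem_range.1 hj') y)] at e1
      exact hne (lead_inj hj (Finset.mem_range.1 hj') e1).1
    · intro h; exact absurd (Finset.mem_range.2 (by omega)) h
  rw [h1, Finset.sum_congr rfl fun K _ => hT K l q hl hq, Finset.sum_comm, near,
    Finset.sum_filter, ← Finset.sum_subset (Finset.subset_univ X.pts)]
  · refine Finset.sum_congr rfl fun y hy => ?_
    rw [← Finset.mul_sum, hin, WSet.wt, if_pos hy]
    simp only [hB, keyOf_mem_frontier P hj y]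
    split_ifs <;> simp
  · intro y _ hy
    simp [WSet.wt, hy]

theorem coordCost_eq (P : Params E d Δ t L V b) {tab : ℕ → ℝ} (hT : TabInv E t V d L X tab)
    (hi : i ≤ L) (hj : j < E) {l : ℕ} (hl : l < d) (c : ℕ) :
    coordCost d tab (frontier E t V (i * E + j) (fun l => pos E t i (x.co l) + j) d) l c =
      ∑ y ∈ near E t i j X x, (X.w y : ℝ) * ((y.co l : ℝ) - c) ^ 2 := by
  rw [coordCost, moment_eq P hT hi hj hl (by norm_num), moment_eq P hT hi hj hl (by norm_num),
    moment_eq P hT hi hj hl (by norm_num), Finset.mul_sum, Finset.mul_sum,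
    ← Finset.sum_sub_distrib, ← Finset.sum_add_distrib]
  exact Finset.sum_congr rfl fun y _ => by ring

theorem cost_near (P : Params E d Δ t L V b) {tab : ℕ → ℝ} (hT : TabInv E t V d L X tab)
    (hi : i ≤ L) (hj : j < E) (c : Grid d Δ) {z : ℕ → ℕ} (hz : ∀ l < d, z l = c.co l) :
    ∑ l ∈ Finset.range d, coordCost d tab
        (frontier E t V (i * E + j) (fun l => pos E t i (x.co l) + j) d) l (z l) =
      cost X.w (near E t i j X x) c.pt := by
  rw [cost_eq, Finset.sum_range]
  refine Finset.sum_congr rfl fun l _ => ?_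
  rw [coordCost_eq P hT hi hj l.2, hz l l.2, Grid.co_coe]
  rfl

end
end OneMeans

namespace OneMeans

/-! ### Correctness of the answers -/

section
variable {E d Δ t L V b : ℕ} {i j : ℕ} {X : WSet d Δ} {x : Grid d Δ}

/-- At the top scale the ball around any grid point contains the whole grid, so larger query radii
need no further scale. -/
theorem Params.diam_le (P : Params E d Δ t L V b) : (d * Δ : ℝ) ≤ radius E L := by
  have hE : (0 : ℝ) < E := by exact_mod_cast (by have := P.E_pos; omega : 0 < E)
  have h : (4 * E * E * d * Δ : ℝ) ≤ 2 ^ L := by exact_mod_cast P.le_L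
  rw [radius, le_div_iff₀ (by positivity)]
  linarith

theorem Grid.dist_le (x y : Grid d Δ) : dist x.pt y.pt ^ 2 ≤ (d * Δ : ℝ) ^ 2 := by
  rw [Grid.dist_sq_co]
  calc ∑ l ∈ Finset.range d, ((x.co l : ℝ) - y.co l) ^ 2
      ≤ ∑ _l ∈ Finset.range d, (Δ : ℝ) ^ 2 := Finset.sum_le_sum fun l hl => by
        have hl := Finset.mem_range.1 hl
        have h1 : (x.co l : ℝ) ≤ Δ := by exact_mod_cast x.co_le hl
        have h2 : (y.co l : ℝ) ≤ Δ := by exact_mod_cast y.co_le hl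
        have h3 : (0 : ℝ) ≤ x.co l := Nat.cast_nonneg _
        have h4 : (0 : ℝ) ≤ y.co l := Nat.cast_nonneg _
        exact sq_le_sq' (by linarith) (by linarith)
    _ = d * (Δ : ℝ) ^ 2 := by simp
    _ ≤ (d * Δ : ℝ) ^ 2 := by
        rw [mul_pow]
        refine mul_le_mul_of_nonneg_right ?_ (sq_nonneg _)
        have : d ≤ d ^ 2 := Nat.le_self_pow (by norm_num) d
        exact_mod_cast this

theorem mem_near_of_dist_le (P : Params E d Δ t L V b) {r : ℝ} {y : Grid d Δ} (hy : y ∈ X.pts)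
    (hr : i = L ∨ r < radius E i) (h : dist x.pt y.pt ≤ r) : y ∈ near E t i j X x := by
  have hE : 0 < E := by have := P.E_pos; omega
  refine Finset.mem_filter.2 ⟨hy, sum_gap_lt hE P.t_pos j ?_⟩
  rw [← Grid.dist_sq_co]
  rcases hr with rfl | hr
  · exact (x.dist_le y).trans (pow_le_pow_left₀ (by positivity) P.diam_le 2)
  · exact pow_le_pow_left₀ dist_nonneg (h.trans hr.le) 2

/-- At scale 0 only the query point is found. Otherwise the squared distance is at most 10E³(2r)² ≤
40·33³·ε⁻³r², and 40·33³ = 1437480 is below 2000². -/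
theorem dist_le_of_mem_near (P : Params E d Δ t L V b) {ε r : ℝ} (hε : 0 < ε)
    (hEε : (E : ℝ) ≤ 33 / ε) (hr0 : 0 ≤ r) {y : Grid d Δ}
    (hr : i = 0 ∨ radius E i ≤ 2 * r) (h : y ∈ near E t i j X x) :
    dist x.pt y.pt ≤ 2000 * ε ^ (-(3 / 2) : ℝ) * r := by
  have hE : 0 < E := by have := P.E_pos; omega
  have h := (Finset.mem_filter.1 h).2
  have hp : 0 < ε ^ (-(3 / 2) : ℝ) := Real.rpow_pos_of_pos hε _
  rcases hr with rfl | hr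
  · have := eq_of_cells_eq hE P.t_pos P.d_le P.E_pos h
    rw [Grid.ext_co this, dist_self]
    positivity
  · have h1 := sum_sq_le hE P.t_pos P.d_le h
    rw [← Grid.dist_sq_co] at h1
    refine abs_le_of_sq_le_sq' ?_ (by positivity) |>.2
    have hsq : (ε ^ (-(3 / 2) : ℝ)) ^ 2 = 1 / ε ^ 3 := by
      rw [← Real.rpow_natCast, ← Real.rpow_mul hε.le, one_div, ← Real.rpow_natCast,
        ← Real.rpow_neg hε.le]
      norm_num
    have hE3 : (E : ℝ) ^ 3 ≤ 33 ^ 3 / ε ^ 3 := by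
      rw [← div_pow]; exact pow_le_pow_left₀ (by positivity) hEε 3
    have hrad : radius E i ^ 2 ≤ (2 * r) ^ 2 := pow_le_pow_left₀ (radius_pos hE i).le hr 2
    calc _ ≤ 10 * (E : ℝ) ^ 3 * radius E i ^ 2 := h1
      _ ≤ 10 * (33 ^ 3 / ε ^ 3) * (2 * r) ^ 2 := by gcongr
      _ = 1437480 * (1 / ε ^ 3 * r ^ 2) := by ring
      _ ≤ 4000000 * (1 / ε ^ 3 * r ^ 2) := by gcongr; norm_num
      _ = _ := by rw [mul_pow, mul_pow, hsq]; ring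

/-- The witness is `near`. Its weight and both costs are returned exactly and the center is optimal
up to a factor 4; the constant 2000 is needed only for the radius. -/
theorem QueryPost.correct (P : Params E d Δ t L V b) {s s' : Mem} {B : List (ℕ × ℕ)}
    (h : QueryPost E d Δ t L V s s' i j B) {r : ℝ≥0} (hin : ∀ l < d, s.inp l = x.co l)
    (hr : s.r 0 = r) (hT : TabInv E t V d L X s.tab) {ε : ℝ} (hε : 0 < ε)
    (hEε : (E : ℝ) ≤ 33 / ε) {a : Answer d} (ha : a.weight = s'.r 0)
    (hc : ∀ i : Fin d, a.center i = s'.inp i) (hcc : a.costCenter = s'.tab 0)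
    (hcp : a.costPoint = s'.r 1) : a.Correct 2000 ε X x r := by
  obtain ⟨hi, hj, hr1, hr2, rfl, h1, h2, h3, h4, -⟩ := h
  have hd := P.d_pos
  rw [frontier_congr (z' := fun l => pos E t i (x.co l) + j) fun k hk => by
    rw [hin k hk]] at h1 h2 h3 h4
  rw [hr] at hr1 hr2
  set c : Grid d Δ := fun l => ⟨s'.inp l, Finset.mem_Icc.2 ⟨(h1 l l.2).one_le, (h1 l l.2).le⟩⟩
    with hcdef
  have hco : ∀ l < d, s'.inp l = c.co l := fun l hl => by simp [Grid.co, hl, hcdef]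
  have hcost := cost_near (X := X) (x := x) P hT hi hj c hco
  have hcostx := cost_near (X := X) (x := x) P hT hi hj x hin
  have hopt : cost X.w (near E t i j X x) c.pt ≤ 4 * opt₁ X.w (near E t i j X x) := by
    refine cost_le_opt₁ _ _ _ fun l hl => ?_
    have := h1 l hl
    rw [moment_eq P hT hi hj hl (by norm_num), moment_eq P hT hi hj hl (by norm_num),
      hco l hl] at this
    simpa using this
  have hopt0 : 0 ≤ opt₁ X.w (near E t i j X x) := Real.iInf_nonneg fun _ => cost_nonneg _ _ _
  have hn := cost_nonneg X.w (near E t i j X x)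
  refine ⟨c, fun l => by rw [hc, hcdef], near E t i j X x, Finset.filter_subset _ _,
    fun y hy hdist => mem_near_of_dist_le P hy hr1 hdist,
    fun y hy => dist_le_of_mem_near P hε hEε r.2 hr2 hy, ?_, ?_, ?_, ?_⟩
  · rw [ha, h2, moment_eq P hT hi hj (by omega) (by norm_num)]
    simp
  · rw [hcc, h4, hcost]
    exact ⟨le_rfl, by linarith [hn c.pt]⟩
  · rw [hcp, h3, hcostx]
    exact ⟨le_rfl, by linarith [hn x.pt]⟩
  · linarith

end
end OneMeans

namespace OneMeans

/-! ### The interaction -/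

theorem Runs.run_comp {b K W : ℕ} {c : Cmd} {s : Mem} {Q : Mem → Prop} {ω : Coins} {σ : State}
    (h : Runs b c s K Q) (hb : 1 ≤ b) (hs : s.Small b) (hok : c.Ok b) (hW : c.work ≤ W)
    (hpc : σ.pc = 0) (hr : Rep s σ) :
    Halts (c.comp 0) ω σ ∧ runCost (c.comp 0) ω σ ≤ K * (W * b) ∧
      ∃ s', Rep s' (run (c.comp 0) ω σ) ∧ s'.Small b ∧ Q s' := by
  obtain ⟨s', k, he, hk, hQ⟩ := h
  obtain ⟨h1, h2, h3⟩ := he.run (ω := ω) hb hs hok hpc hr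
  exact ⟨h1, h3.trans (Nat.mul_le_mul hk (Nat.mul_le_mul_right _ hW)), s', h2, he.small hs, hQ⟩

/-- The parameters, with all that is needed for the whole interaction. -/
structure Setup (E d Δ t L V b N : ℕ) : Prop extends Params E d Δ t L V b where
  t_min : ∀ u, 1 ≤ u → u < t → u * u * E < d
  t_sq : (t : ℝ) * t ≤ 2 + 2 * d / E
  L_min : ∀ k < L, 2 ^ k < 4 * E * E * d * Δ
  exp_lt : Real.exp (2 + 18 * d / E) < N + 1
  queue_lt : (d + 1) * N < 2 ^ b
  five_le : 5 ≤ b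

/-- The bound on the number of ticks for the initialization and for each request. -/
def ticks (E d Δ t L N : ℕ) : ℕ :=
  ((L + 1) * (E * (8 * d + 7) + 5) + 3 * d + 12) + (queryTicks E d Δ t L N + 2)

/-- The memory after the initialization with the parameters. -/
noncomputable def initMem (d Δ : ℕ) : Mem where
  n := fun _ => 0
  inp := fun i => if i = 0 then d else if i = 1 then Δ else 0
  arr := fun _ => 0
  r := fun _ => 0
  tab := fun _ => 0

theorem rep_initMem (d Δ : ℕ) : Rep (initMem d Δ) (initState d Δ) where
  n v _ := by simp [initMem, initState]; omega
  inp i := by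
    simp only [initMem, initState]
    split_ifs <;> first | rfl | omega
  arr i := by simp [initMem, initState]
  r _ _ := rfl
  tab _ := rfl

section
variable {E d Δ t L V b N : ℕ}

/-- The memory with a request in place. -/
noncomputable def Mem.present (s : Mem) (q : Request d Δ) : Mem :=
  { s with
    n := Function.update s.n 0 q.code
    inp := fun i => if i < d then q.point.co i else s.inp i
    r := Function.update s.r 0 q.number }

theorem Rep.present {s : Mem} {σ : State} (h : Rep s σ) (q : Request d Δ) :
    Rep (s.present q) (present q σ) where
  n v hv := by
    by_cases h0 : v = 0
    · simp [h0, Mem.present, OneMeans.present]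
    · have h1 : 4 * v ≠ 0 := by omega
      have h2 : ¬ (4 * v % 2 = 1 ∧ 4 * v / 2 < d) := by omega
      simp only [Mem.present, OneMeans.present, h1, if_false, h2, dif_neg, not_false_iff,
        Function.update_of_ne h0, h.n v hv]
  inp i := by
    have h1 : 2 * i + 1 ≠ 0 := by omega
    have h2 : (2 * i + 1) % 2 = 1 := by omega
    have h3 : (2 * i + 1) / 2 = i := by omega
    by_cases hi : i < d
    · simp [Mem.present, OneMeans.present, h2, h3, hi, Grid.co]
    · simp [Mem.present, OneMeans.present, h2, h3, hi, h.inp i]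
  arr i := by
    have h1 : 4 * i + 2 ≠ 0 := by omega
    have h2 : ¬ ((4 * i + 2) % 2 = 1 ∧ (4 * i + 2) / 2 < d) := by omega
    simp only [Mem.present, OneMeans.present, h1, if_false, h2, dif_neg, not_false_iff, h.arr i]
  r v hv := by
    by_cases h0 : v = 0
    · simp [h0, Mem.present, OneMeans.present]
    · have h1 : 2 * v ≠ 0 := by omega
      simp only [Mem.present, OneMeans.present, Function.update_of_ne h0,
        Function.update_of_ne h1, h.r v hv]
  tab i := by
    simp only [Mem.present, OneMeans.present, Function.update_of_ne (Nat.succ_ne_zero (2 * i)),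
      h.tab i]

/-- The invariant of the interaction. -/
def Inv (E t L V b : ℕ) {d Δ : ℕ} (X : WSet d Δ) (σ : State) : Prop :=
  ∃ s, Rep s σ ∧ s.Small b ∧ Holds d Δ t L V s ∧ TabInv E t V d L X s.tab

theorem Params.side_lt (P : Params E d Δ t L V b) : Δ < 2 ^ b := by
  refine P.le_num ?_
  have h1 := P.d_pos
  have h3 := P.E_pos
  calc Δ = 1 * 1 * 1 * 1 * 1 * Δ := by ring
    _ ≤ 20 * E * E * d * d * Δ := by gcongr <;> omega

theorem Setup.init (S : Setup E d Δ t L V b N) (ω : Coins) :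
    Halts ((mainCmd E).comp 0) ω (initState d Δ) ∧
    runCost ((mainCmd E).comp 0) ω (initState d Δ) ≤ ticks E d Δ t L N * (200 * b) ∧
    Inv E t L V b (⟨∅, fun _ => 0⟩ : WSet d Δ)
      (run ((mainCmd E).comp 0) ω (initState d Δ)) := by
  have h5 := S.five_le
  have hV := S.V_le_num
  have hs : (initMem d Δ).Small b := by
    refine ⟨fun v => by simp [initMem], fun i => ?_, fun v => by simp [initMem]⟩
    simp only [initMem]
    split_ifs
    exacts [S.d_lt, S.side_lt, by positivity]
  obtain ⟨h1, h2, s', h3, h4, h6, h7⟩ := (mainCmd_init S.toParams S.t_min S.L_min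
    (s := initMem d Δ) rfl rfl rfl S.side_lt (S.le_num (by omega))).run_comp (ω := ω) (by omega) hs
      (mainCmd_ok S.lit_lt h5) (work_mainCmd E) rfl (rep_initMem d Δ)
  refine ⟨h1, h2.trans (Nat.mul_le_mul_right _ ?_), s', h3, h4, h6, ?_⟩
  · have : (L + 1) * 5 ≤ (L + 1) * (E * (8 * d + 7) + 5) := Nat.mul_le_mul_left _ (by omega)
    unfold ticks
    omega
  · rw [h7]; exact tabInv_empty _

/-- Every state that satisfies the invariant serves every request within the bound, so how the
adversary chooses requests does not matter. -/
theorem Setup.serve (S : Setup E d Δ t L V b N) (ω : Coins) {ε : ℝ} (hε : 0 < ε)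
    (hEε : (E : ℝ) ≤ 33 / ε) {X : WSet d Δ} {σ : State} (h : Inv E t L V b X σ)
    (q : Request d Δ) :
    Halts ((mainCmd E).comp 0) ω (present q σ) ∧
    runCost ((mainCmd E).comp 0) ω (present q σ) ≤ ticks E d Δ t L N * (200 * b) ∧
    Inv E t L V b (q.apply X) (run ((mainCmd E).comp 0) ω (present q σ)) ∧
    ∀ x r, q = .query x r → Answer.Correct 2000 ε X x r
      (readAnswer d (run ((mainCmd E).comp 0) ω (present q σ))) := by
  obtain ⟨s, hr, hs, H, hT⟩ := h
  have h5 := S.five_le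
  have hcode : q.code < 2 ^ b := by
    have : 2 ^ 5 ≤ 2 ^ b := Nat.pow_le_pow_right (by norm_num) h5
    cases q <;> simp only [Request.code] <;> omega
  have hin : ∀ l < d, (s.present q).inp l = q.point.co l := fun l hl => by
    simp [Mem.present, hl]
  have hy : ∀ l < d, (s.present q).inp l ≤ Δ := fun l hl => by
    rw [hin l hl]; exact q.point.co_le hl
  have hs' : (s.present q).Small b := by
    refine ⟨fun v => ?_, fun i => ?_, hs.arr⟩
    · simp only [Mem.present, Function.update_apply]
      split_ifs
      exacts [hcode, hs.n v]
    · by_cases hi : i < d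
      · exact (hy i hi).trans_lt S.side_lt
      · simpa [Mem.present, hi] using hs.inp i
  have H' : Holds d Δ t L V (s.present q) := by
    constructor <;> simp [Mem.present, H.n1, H.n2, H.n3, H.n4, H.n5]
  have hok := mainCmd_ok S.lit_lt h5
  have hr' := hr.present q
  have hnum : (s.present q).r 0 = q.number := by simp [Mem.present]
  have hn0 : (s.present q).n 0 = q.code := by simp [Mem.present]
  have htab : (s.present q).tab = s.tab := rfl
  -- Insertions and deletions run the same code; a deletion comes with the number 0 and sets the
  -- weight to 0.
  have hupd : (q.code = 1 ∨ q.code = 2) →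
      (∀ y, (q.apply X).wt y = if y = q.point then q.number else X.wt y) →
      Halts ((mainCmd E).comp 0) ω (present q σ) ∧
      runCost ((mainCmd E).comp 0) ω (present q σ) ≤ ticks E d Δ t L N * (200 * b) ∧
      Inv E t L V b (q.apply X) (run ((mainCmd E).comp 0) ω (present q σ)) := by
    intro hc hwt
    obtain ⟨h1, h2, s', h3, h4, h6, h7⟩ := (mainCmd_update S.toParams H' hy
      (hn0 ▸ hc)).run_comp (ω := ω) (by omega) hs' hok (work_mainCmd E) rfl hr'
    rw [hnum, htab] at h7
    exact ⟨h1, h2.trans (Nat.mul_le_mul_right _ (Nat.le_add_right _ _)), s', h3, h4, h6,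
      hT.update S.toParams hin hwt h7⟩
  cases q with
  | insert x v =>
    obtain ⟨h1, h2, h3⟩ := hupd (.inl rfl) (wt_apply_insert X x v)
    exact ⟨h1, h2, h3, fun _ _ h => by cases h⟩
  | delete x =>
    obtain ⟨h1, h2, h3⟩ := hupd (.inr rfl) (wt_apply_delete X x)
    exact ⟨h1, h2, h3, fun _ _ h => by cases h⟩
  | query x r =>
    obtain ⟨h1, h2, s', h3, h4, h6, i, j, B, h7⟩ := (mainCmd_query S.toParams H' hs' hy S.t_sq
      S.exp_lt S.queue_lt hn0).run_comp (ω := ω) (by omega) hs' hok (work_mainCmd E) rfl hr'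
    refine ⟨h1, h2.trans (Nat.mul_le_mul_right _ (Nat.le_add_left _ _)),
      ⟨s', h3, h4, h6, fun K l q hl hq => ?_⟩, ?_⟩
    -- Table addresses are positive, so the cost that the query wrote to address 0 does no harm.
    · rw [addr, h7.tab]
      exact hT K l q hl hq
    · rintro x' r' h
      cases h
      -- Real cells 0, 1, 2 represent `r 0`, `tab 0` and `r 1`, because variables and table
      -- alternate.
      refine h7.correct S.toParams hin hnum hT hε hEε (h3.r 0 (by norm_num))
        (fun i => h3.inp i) (h3.tab 0) (h3.r 1 (by norm_num))

theorem Setup.inv (S : Setup E d Δ t L V b N) (ω : Coins) {ε : ℝ} (hε : 0 < ε)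
    (hEε : (E : ℝ) ≤ 33 / ε) (A : Adversary d Δ) (k : ℕ) :
    Inv E t L V b (play ((mainCmd E).comp 0) ω A k).X
      (play ((mainCmd E).comp 0) ω A k).state := by
  induction k with
  | zero => exact (S.init ω).2.2
  | succ k ih => exact (S.serve ω hε hEε ih _).2.2.1

theorem Setup.alwaysCorrect (S : Setup E d Δ t L V b N) (ω : Coins) {ε : ℝ} (hε : 0 < ε)
    (hEε : (E : ℝ) ≤ 33 / ε) (A : Adversary d Δ) :
    AlwaysCorrect ((mainCmd E).comp 0) ω A 2000 ε :=
  ⟨(S.init ω).1, fun k =>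
    ⟨(S.serve ω hε hEε (S.inv ω hε hEε A k) _).1,
      (S.serve ω hε hEε (S.inv ω hε hEε A k) (request _ ω A k)).2.2.2⟩⟩

/-- The bound is worst case for each request, so the amortized statement is mere summation. -/
theorem Setup.withinTime (S : Setup E d Δ t L V b N) (ω : Coins) {ε T : ℝ} (hε : 0 < ε)
    (hEε : (E : ℝ) ≤ 33 / ε) (A : Adversary d Δ)
    (hT : ((ticks E d Δ t L N * (200 * b) : ℕ) : ℝ) ≤ T) :
    WithinTime ((mainCmd E).comp 0) ω A T := by
  have htime : ∀ k, (time ((mainCmd E).comp 0) ω A k : ℝ) ≤ T := fun k =>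
    le_trans (by exact_mod_cast (S.serve ω hε hEε (S.inv ω hε hEε A k) _).2.1) hT
  refine ⟨fun k _ => htime k, fun k => ?_⟩
  intro U
  have h1 : (runCost ((mainCmd E).comp 0) ω (initState d Δ) : ℝ) ≤ T :=
    le_trans (by exact_mod_cast (S.init ω).2.1) hT
  have h2 : ∑ i ∈ U, (time ((mainCmd E).comp 0) ω A i : ℝ) ≤ U.card • T :=
    Finset.sum_le_card_nsmul _ _ _ fun i _ => htime i
  rw [nsmul_eq_mul] at h2
  linarith

end
end OneMeans

namespace OneMeans

/-! ### The choice of the parameters -/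

theorem lt_pow_of_le {x b : ℕ} (h : x ≤ b) : x < 2 ^ b :=
  Nat.lt_two_pow_self.trans_le (Nat.pow_le_pow_right (by norm_num) h)

theorem num_lt_pow {E d Δ p : ℕ} (hE : E ≤ p) (hd : d ≤ p) (hΔ : Δ.size ≤ p) (hp : 8 ≤ p) :
    20 * E * E * d * d * Δ < 2 ^ (6 * p) := by
  have h1 : 20 < 2 ^ p := by
    calc 20 < 2 ^ 8 := by norm_num
      _ ≤ 2 ^ p := Nat.pow_le_pow_right (by norm_num) hp
  have h2 := lt_pow_of_le hE
  have h3 := lt_pow_of_le hd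
  have h4 : Δ < 2 ^ p :=
    (Nat.lt_size_self Δ).trans_le (Nat.pow_le_pow_right (by norm_num) hΔ)
  have e : (2 : ℕ) ^ (6 * p) = 2 ^ p * 2 ^ p * 2 ^ p * 2 ^ p * 2 ^ p * 2 ^ p := by ring
  rw [e]
  gcongr

/-- The quadratic bit bound is forced by the cell numbers, with d digits of at most 6p bits each;
all other integers have O(p) bits. -/
theorem exists_setup {E d Δ p : ℕ} (hE4 : 4 ≤ E) (hd : 1 ≤ d) (hΔ : 2 ≤ Δ)
    (hp : p = d * E * Δ.size) : ∃ t L V N, Setup E d Δ t L V (16 * p * p) N ∧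
      1 ≤ N ∧ (N : ℝ) ≤ Real.exp (2 + 18 * d / E) ∧ t ≤ p ∧ L ≤ 6 * p := by
  have hS : 2 ≤ Δ.size := by
    have : (2 : ℕ).size ≤ Δ.size := Nat.size_le_size hΔ
    exact this
  have hEp : E ≤ p := by
    calc E = 1 * E * 1 := by ring
      _ ≤ _ := by rw [hp]; gcongr; omega
  have hdp : d ≤ p := by
    calc d = d * 1 * 1 := by ring
      _ ≤ _ := by rw [hp]; gcongr <;> omega
  have hSp : Δ.size ≤ p := by
    calc Δ.size = 1 * 1 * Δ.size := by ring
      _ ≤ _ := by rw [hp]; gcongr; omega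
  have hp8 : 8 ≤ p := by
    calc 8 = 1 * 4 * 2 := by norm_num
      _ ≤ _ := by rw [hp]; gcongr
  have hnum := num_lt_pow hEp hdp hSp hp8
  obtain ⟨t, ht1, htd, hdt, hmin, hsq⟩ := exists_budget (E := E) (by omega) hd
  have hex : ∃ L, 4 * E * E * d * Δ ≤ 2 ^ L := ⟨_, Nat.lt_two_pow_self.le⟩
  classical
  set L := Nat.find hex with hLdef
  have hL6 : L ≤ 6 * p := by
    refine Nat.find_min' hex (le_trans ?_ hnum.le)
    calc 4 * E * E * d * Δ = 4 * E * E * d * 1 * Δ := by ring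
      _ ≤ 20 * E * E * d * d * Δ := by gcongr; norm_num
  set V := 4 * E * E * t * Δ + 2 * t + 2 with hV
  set N := ⌊Real.exp (2 + 18 * d / E)⌋₊ with hN
  have hNle : (N : ℝ) ≤ Real.exp (2 + 18 * d / E) := Nat.floor_le (Real.exp_pos _).le
  have hN1 : 1 ≤ N := Nat.le_floor (by simpa using Real.one_le_exp (by positivity))
  have hpp : 8 * p ≤ p * p := Nat.mul_le_mul_right _ hp8
  have hb : ∀ x ≤ 16 * p * p, 2 ^ x ≤ 2 ^ (16 * p * p) := fun x hx =>
    Nat.pow_le_pow_right (by norm_num) hx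
  have hbb : 16 * p * p = 16 * (p * p) := mul_assoc _ _ _
  have hnumb : 20 * E * E * d * d * Δ < 2 ^ (16 * p * p) := hnum.trans_le (hb _ (by omega))
  have hV2 : V ≤ 2 ^ (6 * p) := by
    refine le_trans ?_ hnum.le
    have e1 : 4 * E * E * t * Δ ≤ 4 * (E * E * d * d * Δ) := by
      calc 4 * E * E * t * Δ = 4 * (E * E * t * 1 * Δ) := by ring
        _ ≤ _ := by gcongr
    have e2 : t ≤ E * E * d * d * Δ := by
      calc t = 1 * 1 * t * 1 * 1 := by ring
        _ ≤ _ := by gcongr <;> omega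
    have e3 : 20 * E * E * d * d * Δ = 20 * (E * E * d * d * Δ) := by ring
    omega
  have hkey : (L + 1) * E * V ^ d < 2 ^ (16 * p * p) := by
    have h1 : L + 1 < 2 ^ (7 * p) := lt_pow_of_le (by omega)
    have h2 : E < 2 ^ p := lt_pow_of_le hEp
    have h3 : V ^ d ≤ 2 ^ (6 * p * p) := by
      calc V ^ d ≤ (2 ^ (6 * p)) ^ d := Nat.pow_le_pow_left hV2 d
        _ = 2 ^ (6 * p * d) := by rw [← pow_mul]
        _ ≤ _ := Nat.pow_le_pow_right (by norm_num) (Nat.mul_le_mul_left _ hdp)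
    calc (L + 1) * E * V ^ d < 2 ^ (7 * p) * 2 ^ p * 2 ^ (6 * p * p) :=
          Nat.mul_lt_mul_of_lt_of_le (Nat.mul_lt_mul'' h1 h2) h3 (by positivity)
      _ = 2 ^ (8 * p + 6 * (p * p)) := by ring
      _ ≤ _ := hb _ (by omega)
  have hqueue : (d + 1) * N < 2 ^ (16 * p * p) := by
    have h1 : d + 1 < 2 ^ (p + 1) := lt_pow_of_le (by omega)
    have h2 : N ≤ 2 ^ (2 * (2 + 5 * d)) := by
      have h3 : (N : ℝ) ≤ (2 : ℝ) ^ (2 * (2 + 5 * d)) := by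
        refine hNle.trans ?_
        have hE' : (4 : ℝ) ≤ E := by exact_mod_cast hE4
        calc Real.exp (2 + 18 * d / E) ≤ Real.exp ((2 + 5 * d : ℕ) * 1) := by
              rw [Real.exp_le_exp, mul_one]
              push_cast
              have : (18 * d / E : ℝ) ≤ 5 * d := by
                rw [div_le_iff₀ (by positivity)]
                have : (0 : ℝ) ≤ d := by positivity
                nlinarith
              linarith
          _ = Real.exp 1 ^ (2 + 5 * d) := Real.exp_nat_mul _ _
          _ ≤ 4 ^ (2 + 5 * d) :=
              pow_le_pow_left₀ (Real.exp_pos _).le (by linarith [Real.exp_one_lt_d9]) _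
          _ = _ := by rw [pow_mul]; norm_num
      exact_mod_cast h3
    calc (d + 1) * N < 2 ^ (p + 1) * 2 ^ (2 * (2 + 5 * d)) :=
          Nat.mul_lt_mul_of_lt_of_le h1 h2 (by positivity)
      _ = 2 ^ (p + 1 + 2 * (2 + 5 * d)) := (pow_add _ _ _).symm
      _ ≤ _ := hb _ (by omega)
  refine ⟨t, L, V, N, ⟨⟨hE4, hd, by omega, ht1, hdt, htd, Nat.find_spec hex, rfl, hkey, hnumb,
    by omega⟩, hmin, hsq, fun k hk => ?_, Nat.lt_floor_add_one _, hqueue, by omega⟩, hN1, hNle,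
    htd.trans hdp, hL6⟩
  exact not_le.1 (Nat.find_min hex hk)

theorem ticks_le {E d Δ t L N p : ℕ} (hp : 8 ≤ p) (hE : E ≤ p) (hd : d ≤ p) (hS : Δ.size ≤ p)
    (ht : t ≤ p) (hL : L ≤ 6 * p) (hN : 1 ≤ N) : ticks E d Δ t L N ≤ 300 * N * p ^ 3 := by
  have h1 : (L + 1) * (E * (8 * d + 7) + 5) ≤ 7 * p * (10 * (p * p)) := by
    have : E * (8 * d + 7) ≤ p * (9 * p) := Nat.mul_le_mul hE (by omega)
    refine Nat.mul_le_mul (by omega) ?_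
    have : p * (9 * p) = 9 * (p * p) := by ring
    have : 8 * 8 ≤ p * p := Nat.mul_le_mul hp hp
    omega
  have h2 : E * (5 * d + 8) ≤ p * (6 * p) := Nat.mul_le_mul hE (by omega)
  have h3 : d * (N * (14 * t + 13) + 7) ≤ p * (17 * (N * p)) := by
    refine Nat.mul_le_mul hd ?_
    have e1 : N * (14 * t + 13) ≤ N * (16 * p) := Nat.mul_le_mul_left _ (by omega)
    have e2 : N * (16 * p) = 16 * (N * p) := by ring
    have e3 : 1 * 8 ≤ N * p := Nat.mul_le_mul hN hp
    omega
  have h4 : d * (N * 6 + Δ.size * 4 + 13) ≤ p * (12 * (N * p)) := by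
    refine Nat.mul_le_mul hd ?_
    have e1 : N * 8 ≤ N * p := Nat.mul_le_mul_left _ hp
    have e2 : 1 * p ≤ N * p := Nat.mul_le_mul_right _ hN
    omega
  have hx : p * p * 1 ≤ p * p * (N * p) := Nat.mul_le_mul_left _ (Nat.mul_pos hN (by omega))
  have hx2 : p * 8 ≤ p * p := Nat.mul_le_mul_left _ hp
  have hx3 : 1 * (N * (p * p)) ≤ p * (N * (p * p)) := Nat.mul_le_mul_right _ (by omega)
  have hx4 : 1 * (p * (p * p)) ≤ N * (p * (p * p)) := Nat.mul_le_mul_right _ hN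
  have e : 300 * N * p ^ 3 = 300 * (p * p * (N * p)) := by ring
  have e1 : 7 * p * (10 * (p * p)) = 70 * (p * (p * p)) := by ring
  have e2 : p * (6 * p) = 6 * (p * p) := by ring
  have e3 : p * (17 * (N * p)) = 17 * (N * (p * p)) := by ring
  have e4 : p * (12 * (N * p)) = 12 * (N * (p * p)) := by ring
  have e5 : p * (N * (p * p)) = p * p * (N * p) := by ring
  have e6 : N * (p * (p * p)) = p * p * (N * p) := by ring
  unfold ticks queryTicks
  omega

/-- Since 18 < 32·log 2, the choice of E gives 18/E ≤ ε·log 2; and e² ≤ 8. -/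
theorem exp_bound {E d : ℕ} {ε : ℝ} (hε : 0 < ε) (hE : 32 / ε ≤ E) :
    Real.exp (2 + 18 * d / E) ≤ 8 * (2 : ℝ) ^ (ε * d) := by
  have hE0 : (0 : ℝ) < E := lt_of_lt_of_le (by positivity) hE
  have h1 : Real.exp 2 ≤ 8 := by
    have : Real.exp 2 = Real.exp 1 ^ 2 := by rw [← Real.exp_nat_mul]; norm_num
    rw [this]
    nlinarith [Real.exp_one_lt_d9, Real.exp_pos 1]
  rw [Real.exp_add, Real.rpow_def_of_pos (by norm_num)]
  refine mul_le_mul h1 (Real.exp_le_exp.2 ?_) (Real.exp_pos _).le (by norm_num)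
  rw [div_le_iff₀ hE0]
  have h2 : 32 ≤ E * ε := (div_le_iff₀ hε).1 hE
  have h3 := Real.log_two_gt_d9
  have hd : (0 : ℝ) ≤ d := by positivity
  have h4 : 18 ≤ Real.log 2 * (E * ε) := by nlinarith
  nlinarith [mul_le_mul_of_nonneg_right h4 hd]

/-- The bit length is at most log₂ Δ + 1, and log₂ Δ ≥ 1. -/
theorem size_le_logb {Δ : ℕ} (hΔ : 2 ≤ Δ) : (Δ.size : ℝ) ≤ 2 * Real.logb 2 Δ := by
  obtain ⟨k, hk⟩ : ∃ k, Δ.size = k + 1 :=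
    ⟨Δ.size - 1, by have := Nat.size_pos.2 (show 0 < Δ by omega); omega⟩
  have h1 : 2 ^ k ≤ Δ := by
    by_contra hcon
    have := Nat.size_le.2 (not_le.1 hcon)
    omega
  have hΔ0 : (0 : ℝ) < Δ := by exact_mod_cast (by omega : 0 < Δ)
  have h2 : (k : ℝ) ≤ Real.logb 2 Δ := by
    rw [Real.le_logb_iff_rpow_le (by norm_num) hΔ0, Real.rpow_natCast]
    exact_mod_cast h1
  have h3 : (1 : ℝ) ≤ Real.logb 2 Δ := by
    rw [Real.le_logb_iff_rpow_le (by norm_num) hΔ0, Real.rpow_one]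
    exact_mod_cast hΔ
  rw [hk]; push_cast; linarith

end OneMeans

/-! ### Assembly of the theorem -/

theorem mainTheorem8 :
    ∃ K : ℝ, ∀ κ : ℕ, ∃ C : ℕ, ∀ ε : ℝ, 0 < ε → ε < 1 →
      ∃ P : OneMeans.Program, ∀ d Δ : ℕ, 1 ≤ d → 2 ≤ Δ → ∀ A : OneMeans.Adversary d Δ,
        (∀ ω : OneMeans.Coins, OneMeans.AlwaysCorrect P ω A K ε) ∧
        OneMeans.coinMeasure {ω | ¬ OneMeans.WithinTime P ω A
            (C * (2 : ℝ) ^ (ε * d) * (d * ε⁻¹ * Real.logb 2 Δ) ^ C)} ≤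
          ENNReal.ofReal (((Δ : ℝ) ^ (κ * d))⁻¹) := by
  refine ⟨2000, fun _ => ?_⟩
  -- Ticks 300Np³ times 200·16p² per tick give 960000·N·p⁵; then N ≤ 8·2^(εd) and p ≤ 66x, where x =
  -- d·ε⁻¹·log₂ Δ ≥ 1 allows the exponent 5 to be raised to C.
  obtain ⟨C, hC5, hC⟩ : ∃ C : ℕ, 5 ≤ C ∧ (960000 * 8 * 66 ^ 5 : ℝ) ≤ C :=
    ⟨960000 * 8 * 66 ^ 5, by norm_num, by norm_num⟩
  refine ⟨C, fun ε hε hε1 => ?_⟩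
  -- `E` depends on ε alone, so it can be a literal of the program.
  set E := ⌈32 / ε⌉₊ with hEdef
  have hE1 : 32 / ε ≤ E := Nat.le_ceil _
  have hinv : 1 ≤ 1 / ε := (one_le_div hε).2 hε1.le
  have hE2 : (E : ℝ) ≤ 33 / ε := by
    have h1 : (E : ℝ) < 32 / ε + 1 := Nat.ceil_lt_add_one (by positivity)
    have h2 : 33 / ε = 32 / ε + 1 / ε := by ring
    linarith
  have hE4 : 4 ≤ E := by
    have h1 : (32 : ℝ) ≤ E := le_trans (by rw [le_div_iff₀ hε]; linarith) hE1
    have h2 : 32 ≤ E := by exact_mod_cast h1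
    omega
  refine ⟨(OneMeans.mainCmd E).comp 0, fun d Δ hd hΔ A => ?_⟩
  obtain ⟨t, L, V, N, S, hN1, hN, htp, hLp⟩ := OneMeans.exists_setup hE4 hd hΔ rfl
  refine ⟨fun ω => S.alwaysCorrect ω hε hE2 A, ?_⟩
  have hT : ((OneMeans.ticks E d Δ t L N * (200 * (16 * (d * E * Δ.size) * (d * E * Δ.size))) :
      ℕ) : ℝ) ≤ C * (2 : ℝ) ^ (ε * d) * (d * ε⁻¹ * Real.logb 2 Δ) ^ C := by
    set p := d * E * Δ.size with hp
    set x := d * ε⁻¹ * Real.logb 2 Δ with hx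
    have hS : 2 ≤ Δ.size := Nat.size_le_size hΔ
    have hEp : E ≤ p := by
      calc E = 1 * E * 1 := by ring
        _ ≤ _ := by rw [hp]; gcongr; omega
    have hdp : d ≤ p := by
      calc d = d * 1 * 1 := by ring
        _ ≤ _ := by rw [hp]; gcongr <;> omega
    have hSp : Δ.size ≤ p := by
      calc Δ.size = 1 * 1 * Δ.size := by ring
        _ ≤ _ := by rw [hp]; gcongr; omega
    have hp8 : 8 ≤ p := by
      calc 8 = 1 * 4 * 2 := by norm_num
        _ ≤ _ := by rw [hp]; gcongr
    have hticks := OneMeans.ticks_le (Δ := Δ) hp8 hEp hdp hSp htp hLp hN1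
    have hlog := OneMeans.size_le_logb hΔ
    have hlog1 : 1 ≤ Real.logb 2 Δ := by
      have : (2 : ℝ) ≤ Δ.size := by exact_mod_cast hS
      linarith
    have hd1 : (1 : ℝ) ≤ d := by exact_mod_cast hd
    have hx1 : 1 ≤ x := by
      rw [one_div] at hinv
      exact one_le_mul_of_one_le_of_one_le (one_le_mul_of_one_le_of_one_le hd1 hinv) hlog1
    have hpx : (p : ℝ) ≤ 66 * x := by
      calc (p : ℝ) = d * E * Δ.size := by rw [hp]; push_cast; ring
        _ ≤ d * (33 / ε) * (2 * Real.logb 2 Δ) := by gcongr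
        _ = 66 * x := by rw [hx]; ring
    have hNle := hN.trans (OneMeans.exp_bound (d := d) hε hE1)
    calc ((OneMeans.ticks E d Δ t L N * (200 * (16 * p * p)) : ℕ) : ℝ)
        ≤ ((300 * N * p ^ 3 * (200 * (16 * p * p)) : ℕ) : ℝ) := by
          exact_mod_cast Nat.mul_le_mul_right _ hticks
      _ = 960000 * N * (p : ℝ) ^ 5 := by push_cast; ring
      _ ≤ 960000 * (8 * (2 : ℝ) ^ (ε * d)) * (66 * x) ^ 5 := by gcongr
      _ = 960000 * 8 * 66 ^ 5 * (2 : ℝ) ^ (ε * d) * x ^ 5 := by ring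
      _ ≤ C * (2 : ℝ) ^ (ε * d) * x ^ C := by gcongr
  -- The time bound holds for every tape.
  have hempty : {ω | ¬ OneMeans.WithinTime ((OneMeans.mainCmd E).comp 0) ω A
      (C * (2 : ℝ) ^ (ε * d) * (d * ε⁻¹ * Real.logb 2 Δ) ^ C)} = ∅ := by
    ext ω
    simpa using S.withinTime ω hε hE2 A hT
  rw [hempty, MeasureTheory.measure_empty]
  exact zero_le
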